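/- Let $q>0$ (the elementary charge), $n\in\mathbb Z$, and $z=n^2q^2/\pi$. Let $\mathcal H_n$ be the eigenspace of the total charge $Q$ with eigenvalue $nq$ in the Hilbert space of Staruszkiewicz's quantum Coulomb field, realized in a fixed Lorentz frame with time-like unit vector $u$: $\mathcal H_n$ is $e^{-inS(u)}$ times the bosonic Fock space generated from the vacuum by the creation operators $c^+_{l,m}$ ($l\ge 1$, $-l\le m\le l$) with $[c_\alpha,c_\beta^+]=4\pi q^2\delta_{\alpha\beta}$, and $|u\rangle=e^{-inS(u)}|0\rangle$. Let $U$ be the unitary representation of $SL(2,\mathbb C)$ on $\mathcal H_n$ which implements $U(g)c_\alpha U(g)^{-1}=\sum_\beta c_\beta A_{\beta\alpha}(g)+B_\alpha(g)Q$, where $A$ is the matrix of the irreducible unitary representation $(l_0,l_1)=(1,0)$ and $B$ is determined by $B(gh)=B(g)A(h)+B(h)$, $B|_{SU(2)}=0$ and $B_{l,m}(g_{03}(\lambda))=iq\sqrt{8/3}\int_0^\lambda A_{1,0\;l,m}(g_{03}(\lambda'))\,d\lambda'$; here $g_{03}(\lambda)$ is the hyperbolic rotation in the $03$-plane with hyperbolic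 angle $\lambda$, and $U(\lambda)=U(g_{03}(\lambda))$. Suppose $0<z<1$. Then the limit (in norm) $$|u,\infty\rangle=\lim_{\lambda\to+\infty}c_\lambda\int_{SU(2)}U(a)U(\lambda)|u\rangle\,da,\qquad c_\lambda=\frac{\sqrt2\,\sinh\lambda}{\Big[\int_0^{2\lambda}\sinh x\;e^{-z(x\coth x-1)}\,dx\Big]^{1/2}},$$ with $da$ the normalized invariant measure, exists and is a unit vector. For every integer $l\ge1$ the function $F_l(\sigma)=\langle u,\infty|U(\sigma)c^+_{l,0}|u\rangle$ of the hyperbolic angle $\sigma\in\mathbb R$ is nonzero for Lebesgue almost every $\sigma$; moreover $F_l$ is real analytic at $\sigma=0$ and its Taylor expansion there begins in order $l$: there is a constant $C_l\ne0$ with $F_l(\sigma)=C_l\,\sigma^l+O(\sigma^{l+2})$ as $\sigma\to0$. -/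

import Mathlib

open MeasureTheory Filter Topology Asymptotics
open scoped ENNReal InnerProductSpace ComplexConjugate MatrixGroups

/-!
Setting. In a fixed Lorentz frame with time-like unit vector `u`, the Hilbert space of the quantum
Coulomb field is the tensor product of the square summable functions on the circle (carrying the
phase `S(u)` and the charge `Q`) with the bosonic Fock space of the transversal infrared photons.
As `S(u)` commutes with all `c_α, c_α⁺`, the eigenspace of `Q` with eigenvalue `n q` (`q` is the
elementary charge) is `exp(-i n S(u))` times the Fock space and is identified with the Fock space
below; the vector `|u⟩ = exp(-i n S(u))|0⟩` is then the Fock vacuum.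

* One-photon space: the irreducible unitary representation `(l₀, l₁) = (1, 0)` of `SL(2, ℂ)`, in
  its realization by square integrable functions on `ℂ`.  A function `F` on the celestial sphere
  `ℂ ∪ {∞}` (homogeneous of degree zero on the light cone, modulo constants) with the invariant
  product `∫ conj F₁ (-Δ) F₂` corresponds to a multiple of `∂F/∂ζ` in `L²(ℂ)`.
* `U(g)` is the unitary operator on the sector which implements the inhomogeneous
  transformation `c_α ↦ ∑ c_β A_{βα}(g) + B_α(g) Q`.
-/

noncomputable section
namespace CoulombField

section Fock
variable {K : Type} [NormedAddCommGroup K] [InnerProductSpace ℂ K]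

variable (K) in
/-- The kernel `exp ⟪φ, ψ⟫` on a Hilbert space `K`. -/
def expKernel : Matrix K K (ℂ →L[ℂ] ℂ) :=
  Matrix.of fun φ ψ => Complex.exp ⟪φ, ψ⟫_ℂ • ContinuousLinearMap.id ℂ ℂ

variable (K) in
theorem exists_tensorPower (n : ℕ) :
    ∃ (E : Type) (_ : NormedAddCommGroup E) (_ : InnerProductSpace ℂ E) (f : K → E),
      ∀ φ ψ, ⟪f φ, f ψ⟫_ℂ = ⟪φ, ψ⟫_ℂ ^ n := by
  induction n with
  | zero => exact ⟨ℂ, inferInstance, inferInstance, fun _ => 1, fun φ ψ => by simp⟩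
  | succ n ih =>
    obtain ⟨E, _, _, f, hf⟩ := ih
    refine ⟨TensorProduct ℂ E K, inferInstance, inferInstance, fun φ => f φ ⊗ₜ φ, fun φ ψ => ?_⟩
    rw [TensorProduct.inner_tmul, hf, pow_succ]

theorem posSemidef_expKernel : (expKernel K).PosSemidef := by
  refine ((RKHS.posSemidef_tfae (K := expKernel K)).out 0 2 rfl rfl).2 ⟨?_, fun vv => ?_⟩
  · ext φ ψ
    rw [Matrix.conjTranspose_apply]
    simp only [expKernel, Matrix.of_apply, star_smul, RCLike.star_def, ← Complex.exp_conj,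
      inner_conj_symm]
    have h1 : star (ContinuousLinearMap.id ℂ ℂ) = ContinuousLinearMap.id ℂ ℂ :=
      star_one (ℂ →L[ℂ] ℂ)
    rw [h1]
  · have key : ∀ n : ℕ, 0 ≤ (vv.sum fun φ a => vv.sum fun ψ b =>
        (starRingEnd ℂ) (⟪ψ, φ⟫_ℂ ^ n * a) * b).re := by
      intro n
      obtain ⟨E, _, _, f, hf⟩ := exists_tensorPower K n
      have h : (vv.sum fun φ a => vv.sum fun ψ b =>
          (starRingEnd ℂ) (⟪ψ, φ⟫_ℂ ^ n * a) * b)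
          = ⟪vv.sum fun φ a => a • f φ, vv.sum fun φ a => a • f φ⟫_ℂ := by
        simp only [inner_smul_left, inner_smul_right,
          Finsupp.sum, Finset.mul_sum, sum_inner, inner_sum]
        rw [Finset.sum_comm]
        refine Finset.sum_congr rfl fun φ _ => Finset.sum_congr rfl fun ψ _ => ?_
        rw [map_mul, ← hf, inner_conj_symm]
        ring
      rw [h]
      exact inner_self_nonneg (𝕜 := ℂ)
    have hs : HasSum (fun n : ℕ => ((n.factorial : ℝ))⁻¹ * (vv.sum fun φ a => vv.sum fun ψ b =>
        (starRingEnd ℂ) (⟪ψ, φ⟫_ℂ ^ n * a) * b).re)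
        (vv.sum fun φ a => vv.sum fun ψ b =>
          (starRingEnd ℂ) (Complex.exp ⟪ψ, φ⟫_ℂ * a) * b).re := by
      have : HasSum (fun n : ℕ => ((n.factorial : ℂ))⁻¹ * (vv.sum fun φ a => vv.sum fun ψ b =>
        (starRingEnd ℂ) (⟪ψ, φ⟫_ℂ ^ n * a) * b))
        (vv.sum fun φ a => vv.sum fun ψ b =>
          (starRingEnd ℂ) (Complex.exp ⟪ψ, φ⟫_ℂ * a) * b) := by
        simp only [Finsupp.sum, Finset.mul_sum]
        refine hasSum_sum fun φ _ => hasSum_sum fun ψ _ => ?_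
        have h1 := (NormedSpace.expSeries_div_hasSum_exp (𝔸 := ℂ) ⟪ψ, φ⟫_ℂ)
        rw [← Complex.exp_eq_exp_ℂ] at h1
        have h2 := ((Complex.hasSum_conj'.2 h1).mul_right
          ((starRingEnd ℂ) (vv φ))).mul_right (vv ψ)
        convert! h2 using 1
        · ext k
          simp
          ring
        · simp
      have h3 := Complex.hasSum_re this
      convert h3 using 2
      rw [← Complex.re_ofReal_mul]; push_cast; rfl
    have h0 := hs.nonneg fun n => mul_nonneg (by positivity) (key n)
    simpa [expKernel, mul_comm] using h0

instance : Fact (expKernel K).PosSemidef := ⟨posSemidef_expKernel⟩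

variable (K) in
/-- The bosonic Fock space over `K`, as the reproducing kernel Hilbert space of the kernel
`exp ⟪φ, ψ⟫` (functions on `K`; the `m`-particle vectors are the homogeneous functions of
degree `m`). -/
abbrev Fock : Type := RKHS.OfKernel (expKernel K)

/-- The exponential (unnormalized coherent) vector `∑ φ^{⊗ m} / √(m!)`. -/
def expVec (φ : K) : Fock K := RKHS.kerFun (Fock K) φ 1

theorem expVec_apply (φ ψ : K) : expVec ψ φ = Complex.exp ⟪φ, ψ⟫_ℂ := by
  rw [expVec, RKHS.kerFun_apply, RKHS.OfKernel.kernel_ofKernel]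
  simp [expKernel]

theorem inner_expVec (φ ψ : K) : ⟪expVec φ, expVec ψ⟫_ℂ = Complex.exp ⟪φ, ψ⟫_ℂ := by
  rw [expVec, RKHS.kerFun_inner, expVec_apply]; simp


theorem span_expVec_dense : (Submodule.span ℂ (Set.range (expVec (K := K)))).topologicalClosure = ⊤ := by
  rw [eq_top_iff, ← RKHS.kerFun_dense (Fock K)]
  refine Submodule.topologicalClosure_mono (Submodule.span_le.2 ?_)
  rintro _ ⟨φ, v, rfl⟩
  have : RKHS.kerFun (Fock K) φ v = v • expVec φ := by
    rw [expVec, ← map_smul, smul_eq_mul, mul_one]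
  rw [this]
  exact Submodule.smul_mem _ _ (Submodule.subset_span ⟨φ, rfl⟩)

theorem denseRange_of_span_le {w : K → Fock K}
    (h : ∀ φ, expVec φ ∈ Submodule.span ℂ (Set.range w)) :
    DenseRange (Finsupp.linearCombination ℂ w) := by
  have h1 : Submodule.span ℂ (Set.range (expVec (K := K))) ≤ Submodule.span ℂ (Set.range w) :=
    Submodule.span_le.2 (by rintro _ ⟨φ, rfl⟩; exact h φ)
  rw [DenseRange, dense_iff_closure_eq, ← LinearMap.coe_range, Finsupp.range_linearCombination,
    ← Submodule.topologicalClosure_coe, Submodule.coe_eq_univ, eq_top_iff, ← span_expVec_dense]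
  exact Submodule.topologicalClosure_mono h1

/-- The image of `expVec φ` under the second quantization of `T` followed by the Weyl
displacement operator of `b`. -/
def affineVec (T : K ≃ₗᵢ[ℂ] K) (b φ : K) : Fock K :=
  Complex.exp (-(‖b‖ ^ 2 / 2 : ℝ) - ⟪b, T φ⟫_ℂ) • expVec (T φ + b)

theorem inner_affineVec (T : K ≃ₗᵢ[ℂ] K) (b φ ψ : K) :
    ⟪affineVec T b φ, affineVec T b ψ⟫_ℂ = Complex.exp ⟪φ, ψ⟫_ℂ := by
  rw [affineVec, affineVec, inner_smul_left, inner_smul_right, inner_expVec, ← Complex.exp_conj,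
    ← Complex.exp_add, ← Complex.exp_add]
  congr 1
  rw [map_sub, map_neg, Complex.conj_ofReal, inner_conj_symm, inner_add_left, inner_add_right,
    inner_add_right, T.inner_map_map, inner_self_eq_norm_sq_to_K]
  push_cast
  simp
  ring

theorem inner_linearCombination (w : K → Fock K)
    (hw : ∀ φ ψ, ⟪w φ, w ψ⟫_ℂ = Complex.exp ⟪φ, ψ⟫_ℂ) (f : K →₀ ℂ) :
    ⟪Finsupp.linearCombination ℂ w f, Finsupp.linearCombination ℂ w f⟫_ℂ =
      ∑ φ ∈ f.support, ∑ ψ ∈ f.support, conj (f φ) * (f ψ * Complex.exp ⟪φ, ψ⟫_ℂ) := by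
  simp only [Finsupp.linearCombination_apply, Finsupp.sum, sum_inner, inner_sum, inner_smul_left,
    inner_smul_right, hw, Finset.mul_sum]
  rw [Finset.sum_comm]
  exact Finset.sum_congr rfl fun φ _ => Finset.sum_congr rfl fun ψ _ => by ring

theorem denseRange_expVec : DenseRange (Finsupp.linearCombination ℂ (expVec (K := K))) :=
  denseRange_of_span_le fun φ => Submodule.subset_span ⟨φ, rfl⟩

theorem denseRange_affineVec (T : K ≃ₗᵢ[ℂ] K) (b : K) :
    DenseRange (Finsupp.linearCombination ℂ (affineVec T b)) :=
  denseRange_of_span_le fun φ => by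
    have h : expVec φ = (Complex.exp (-(‖b‖ ^ 2 / 2 : ℝ) - ⟪b, φ - b⟫_ℂ))⁻¹ •
        affineVec T b (T.symm (φ - b)) := by
      rw [affineVec, T.apply_symm_apply, sub_add_cancel, smul_smul,
        inv_mul_cancel₀ (Complex.exp_ne_zero _), one_smul]
    rw [h]
    exact Submodule.smul_mem _ _ (Submodule.subset_span ⟨_, rfl⟩)

theorem norm_linearCombination_affineVec (T : K ≃ₗᵢ[ℂ] K) (b : K) (f : K →₀ ℂ) :
    ‖Finsupp.linearCombination ℂ (affineVec T b) (LinearEquiv.refl ℂ (K →₀ ℂ) f)‖ =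
      ‖Finsupp.linearCombination ℂ expVec f‖ := by
  have h : ⟪Finsupp.linearCombination ℂ (affineVec T b) f,
      Finsupp.linearCombination ℂ (affineVec T b) f⟫_ℂ =
      ⟪Finsupp.linearCombination ℂ expVec f, Finsupp.linearCombination ℂ expVec f⟫_ℂ := by
    rw [inner_linearCombination _ (inner_affineVec T b),
      inner_linearCombination _ inner_expVec]
  rw [inner_self_eq_norm_sq_to_K, inner_self_eq_norm_sq_to_K] at h
  rw [LinearEquiv.refl_apply]
  exact (sq_eq_sq₀ (norm_nonneg _) (norm_nonneg _)).1 (by exact_mod_cast h)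

/-- The unitary operator on Fock space: second quantization of `T` followed by the Weyl
displacement operator of `b`; it is determined by `affineUnitary_expVec`. -/
def affineUnitary (T : K ≃ₗᵢ[ℂ] K) (b : K) : Fock K ≃ₗᵢ[ℂ] Fock K :=
  (LinearEquiv.refl ℂ (K →₀ ℂ)).extendOfIsometry
    (Finsupp.linearCombination ℂ expVec) (Finsupp.linearCombination ℂ (affineVec T b))
    denseRange_expVec (denseRange_affineVec T b) (norm_linearCombination_affineVec T b)

theorem affineUnitary_expVec (T : K ≃ₗᵢ[ℂ] K) (b φ : K) :
    affineUnitary T b (expVec φ) =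
      Complex.exp (-(‖b‖ ^ 2 / 2 : ℝ) - ⟪b, T φ⟫_ℂ) • expVec (T φ + b) := by
  have h := LinearEquiv.extendOfIsometry_eq (LinearEquiv.refl ℂ (K →₀ ℂ))
    (Finsupp.linearCombination ℂ expVec) (Finsupp.linearCombination ℂ (affineVec T b))
    denseRange_expVec (denseRange_affineVec T b) (norm_linearCombination_affineVec T b)
    (Finsupp.single φ 1)
  simpa [affineVec, affineUnitary] using h

theorem apply_eq_inner (F : Fock K) (φ : K) : F φ = ⟪expVec φ, F⟫_ℂ := by
  rw [expVec, RKHS.kerFun_inner]; simp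

theorem continuous_expVec : Continuous (expVec (K := K)) := by
  rw [continuous_iff_continuousAt]
  intro ψ
  rw [ContinuousAt, tendsto_iff_norm_sub_tendsto_zero]
  have h : ∀ φ : K, ‖expVec φ - expVec ψ‖ =
      √(Complex.exp ⟪φ, φ⟫_ℂ - Complex.exp ⟪ψ, φ⟫_ℂ - Complex.exp ⟪φ, ψ⟫_ℂ
        + Complex.exp ⟪ψ, ψ⟫_ℂ).re := by
    intro φ
    rw [norm_eq_sqrt_re_inner (𝕜 := ℂ)]
    simp only [inner_sub_left, inner_sub_right, inner_expVec]
    rw [← sub_add]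
    rfl
  simp_rw [h]
  have hc : Continuous fun φ : K => √(Complex.exp ⟪φ, φ⟫_ℂ - Complex.exp ⟪ψ, φ⟫_ℂ
      - Complex.exp ⟪φ, ψ⟫_ℂ + Complex.exp ⟪ψ, ψ⟫_ℂ).re := by fun_prop
  have := hc.tendsto ψ
  simpa using this

variable (K) in
/-- The Fock vacuum. -/
def vacuum : Fock K := expVec 0

theorem vacuum_apply (φ : K) : vacuum K φ = 1 := by
  rw [vacuum, expVec_apply]; simp

/-- The standard creation operator `a⁺(e)`, normalized by `[a(e), a⁺(e')] = ⟪e, e'⟫`, with its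
maximal domain: multiplication by the function `φ ↦ ⟪φ, e⟫`. -/
def creation (e : K) : Fock K →ₗ.[ℂ] Fock K where
  domain :=
    { carrier := {F | ∃ G : Fock K, ∀ φ, G φ = ⟪φ, e⟫_ℂ * F φ}
      add_mem' := by
        rintro F₁ F₂ ⟨G₁, h₁⟩ ⟨G₂, h₂⟩
        exact ⟨G₁ + G₂, fun φ => by simp [h₁, h₂, mul_add]⟩
      zero_mem' := ⟨0, fun φ => by simp⟩
      smul_mem' := by
        rintro c F ⟨G, h⟩
        exact ⟨c • G, fun φ => by simp [h, mul_left_comm]⟩ }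
  toFun :=
    { toFun := fun F => F.2.choose
      map_add' := fun F₁ F₂ => RKHS.ext fun φ => by
        rw [(F₁ + F₂).2.choose_spec φ, RKHS.coe_add, Pi.add_apply, F₁.2.choose_spec φ,
          F₂.2.choose_spec φ]
        simp [mul_add]
      map_smul' := fun c F => RKHS.ext fun φ => by
        rw [(c • F).2.choose_spec φ, RingHom.id_apply, RKHS.coe_smul, Pi.smul_apply,
          F.2.choose_spec φ]
        simp [mul_left_comm] }

theorem creation_apply (e : K) (F : (creation e).domain) (φ : K) :
    creation e F φ = ⟪φ, e⟫_ℂ * (F : Fock K) φ :=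
  F.2.choose_spec φ

theorem vacuum_mem_creation_domain (e : K) : vacuum K ∈ (creation e).domain := by
  refine ⟨(2 * Real.pi : ℂ)⁻¹ • ∫ θ in (0 : ℝ)..2 * Real.pi,
    Complex.exp (-(θ * Complex.I)) • expVec (Complex.exp (θ * Complex.I) • e), fun φ => ?_⟩
  rw [vacuum_apply, mul_one, apply_eq_inner, inner_smul_right]
  have hc : Continuous fun θ : ℝ =>
      Complex.exp (-(θ * Complex.I)) • expVec (Complex.exp (θ * Complex.I) • e) :=
    (by fun_prop : Continuous fun θ : ℝ => Complex.exp (-(θ * Complex.I))).smul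
      (continuous_expVec.comp (by fun_prop))
  have h1 := (innerSL ℂ (expVec φ)).intervalIntegral_comp_comm
    (hc.intervalIntegrable (μ := volume) 0 (2 * Real.pi))
  simp only [innerSL_apply_apply] at h1
  rw [← h1]
  simp only [inner_smul_right, inner_expVec]
  set w := ⟪φ, e⟫_ℂ
  have h2 := DiffContOnCl.deriv_eq_smul_circleIntegral (f := fun t : ℂ => Complex.exp (t * w))
    (c := 0) one_pos
    (Differentiable.diffContOnCl (by fun_prop))
  have h3 : deriv (fun t : ℂ => Complex.exp (t * w)) 0 = w := by
    have : HasDerivAt (fun t : ℂ => Complex.exp (t * w)) w 0 := by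
      simpa using ((hasDerivAt_id (0 : ℂ)).mul_const w).cexp
    exact this.deriv
  rw [h3, circleIntegral] at h2
  have h4 : ∀ θ : ℝ, deriv (circleMap 0 1) θ • (1 / (circleMap 0 1 θ - 0) ^ 2) •
      Complex.exp (circleMap 0 1 θ * w) = Complex.I *
      (Complex.exp (-(θ * Complex.I)) * Complex.exp (Complex.exp (θ * Complex.I) * w)) := by
    intro θ
    rw [deriv_circleMap, Complex.exp_neg]
    have := Complex.exp_ne_zero (θ * Complex.I)
    simp [circleMap]
    field_simp
  simp only [h4, intervalIntegral.integral_const_mul] at h2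
  have hpi : (Real.pi : ℂ) ≠ 0 := by exact_mod_cast Real.pi_ne_zero
  rw [inv_mul_eq_iff_eq_mul₀ (by simp)]
  refine mul_left_cancel₀ Complex.I_ne_zero (h2.trans ?_)
  rw [smul_eq_mul]
  ring

end Fock

/-- The one-photon Hilbert space. -/
abbrev Photon : Type := Lp ℂ 2 (volume : Measure ℂ)

section Moebius
variable (g h : SL(2, ℂ))

/-- The action of `SL(2, ℂ)` on the celestial sphere. -/
def moebius (ζ : ℂ) : ℂ := (g 0 0 * ζ + g 0 1) / (g 1 0 * ζ + g 1 1)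

/-- The complex derivative of `moebius g`. -/
def moebiusDeriv (ζ : ℂ) : ℂ := ((g 1 0 * ζ + g 1 1) ^ 2)⁻¹

theorem det_eq : g 0 0 * g 1 1 - g 0 1 * g 1 0 = 1 := by
  have := g.det_coe
  rwa [Matrix.det_fin_two] at this

theorem ae_denom_ne : ∀ᵐ ζ : ℂ, g 1 0 * ζ + g 1 1 ≠ 0 := by
  have hd := det_eq g
  by_cases hc : g 1 0 = 0
  · refine Eventually.of_forall fun ζ h0 => ?_
    rw [hc] at hd h0
    simp only [zero_mul, zero_add] at h0
    rw [h0] at hd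
    simp at hd
  · have : {ζ : ℂ | ¬ (g 1 0 * ζ + g 1 1 ≠ 0)} ⊆ {-(g 1 1) / g 1 0} := by
      intro ζ hζ
      simp only [ne_eq, not_not, Set.mem_ofPred_eq] at hζ
      rw [Set.mem_singleton_iff, eq_div_iff hc]
      linear_combination hζ
    exact measure_mono_null this (measure_singleton _)

theorem hasDerivAt_moebius {ζ : ℂ} (hζ : g 1 0 * ζ + g 1 1 ≠ 0) :
    HasDerivAt (moebius g) (moebiusDeriv g ζ) ζ := by
  have h1 : HasDerivAt (fun ζ : ℂ => g 0 0 * ζ + g 0 1) (g 0 0) ζ := by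
    simpa using ((hasDerivAt_id ζ).const_mul (g 0 0)).add_const (g 0 1)
  have h2 : HasDerivAt (fun ζ : ℂ => g 1 0 * ζ + g 1 1) (g 1 0) ζ := by
    simpa using ((hasDerivAt_id ζ).const_mul (g 1 0)).add_const (g 1 1)
  refine (h1.div h2 hζ).congr_deriv ?_
  rw [moebiusDeriv, div_eq_mul_inv]
  have : g 0 0 * (g 1 0 * ζ + g 1 1) - (g 0 0 * ζ + g 0 1) * g 1 0 = 1 := by
    linear_combination det_eq g
  rw [this, one_mul]

theorem mul_apply (i j : Fin 2) : (g * h) i j = g i 0 * h 0 j + g i 1 * h 1 j := by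
  simp [Matrix.mul_apply, Fin.sum_univ_two]

theorem moebius_mul {ζ : ℂ} (hζ : h 1 0 * ζ + h 1 1 ≠ 0) :
    moebius (g * h) ζ = moebius g (moebius h ζ) := by
  simp only [moebius, mul_apply]
  rw [← mul_div_mul_right (g 0 0 * ((h 0 0 * ζ + h 0 1) / (h 1 0 * ζ + h 1 1)) + g 0 1) _ hζ]
  congr 1 <;> field_simp <;> ring

theorem moebiusDeriv_mul {ζ : ℂ} (hζ : h 1 0 * ζ + h 1 1 ≠ 0) :
    moebiusDeriv (g * h) ζ = moebiusDeriv h ζ * moebiusDeriv g (moebius h ζ) := by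
  simp only [moebius, moebiusDeriv, mul_apply]
  rw [← mul_inv, ← mul_pow]
  congr 2
  field_simp
  ring

theorem moebius_one : moebius 1 = id := by
  ext ζ; simp [moebius]

theorem moebiusDeriv_one (ζ : ℂ) : moebiusDeriv 1 ζ = 1 := by
  simp [moebiusDeriv]

theorem measurable_moebius : Measurable (moebius g) := by
  unfold moebius; fun_prop

theorem measurable_moebiusDeriv : Measurable (moebiusDeriv g) := by
  unfold moebiusDeriv; fun_prop

theorem lintegral_moebius (F : ℂ → ℝ≥0∞) :
    ∫⁻ ζ, ‖moebiusDeriv g ζ‖ₑ ^ 2 * F (moebius g ζ) = ∫⁻ ζ, F ζ := by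
  set s : Set ℂ := {ζ | g 1 0 * ζ + g 1 1 ≠ 0} with hs
  have hsm : MeasurableSet s := by
    apply MeasurableSet.compl
    exact measurableSet_eq_fun (by fun_prop) measurable_const
  have himg : moebius g '' s =ᵐ[volume] (Set.univ : Set ℂ) := by
    rw [eventuallyEq_univ]
    filter_upwards [ae_denom_ne g⁻¹] with w hw
    refine ⟨moebius g⁻¹ w, ?_, ?_⟩
    · intro h0
      have h1 : (g * g⁻¹) 1 0 * w + (g * g⁻¹) 1 1 = 0 := by
        rw [mul_apply, mul_apply]
        rw [moebius] at h0
        rw [mul_div_assoc', div_add' _ _ _ hw, div_eq_zero_iff, or_iff_left hw] at h0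
        linear_combination h0
      simp at h1
    · rw [← moebius_mul _ _ hw, mul_inv_cancel, moebius_one]; rfl
  have hinj : Set.InjOn (moebius g) s := by
    intro x hx y hy hxy
    have := congrArg (moebius g⁻¹) hxy
    rwa [← moebius_mul _ _ hx, ← moebius_mul _ _ hy, inv_mul_cancel, moebius_one] at this
  have hsu : s =ᵐ[volume] (Set.univ : Set ℂ) := by
    rw [eventuallyEq_univ]; exact ae_denom_ne g
  have key := lintegral_image_eq_lintegral_abs_det_fderiv_mul volume hsm
    (fun ζ hζ => ((hasDerivAt_moebius g hζ).hasFDerivAt.restrictScalars ℝ).hasFDerivWithinAt)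
    hinj F
  rw [setLIntegral_congr himg, setLIntegral_congr hsu, setLIntegral_univ, setLIntegral_univ] at key
  rw [key]
  refine lintegral_congr fun ζ => ?_
  congr 1
  have : (ContinuousLinearMap.restrictScalars ℝ
      (ContinuousLinearMap.toSpanSingleton ℂ (moebiusDeriv g ζ))).det
      = ‖moebiusDeriv g ζ‖ ^ 2 := by
    rw [ContinuousLinearMap.det]
    change LinearMap.det (LinearMap.restrictScalars ℝ
      (ContinuousLinearMap.toSpanSingleton ℂ (moebiusDeriv g ζ) : ℂ →ₗ[ℂ] ℂ)) = _
    rw [LinearMap.det_restrictScalars, LinearMap.det_ring]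
    simp [Algebra.norm_complex_apply, Complex.normSq_eq_norm_sq]
  rw [this, abs_of_nonneg (by positivity), ENNReal.ofReal_pow (norm_nonneg _), ofReal_norm]

theorem quasiMeasurePreserving_moebius :
    Measure.QuasiMeasurePreserving (moebius g) (volume : Measure ℂ) volume := by
  refine ⟨measurable_moebius g, Measure.AbsolutelyContinuous.mk fun s hs h0 => ?_⟩
  rw [Measure.map_apply (measurable_moebius g) hs]
  have h1 := lintegral_moebius g (s.indicator 1)
  rw [lintegral_indicator_one hs, h0, lintegral_eq_zero_iff] at h1
  · rw [measure_eq_zero_iff_ae_notMem]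
    filter_upwards [h1, ae_denom_ne g] with ζ h2 h3 h4
    have h5 : moebius g ζ ∈ s := h4
    simp [moebiusDeriv, h5, h3] at h2
  · exact ((measurable_moebiusDeriv g).enorm.pow_const 2).mul
      ((measurable_one.indicator hs).comp (measurable_moebius g))

theorem eLpNorm_moebius (f : ℂ → ℂ) :
    eLpNorm (fun ζ => moebiusDeriv g ζ * f (moebius g ζ)) 2 volume = eLpNorm f 2 volume := by
  rw [eLpNorm_eq_lintegral_rpow_enorm_toReal (by simp) (by simp), eLpNorm_eq_lintegral_rpow_enorm_toReal (by simp) (by simp)]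
  congr 1
  simp only [ENNReal.toReal_ofNat, ENNReal.rpow_ofNat, enorm_mul, mul_pow]
  exact lintegral_moebius g fun ζ => ‖f ζ‖ₑ ^ 2

theorem memLp_moebius (f : Photon) :
    MemLp (fun ζ => moebiusDeriv g ζ * f (moebius g ζ)) 2 (volume : Measure ℂ) := by
  refine ⟨(measurable_moebiusDeriv g).aestronglyMeasurable.mul
    ((Lp.aestronglyMeasurable f).comp_quasiMeasurePreserving
      (quasiMeasurePreserving_moebius g)), ?_⟩
  rw [eLpNorm_moebius]
  exact Lp.eLpNorm_lt_top f

/-- The map `f ↦ (g⁻¹)' · (f ∘ g⁻¹)`, that is, the pullback of `∂F/∂ζ` when `F` goes to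
`F ∘ g⁻¹`. -/
def photonMap (f : Photon) : Photon := (memLp_moebius g⁻¹ f).toLp _

theorem photonMap_ae (f : Photon) : photonMap g f =ᵐ[volume]
    fun ζ => moebiusDeriv g⁻¹ ζ * f (moebius g⁻¹ ζ) :=
  MemLp.coeFn_toLp _

theorem photonMap_mul (f : Photon) : photonMap (g * h) f = photonMap g (photonMap h f) := by
  apply Lp.ext
  filter_upwards [photonMap_ae (g * h) f, photonMap_ae g (photonMap h f),
    (quasiMeasurePreserving_moebius g⁻¹).ae (photonMap_ae h f), ae_denom_ne g⁻¹]
    with ζ h1 h2 h3 h4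
  rw [h1, h2, h3, mul_inv_rev, moebius_mul _ _ h4, moebiusDeriv_mul _ _ h4, mul_assoc]

theorem photonMap_one (f : Photon) : photonMap 1 f = f := by
  apply Lp.ext
  filter_upwards [photonMap_ae 1 f] with ζ h1
  rw [h1, inv_one, moebius_one, moebiusDeriv_one]; simp

/-- The unitary representation `(l₀, l₁) = (1, 0)` of `SL(2, ℂ)`. -/
def photonRep (g : SL(2, ℂ)) : Photon ≃ₗᵢ[ℂ] Photon where
  toFun := photonMap g
  invFun := photonMap g⁻¹
  map_add' f₁ f₂ := by
    apply Lp.ext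
    filter_upwards [photonMap_ae g (f₁ + f₂), photonMap_ae g f₁, photonMap_ae g f₂,
      (quasiMeasurePreserving_moebius g⁻¹).ae (Lp.coeFn_add f₁ f₂),
      Lp.coeFn_add (photonMap g f₁) (photonMap g f₂)] with ζ h1 h2 h3 h4 h5
    rw [h1, h5, h4, Pi.add_apply, Pi.add_apply, h2, h3, mul_add]
  map_smul' c f := by
    apply Lp.ext
    filter_upwards [photonMap_ae g (c • f), photonMap_ae g f,
      (quasiMeasurePreserving_moebius g⁻¹).ae (Lp.coeFn_smul c f),
      Lp.coeFn_smul c (photonMap g f)] with ζ h1 h2 h4 h5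
    rw [h1, RingHom.id_apply, h5, h4, Pi.smul_apply, Pi.smul_apply, h2, smul_eq_mul, smul_eq_mul]
    ring
  left_inv f := by rw [← photonMap_mul, inv_mul_cancel, photonMap_one]
  right_inv f := by rw [← photonMap_mul, mul_inv_cancel, photonMap_one]
  norm_map' f := by
    change ‖photonMap g f‖ = ‖f‖
    rw [Lp.norm_def, Lp.norm_def, eLpNorm_congr_ae (photonMap_ae g f), eLpNorm_moebius]

end Moebius

section Wirtinger

/-- The Wirtinger derivative `∂F/∂ζ` of a real function. -/
def dz (F : ℂ → ℝ) (ζ : ℂ) : ℂ :=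
  ((fderiv ℝ F ζ 1 : ℝ) - Complex.I * (fderiv ℝ F ζ Complex.I : ℝ)) / 2

/-- The real linear form `v ↦ 2 Re (D v)`, the differential of `F` when `D = ∂F/∂ζ`. -/
def twoRe (D : ℂ) : ℂ →L[ℝ] ℝ := (2 : ℝ) • (Complex.reCLM ∘L ContinuousLinearMap.mul ℝ ℂ D)

theorem dz_eq {F : ℂ → ℝ} {D ζ : ℂ} (h : HasFDerivAt F (twoRe D) ζ) : dz F ζ = D := by
  rw [dz, h.fderiv]
  apply Complex.ext <;> simp [twoRe]

theorem hasFDerivAt_normSq_affine (p q ζ : ℂ) :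
    HasFDerivAt (fun ζ : ℂ => ‖p * ζ + q‖ ^ 2) (twoRe (p * conj (p * ζ + q))) ζ := by
  have h1 : HasFDerivAt (fun ζ : ℂ => p * ζ + q) (ContinuousLinearMap.mul ℝ ℂ p) ζ := by
    simpa using ((ContinuousLinearMap.mul ℝ ℂ p).hasFDerivAt (x := ζ)).add_const q
  refine h1.norm_sq.congr_fderiv ?_
  apply ContinuousLinearMap.ext
  intro v
  simp [twoRe, Complex.inner]
  ring


theorem smul_twoRe (c : ℝ) (D : ℂ) : c • twoRe D = twoRe (c * D) := by
  apply ContinuousLinearMap.ext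
  intro v
  simp [twoRe]
  ring

theorem twoRe_add (D D' : ℂ) : twoRe D + twoRe D' = twoRe (D + D') := by
  apply ContinuousLinearMap.ext
  intro v
  simp [twoRe]

theorem twoRe_sub (D D' : ℂ) : twoRe D - twoRe D' = twoRe (D - D') := by
  apply ContinuousLinearMap.ext
  intro v
  simp [twoRe]
  ring

theorem hasFDerivAt_normSq_add_one (ζ : ℂ) :
    HasFDerivAt (fun ζ : ℂ => ‖ζ‖ ^ 2 + 1) (twoRe (conj ζ)) ζ := by
  simpa using (hasFDerivAt_normSq_affine 1 0 ζ).add_const 1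

end Wirtinger

section L2
theorem memLp_of_decay {F : ℂ → ℂ} (hF : Measurable F) {C : ℝ}
    (h : ∀ ζ, ‖F ζ‖ ≤ C / (‖ζ‖ ^ 2 + 1)) : MemLp F 2 (volume : Measure ℂ) := by
  have h1 : Integrable (fun ζ : ℂ => ((1 : ℝ) + ‖ζ‖ ^ 2) ^ (-4 / 2 : ℝ)) :=
    integrable_rpow_neg_one_add_norm_sq (by simp; norm_num)
  rw [memLp_two_iff_integrable_sq_norm hF.aestronglyMeasurable]
  refine (h1.const_mul (C ^ 2)).mono' (hF.norm.pow_const 2).aestronglyMeasurable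
    (Eventually.of_forall fun ζ => ?_)
  have h2 : ((1 : ℝ) + ‖ζ‖ ^ 2) ^ (-4 / 2 : ℝ) = ((‖ζ‖ ^ 2 + 1) ^ 2)⁻¹ := by
    rw [show (-4 / 2 : ℝ) = -((2 : ℕ) : ℝ) by norm_num, Real.rpow_neg (by positivity),
      Real.rpow_natCast, add_comm]
  rw [h2, Real.norm_of_nonneg (by positivity), ← div_eq_mul_inv, ← div_pow]
  exact pow_le_pow_left₀ (norm_nonneg _) (h ζ) 2
end L2

section Potential
variable (g : SL(2, ℂ))

/-- Twice the energy component of the null vector with spinor `g (ζ, 1)`. -/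
def energy (ζ : ℂ) : ℝ := ‖g 0 0 * ζ + g 0 1‖ ^ 2 + ‖g 1 0 * ζ + g 1 1‖ ^ 2

/-- The ratio of the energies of `g⁻¹ k` and `k`, for the null vector `k` with spinor `(ζ, 1)`. -/
def energyRatio (ζ : ℂ) : ℝ := energy g⁻¹ ζ / (‖ζ‖ ^ 2 + 1)

/-- A constant controlling `energy g` from below. -/
def frame (g : SL(2, ℂ)) : ℝ :=
  2 * (‖g 0 0‖ ^ 2 + ‖g 0 1‖ ^ 2 + ‖g 1 0‖ ^ 2 + ‖g 1 1‖ ^ 2)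

theorem normSq_sum_le (a b c d : ℂ) :
    ‖a * b + c * d‖ ^ 2 ≤ (‖a‖ ^ 2 + ‖c‖ ^ 2) * (‖b‖ ^ 2 + ‖d‖ ^ 2) := by
  have h1 : ‖a * b + c * d‖ ≤ ‖a‖ * ‖b‖ + ‖c‖ * ‖d‖ := by
    simpa using norm_add_le (a * b) (c * d)
  have h2 := pow_le_pow_left₀ (norm_nonneg _) h1 2
  nlinarith [sq_nonneg (‖a‖ * ‖d‖ - ‖c‖ * ‖b‖)]

theorem le_energy (ζ : ℂ) : ‖ζ‖ ^ 2 + 1 ≤ frame g * energy g ζ := by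
  have h1 := normSq_sum_le (g 1 1) (g 0 0 * ζ + g 0 1) (-g 0 1) (g 1 0 * ζ + g 1 1)
  have h2 := normSq_sum_le (-g 1 0) (g 0 0 * ζ + g 0 1) (g 0 0) (g 1 0 * ζ + g 1 1)
  have e1 : g 1 1 * (g 0 0 * ζ + g 0 1) + -g 0 1 * (g 1 0 * ζ + g 1 1) = ζ := by
    linear_combination ζ * det_eq g
  have e2 : -g 1 0 * (g 0 0 * ζ + g 0 1) + g 0 0 * (g 1 0 * ζ + g 1 1) = 1 := by
    linear_combination det_eq g
  rw [e1, norm_neg] at h1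
  rw [e2, norm_neg, norm_one] at h2
  unfold frame energy
  have h3 : 0 ≤ (‖g 0 0‖ ^ 2 + ‖g 0 1‖ ^ 2 + ‖g 1 0‖ ^ 2 + ‖g 1 1‖ ^ 2) *
    (‖g 0 0 * ζ + g 0 1‖ ^ 2 + ‖g 1 0 * ζ + g 1 1‖ ^ 2) := by positivity
  nlinarith

theorem energy_pos (ζ : ℂ) : 0 < energy g ζ := by
  have h := le_energy g ζ
  have h2 : 0 ≤ energy g ζ := by unfold energy; positivity
  rcases h2.eq_or_lt with h3 | h3
  · rw [← h3] at h
    nlinarith [sq_nonneg ‖ζ‖]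
  · exact h3

/-- The Wirtinger derivative of `energy g`. -/
def energyDz (ζ : ℂ) : ℂ :=
  g 0 0 * conj (g 0 0 * ζ + g 0 1) + g 1 0 * conj (g 1 0 * ζ + g 1 1)

theorem dz_log_energyRatio (ζ : ℂ) :
    dz (fun ζ => Real.log (energyRatio g ζ)) ζ =
      energyDz g⁻¹ ζ / energy g⁻¹ ζ - conj ζ / (‖ζ‖ ^ 2 + 1 : ℝ) := by
  apply dz_eq
  have h1 : HasFDerivAt (energy g⁻¹) (twoRe (energyDz g⁻¹ ζ)) ζ := by
    have := (hasFDerivAt_normSq_affine (g⁻¹ 0 0) (g⁻¹ 0 1) ζ).add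
      (hasFDerivAt_normSq_affine (g⁻¹ 1 0) (g⁻¹ 1 1) ζ)
    rwa [twoRe_add] at this
  have h2 := (h1.log (energy_pos g⁻¹ ζ).ne').sub
    ((hasFDerivAt_normSq_add_one ζ).log (by positivity))
  rw [smul_twoRe, smul_twoRe, twoRe_sub] at h2
  have h3 : (fun ζ => Real.log (energyRatio g ζ)) =
      (fun ζ => Real.log (energy g⁻¹ ζ)) - fun ζ => Real.log (‖ζ‖ ^ 2 + 1) := by
    ext ζ
    rw [energyRatio, Real.log_div (energy_pos _ _).ne' (by positivity)]
    rfl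
  rw [h3]
  refine h2.congr_fderiv ?_
  congr 1
  push_cast
  ring

theorem norm_dz_log_energyRatio_le (ζ : ℂ) :
    ‖dz (fun ζ => Real.log (energyRatio g ζ)) ζ‖ ≤ frame g⁻¹ / (‖ζ‖ ^ 2 + 1) := by
  rw [dz_log_energyRatio]
  have hN := energy_pos g⁻¹ ζ
  have hM : 0 < ‖ζ‖ ^ 2 + 1 := by positivity
  have hle := le_energy g⁻¹ ζ
  set N := energy g⁻¹ ζ with hNdef
  set M := ‖ζ‖ ^ 2 + 1 with hMdef
  set p := g⁻¹ 0 0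
  set q := g⁻¹ 0 1
  set r := g⁻¹ 1 0
  set s := g⁻¹ 1 1
  have hNc : (N : ℂ) = (p * ζ + q) * conj (p * ζ + q) + (r * ζ + s) * conj (r * ζ + s) := by
    rw [hNdef, energy, Complex.mul_conj, Complex.mul_conj, Complex.normSq_eq_norm_sq,
      Complex.normSq_eq_norm_sq]
    push_cast
    rfl
  have hMc : (M : ℂ) = ζ * conj ζ + 1 := by
    rw [hMdef, Complex.mul_conj, Complex.normSq_eq_norm_sq]
    push_cast
    rfl
  set num : ℂ := conj (p * ζ + q) * (p - q * conj ζ) + conj (r * ζ + s) * (r - s * conj ζ)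
    with hnum
  have hD : energyDz g⁻¹ ζ / (N : ℂ) - conj ζ / (M : ℂ) = num / ((N : ℂ) * (M : ℂ)) := by
    have hN0 : (N : ℂ) ≠ 0 := by exact_mod_cast hN.ne'
    have hM0 : (M : ℂ) ≠ 0 := by exact_mod_cast hM.ne'
    rw [div_sub_div _ _ hN0 hM0]
    congr 1
    rw [hNc, hMc, hnum]
    change (p * conj (p * ζ + q) + r * conj (r * ζ + s)) * _ - _ = _
    ring
  have hb : ‖num‖ ≤ frame g⁻¹ * N := by
    have h1 := normSq_sum_le (conj (p * ζ + q)) (p - q * conj ζ) (conj (r * ζ + s))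
      (r - s * conj ζ)
    rw [RCLike.norm_conj, RCLike.norm_conj] at h1
    have h2 := normSq_sum_le p 1 (-q) (conj ζ)
    have h3 := normSq_sum_le r 1 (-s) (conj ζ)
    rw [RCLike.norm_conj, norm_neg, norm_one] at h2 h3
    rw [show p * 1 + -q * conj ζ = p - q * conj ζ by ring] at h2
    rw [show r * 1 + -s * conj ζ = r - s * conj ζ by ring] at h3
    have h4 : ‖p - q * conj ζ‖ ^ 2 + ‖r - s * conj ζ‖ ^ 2 ≤ frame g⁻¹ * M := by
      have : 0 ≤ (‖p‖ ^ 2 + ‖q‖ ^ 2 + ‖r‖ ^ 2 + ‖s‖ ^ 2) * M := by positivity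
      change _ ≤ 2 * (‖p‖ ^ 2 + ‖q‖ ^ 2 + ‖r‖ ^ 2 + ‖s‖ ^ 2) * M
      nlinarith
    have hf : 0 ≤ frame g⁻¹ := by unfold frame; positivity
    have h5 : ‖num‖ ^ 2 ≤ (frame g⁻¹ * N) ^ 2 := by
      calc ‖num‖ ^ 2 ≤ N * (‖p - q * conj ζ‖ ^ 2 + ‖r - s * conj ζ‖ ^ 2) := h1
        _ ≤ N * (frame g⁻¹ * (frame g⁻¹ * N)) := by gcongr; exact h4.trans (by gcongr)
        _ = (frame g⁻¹ * N) ^ 2 := by ring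
    exact (sq_le_sq₀ (norm_nonneg _) (by positivity)).1 h5
  rw [hD, norm_div, norm_mul, Complex.norm_real, Complex.norm_real, Real.norm_of_nonneg hN.le,
    Real.norm_of_nonneg hM.le, div_le_div_iff₀ (by positivity) hM]
  nlinarith

theorem memLp_dz_log_energyRatio :
    MemLp (dz fun ζ => Real.log (energyRatio g ζ)) 2 (volume : Measure ℂ) := by
  refine memLp_of_decay ?_ (norm_dz_log_energyRatio_le g)
  rw [funext (dz_log_energyRatio g)]
  unfold energyDz energy
  fun_prop

end Potential

section Zonal
open Polynomial

/-- The Legendre polynomial `P_l`, by the formula of Rodrigues. -/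
def legendre (l : ℕ) : ℝ[X] :=
  C ((2 ^ l * l.factorial : ℝ)⁻¹) * derivative^[l] ((X ^ 2 - 1) ^ l)

/-- The cosine of the polar angle of the direction with stereographic coordinate `ζ`. -/
def polarCos (ζ : ℂ) : ℝ := (1 - ‖ζ‖ ^ 2) / (‖ζ‖ ^ 2 + 1)

theorem dz_legendre_polarCos (l : ℕ) (ζ : ℂ) :
    dz (fun ζ => (legendre l).eval (polarCos ζ)) ζ =
      ((legendre l).derivative.eval (polarCos ζ) : ℝ) *
        (-2 * conj ζ / ((‖ζ‖ ^ 2 + 1 : ℝ) : ℂ) ^ 2) := by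
  apply dz_eq
  have hM : ‖ζ‖ ^ 2 + 1 ≠ 0 := by positivity
  have h0 : polarCos = fun ζ : ℂ => 2 * (‖ζ‖ ^ 2 + 1)⁻¹ - 1 := by
    ext ζ
    rw [polarCos]
    field_simp
    ring
  have h1 : HasFDerivAt polarCos (twoRe (-2 * conj ζ / ((‖ζ‖ ^ 2 + 1 : ℝ) : ℂ) ^ 2)) ζ := by
    rw [h0]
    have := (((hasDerivAt_inv hM).comp_hasFDerivAt ζ (hasFDerivAt_normSq_add_one ζ)).const_mul
      2).sub_const 1
    refine this.congr_fderiv ?_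
    rw [smul_twoRe, smul_twoRe]
    congr 1
    push_cast
    ring
  have h2 := ((legendre l).hasDerivAt (polarCos ζ)).comp_hasFDerivAt ζ h1
  rw [smul_twoRe] at h2
  exact h2

theorem memLp_dz_legendre_polarCos (l : ℕ) :
    MemLp (dz fun ζ => (legendre l).eval (polarCos ζ)) 2 (volume : Measure ℂ) := by
  obtain ⟨C, hC⟩ := (isCompact_Icc (a := (-1 : ℝ)) (b := 1)).exists_bound_of_continuousOn
    (legendre l).derivative.continuous.continuousOn
  refine memLp_of_decay (C := C) ?_ fun ζ => ?_
  · rw [funext (dz_legendre_polarCos l)]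
    have h : Continuous fun ζ => (legendre l).derivative.eval (polarCos ζ) :=
      (legendre l).derivative.continuous.comp
        (by unfold polarCos; exact Continuous.div (by fun_prop) (by fun_prop)
              fun ζ => by positivity)
    exact (Complex.continuous_ofReal.comp h).measurable.mul (by fun_prop)
  · have hM : 0 < ‖ζ‖ ^ 2 + 1 := by positivity
    have hx : polarCos ζ ∈ Set.Icc (-1 : ℝ) 1 := by
      rw [polarCos, Set.mem_Icc, le_div_iff₀ hM, div_le_iff₀ hM]
      constructor <;> nlinarith [sq_nonneg ‖ζ‖]
    have h1 := hC _ hx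
    rw [dz_legendre_polarCos, norm_mul, Complex.norm_real, norm_div, norm_mul, norm_neg,
      RCLike.norm_conj, norm_pow, Complex.norm_real, Real.norm_of_nonneg hM.le,
      RCLike.norm_ofNat, ← mul_div_assoc, div_le_div_iff₀ (by positivity) hM]
    have h2 : 2 * ‖ζ‖ ≤ ‖ζ‖ ^ 2 + 1 := by nlinarith [sq_nonneg (‖ζ‖ - 1)]
    have h3 : ‖(legendre l).derivative.eval (polarCos ζ)‖ * (2 * ‖ζ‖) ≤ C * (‖ζ‖ ^ 2 + 1) :=
      mul_le_mul h1 h2 (by positivity) ((norm_nonneg _).trans h1)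
    nlinarith

end Zonal
section CoulombField

/-- The coupling constant `z = n² q² / π`. -/
def couplingZ (q : ℝ) (n : ℤ) : ℝ := (n : ℝ) ^ 2 * q ^ 2 / Real.pi

/-- The displacement of the charge `n q` sector under `g`:
`n / (2 √π) * ∑ B_{lm}(g⁻¹) e_{lm}`, where `e_{lm}` is the orthonormal basis of the one-photon
space belonging to the operators `c_{lm}`.  It satisfies
`shift (g h) = shift g + photonRep g (shift h)`, vanishes on `SU(2)`, and along the boosts it is
`-i n q √(2 / (3 π)) ∫₀^λ photonRep (g₀₃(s)) e_{1,0} ds`. -/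
def coulombShift (q : ℝ) (n : ℤ) (g : SL(2, ℂ)) : Photon :=
  (-Complex.I * (n * q / Real.pi)) • (memLp_dz_log_energyRatio g).toLp _

/-- The unitary representation `U` of `SL(2, ℂ)` on the eigenspace of the total charge with
eigenvalue `n q`. -/
def lorentz (q : ℝ) (n : ℤ) (g : SL(2, ℂ)) : Fock Photon ≃ₗᵢ[ℂ] Fock Photon :=
  affineUnitary (photonRep g) (coulombShift q n g)

/-- The vector `|u⟩ = exp(-i n S(u))|0⟩`. -/
def ketU : Fock Photon := vacuum Photon

/-- The normalized one-photon vector `e_{l,0}`, from the zonal harmonic `P_l(cos θ)`. -/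
def zonalPhoton (l : ℕ) : Photon :=
  (√((2 * l + 1) / (Real.pi * l * (l + 1))) : ℂ) • (memLp_dz_legendre_polarCos l).toLp _

/-- The operator `c_{l,0}⁺`, normalized by `[c_α, c_β⁺] = 4 π q² δ_{αβ}`. -/
def cPlus (q : ℝ) (l : ℕ) : Fock Photon →ₗ.[ℂ] Fock Photon :=
  (2 * √Real.pi * q : ℂ) • creation (zonalPhoton l)

theorem ketU_mem_cPlus_domain (q : ℝ) (l : ℕ) : ketU ∈ (cPlus q l).domain :=
  vacuum_mem_creation_domain (zonalPhoton l)

/-- The hyperbolic rotation `g₀₃` along the `03` plane with hyperbolic angle `s`. -/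
def boost (s : ℝ) : SL(2, ℂ) :=
  ⟨!![Complex.exp (s / 2), 0; 0, Complex.exp (-(s / 2))], by
    rw [Matrix.det_fin_two_of, ← Complex.exp_add]; simp⟩

/-- The spatial rotation `g₁₂` along the `12` plane. -/
def rotation12 (t : ℝ) : SL(2, ℂ) :=
  ⟨!![Complex.exp (-(Complex.I * t / 2)), 0; 0, Complex.exp (Complex.I * t / 2)], by
    rw [Matrix.det_fin_two_of, ← Complex.exp_add]; simp⟩

/-- The spatial rotation `g₁₃` along the `13` plane. -/
def rotation13 (t : ℝ) : SL(2, ℂ) :=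
  ⟨!![Complex.cos (t / 2), -Complex.sin (t / 2); Complex.sin (t / 2), Complex.cos (t / 2)], by
    rw [Matrix.det_fin_two_of]
    linear_combination Complex.cos_sq_add_sin_sq ((t : ℂ) / 2)⟩

/-- The mean over `SU(2)` with respect to the normalized invariant measure
`(8 π²)⁻¹ sin φ dθ dφ dϑ` in the Euler angles `g₁₂(θ) g₁₃(φ) g₁₂(ϑ)`, for functions
that factor through the rotation group. -/
def rotationMean (F : SL(2, ℂ) → Fock Photon) : Fock Photon :=
  ∫ θ in (0 : ℝ)..2 * Real.pi, ∫ φ in (0 : ℝ)..Real.pi, ∫ ϑ in (0 : ℝ)..2 * Real.pi,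
    (Real.sin φ / (8 * Real.pi ^ 2)) • F (rotation12 θ * rotation13 φ * rotation12 ϑ)

/-- The normalization factor
`c_s = √2 sinh s / (∫₀^{2 s} sinh x exp(-z (x coth x - 1)) dx)^{1/2}`. -/
def normFactor (z s : ℝ) : ℝ :=
  √2 * Real.sinh s /
    √(∫ x in (0 : ℝ)..2 * s,
      Real.sinh x * Real.exp (-z * (x * (Real.cosh x / Real.sinh x) - 1)))

/-- The family `c_s ∫_{SU(2)} U(a) U(s) |u⟩ da` whose limit for `s → ∞` is the bound state
`|u, ∞⟩`. -/
def boundStateApprox (q : ℝ) (n : ℤ) (s : ℝ) : Fock Photon :=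
  normFactor (couplingZ q n) s • rotationMean fun a => lorentz q n a (lorentz q n (boost s) ketU)

/-- The overlap `⟨b| U(σ) c_{l,0}⁺ |u⟩`. -/
def overlap (q : ℝ) (n : ℤ) (b : Fock Photon) (l : ℕ) (σ : ℝ) : ℂ :=
  ⟪b, lorentz q n (boost σ) (cPlus q l ⟨ketU, ketU_mem_cPlus_domain q l⟩)⟫_ℂ

end CoulombField
end CoulombField
end

open CoulombField

/-!
The states `U(g)|u⟩` are normalized coherent vectors `ketVelocity q n g` over the one-photon space,
with displacement a multiple of `logShift g = ∂ log (energyRatio g) / ∂ζ`. The function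
`g ↦ logShift g` is a cocycle for `photonRep` and vanishes on rotations, so all inner products
reduce to `‖logShift (boost x)‖² = 2 π (x coth x - 1)` (`norm_logShift_boost_sq`), and two such
states with relative rapidity `x` overlap in `exp (-z (x coth x - 1))`
(`inner_ketVelocity_rotation`).

Existence of the limit. Averaging over rotations, the Gram matrix of the rotation means becomes an
integral of this kernel over the sphere. With `Φ = kernelPrimitive z` the inner product of two
normalized means is `(Φ(s + t) - Φ(s - t)) / √(Φ(2 s) Φ(2 t))` (`inner_boundStateApprox`). For
`z < 1` the function `Φ(y)` is asymptotic to a multiple of `exp ((1 - z) y)`, so that the quotient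
tends to `1` as `s, t → ∞` (`tendsto_gram`), and the unit vectors `boundStateApprox q n s` form a
Cauchy family.

The overlaps. The matrix element of a creation operator between a coherent vector and a displaced
vacuum is the overlap of the two coherent vectors times a one-photon inner product. For the zonal
photon of order `l` the latter is the integral `zonalPairing` of `P_l'` against an explicit profile
depending on the velocity (`inner_logShift_zonalVec`), where the azimuthal mean is the mean value
property of a Poisson kernel. As `s → ∞` the velocities become light-like, the profile becomes a
sign function, `zonalPairing` tends to twice a value of `P_l`, and the overlap of the coherent
vectors decays like `exp (-z s)` times the power `-z` of a Doppler factor; the normalization grows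
like `exp (z s)`. Dominated convergence, the aberration formula as a substitution, and `l`
integrations by parts by the formula of Rodrigues give (`exists_overlap_eq`), with a constant
`K ≠ 0`,

  `⟨u, ∞| U(σ) c⁺_{l,0} |u⟩ = K sinh^l σ ∫_{-1}^{1} (t² - 1)^l (cosh σ - t sinh σ)^{z - 2 - l} dt`.

Here `z < 1` enters again, as `K` contains the factors `z - 2 - j` for `j < l`. The integrand has a
constant sign, so the overlap vanishes at most at `σ = 0`. The integral is even and analytic in `σ`
near `0`, as is `sinh σ / σ`, so the expansion of the overlap starts with `σ^l` and has no term of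
order `l + 1`.
-/

noncomputable section
namespace CoulombField

/-! ### Coherent vectors and one-photon vectors in Fock space -/

section Fock
variable {K : Type} [NormedAddCommGroup K] [InnerProductSpace ℂ K]

/-- The matrix element of a displaced and second quantized one-particle vector against an
exponential vector; it follows by moving the unitary operator to the exponential vector. -/
theorem inner_expVec_affineUnitary_creation (T : K ≃ₗᵢ[ℂ] K) (b φ e : K) :
    ⟪expVec φ, affineUnitary T b (creation e ⟨vacuum K, vacuum_mem_creation_domain e⟩)⟫_ℂ =
      Complex.exp (-(‖b‖ ^ 2 / 2 : ℝ) + ⟪φ, b⟫_ℂ) * ⟪T.symm (φ - b), e⟫_ℂ := by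
  set y := creation e ⟨vacuum K, vacuum_mem_creation_domain e⟩ with hy
  have h1 : expVec φ = Complex.exp ((‖b‖ ^ 2 / 2 : ℝ) + ⟪b, φ - b⟫_ℂ) •
      affineUnitary T b (expVec (T.symm (φ - b))) := by
    rw [affineUnitary_expVec, T.apply_symm_apply, sub_add_cancel, smul_smul, ← Complex.exp_add]
    simp
  have h2 : ⟪expVec (T.symm (φ - b)), y⟫_ℂ = ⟪T.symm (φ - b), e⟫_ℂ := by
    rw [← apply_eq_inner, hy, creation_apply, vacuum_apply, mul_one]
  rw [h1, inner_smul_left, LinearIsometryEquiv.inner_map_map, h2, ← Complex.exp_conj]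
  congr 2
  rw [map_add, Complex.conj_ofReal, inner_conj_symm, inner_sub_left, inner_self_eq_norm_sq_to_K]
  push_cast
  simp
  ring

theorem affineUnitary_vacuum (T : K ≃ₗᵢ[ℂ] K) (b : K) :
    affineUnitary T b (vacuum K) = Complex.exp (-(‖b‖ ^ 2 / 2 : ℝ)) • expVec b := by
  rw [vacuum, affineUnitary_expVec]; simp

/-- Normalized coherent vectors with a real overlap. -/
theorem inner_coherent_of_im_eq_zero {b c : K} (h : (⟪b, c⟫_ℂ).im = 0) :
    ⟪Complex.exp (-(‖b‖ ^ 2 / 2 : ℝ)) • expVec b,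
      Complex.exp (-(‖c‖ ^ 2 / 2 : ℝ)) • expVec c⟫_ℂ = (Real.exp (-(‖b - c‖ ^ 2 / 2)) : ℝ) := by
  rw [inner_smul_left, inner_smul_right, inner_expVec, ← Complex.exp_conj, ← Complex.exp_add,
    ← Complex.exp_add, Complex.ofReal_exp]
  congr 1
  have h1 : ⟪b, c⟫_ℂ = ((⟪b, c⟫_ℂ).re : ℂ) := by
    apply Complex.ext <;> simp [h]
  have h2 := @norm_sub_sq ℂ K _ _ _ b c
  simp only [RCLike.re_to_complex] at h2
  rw [h1, h2, map_neg, Complex.conj_ofReal]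
  push_cast
  ring

end Fock

/-! ### The logarithmic potentials and their cocycle property -/

section Cocycle
variable (g h : SL(2, ℂ))

/-- The Wirtinger derivative of `log (energy g)`. -/
def logEnergyDz (ζ : ℂ) : ℂ := energyDz g ζ / energy g ζ

theorem energy_eq_mul_conj (ζ : ℂ) : (energy g ζ : ℂ) =
    (g 0 0 * ζ + g 0 1) * conj (g 0 0 * ζ + g 0 1) +
      (g 1 0 * ζ + g 1 1) * conj (g 1 0 * ζ + g 1 1) := by
  rw [energy, Complex.mul_conj, Complex.mul_conj, Complex.normSq_eq_norm_sq,
    Complex.normSq_eq_norm_sq]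
  push_cast
  rfl

/-- The chain rule for `log (energy (g h) ζ) = log |h₁₀ ζ + h₁₁|² + log (energy g (h ζ))`. -/
theorem logEnergyDz_mul {ζ : ℂ} (hζ : h 1 0 * ζ + h 1 1 ≠ 0) :
    logEnergyDz (g * h) ζ =
      h 1 0 / (h 1 0 * ζ + h 1 1) + moebiusDeriv h ζ * logEnergyDz g (moebius h ζ) := by
  have hE : (energy g (moebius h ζ) : ℂ) ≠ 0 := by exact_mod_cast (energy_pos g _).ne'
  have hEm : (energy (g * h) ζ : ℂ) ≠ 0 := by exact_mod_cast (energy_pos (g * h) _).ne'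
  have hw : h 0 0 * ζ + h 0 1 = moebius h ζ * (h 1 0 * ζ + h 1 1) := by
    rw [moebius, div_mul_cancel₀ _ hζ]
  have h00 : h 0 0 * (h 1 0 * ζ + h 1 1) = h 1 0 * moebius h ζ * (h 1 0 * ζ + h 1 1) + 1 := by
    rw [mul_assoc, ← hw]; linear_combination det_eq h
  have e0 : (g * h) 0 0 * ζ + (g * h) 0 1 =
      (g 0 0 * moebius h ζ + g 0 1) * (h 1 0 * ζ + h 1 1) := by
    rw [mul_apply, mul_apply]; linear_combination g 0 0 * hw
  have e1 : (g * h) 1 0 * ζ + (g * h) 1 1 =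
      (g 1 0 * moebius h ζ + g 1 1) * (h 1 0 * ζ + h 1 1) := by
    rw [mul_apply, mul_apply]; linear_combination g 1 0 * hw
  have hen : (energy (g * h) ζ : ℂ) =
      energy g (moebius h ζ) * ((h 1 0 * ζ + h 1 1) * conj (h 1 0 * ζ + h 1 1)) := by
    rw [energy_eq_mul_conj, energy_eq_mul_conj, e0, e1, map_mul, map_mul]; ring
  have hdz : energyDz (g * h) ζ * (h 1 0 * ζ + h 1 1) = conj (h 1 0 * ζ + h 1 1) *
      (h 1 0 * (h 1 0 * ζ + h 1 1) * energy g (moebius h ζ) + energyDz g (moebius h ζ)) := by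
    rw [energyDz, e0, e1, energy_eq_mul_conj, energyDz, map_mul, map_mul, mul_apply, mul_apply]
    linear_combination (g 0 0 * conj (g 0 0 * moebius h ζ + g 0 1) +
      g 1 0 * conj (g 1 0 * moebius h ζ + g 1 1)) * conj (h 1 0 * ζ + h 1 1) * h00
  have hc : conj (h 1 0 * ζ + h 1 1) ≠ 0 := (map_ne_zero _).2 hζ
  have hdz' : energyDz (g * h) ζ = conj (h 1 0 * ζ + h 1 1) *
      (h 1 0 * (h 1 0 * ζ + h 1 1) * energy g (moebius h ζ) + energyDz g (moebius h ζ)) /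
        (h 1 0 * ζ + h 1 1) := by
    rw [eq_div_iff hζ, hdz]
  rw [logEnergyDz, logEnergyDz, hdz', hen, moebiusDeriv]
  generalize h 1 0 * ζ + h 1 1 = N at *
  field_simp

/-- The one-photon vector `∂ log (energyRatio g) / ∂ζ`. -/
def logShift : Photon := (memLp_dz_log_energyRatio g).toLp _

theorem logShift_ae : logShift g =ᵐ[volume] fun ζ => logEnergyDz g⁻¹ ζ - logEnergyDz 1 ζ := by
  refine (MemLp.coeFn_toLp _).trans (Eventually.of_forall fun ζ => ?_)
  rw [dz_log_energyRatio]
  simp [logEnergyDz, energyDz, energy]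

theorem coulombShift_eq (q : ℝ) (n : ℤ) :
    coulombShift q n g = (-Complex.I * (n * q / Real.pi)) • logShift g := rfl

/-- The cocycle property of the displacements. -/
theorem logShift_mul : logShift (g * h) = logShift g + photonRep g (logShift h) := by
  apply Lp.ext
  filter_upwards [logShift_ae (g * h), logShift_ae g, photonMap_ae g (logShift h),
    (quasiMeasurePreserving_moebius g⁻¹).ae (logShift_ae h), ae_denom_ne g⁻¹,
    Lp.coeFn_add (logShift g) (photonRep g (logShift h))] with ζ h1 h2 h3 h4 h5 h6
  rw [h6, Pi.add_apply, h1, h2]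
  change _ = _ + photonMap g (logShift h) ζ
  rw [h3, h4, mul_inv_rev, logEnergyDz_mul _ _ h5]
  have h7 := logEnergyDz_mul 1 g⁻¹ h5
  rw [one_mul] at h7
  rw [h7]
  ring

/-- `logShift g` depends on `g` only through the four-velocity `g u`. -/
theorem logShift_congr (hgh : ∀ ζ, energy g⁻¹ ζ = energy h⁻¹ ζ) : logShift g = logShift h := by
  have : (fun ζ => Real.log (energyRatio g ζ)) = fun ζ => Real.log (energyRatio h ζ) := by
    ext ζ; rw [energyRatio, energyRatio, hgh]
  unfold logShift
  congr 1
  rw [this]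

theorem logShift_one : logShift 1 = 0 := by
  have h := logShift_mul 1 1
  have h1 : photonRep 1 (logShift 1) = logShift 1 := photonMap_one _
  rw [h1, mul_one] at h
  simpa using h

theorem photonRep_mul (f : Photon) : photonRep (g * h) f = photonRep g (photonRep h f) :=
  photonMap_mul g h f

theorem photonRep_symm (f : Photon) : (photonRep g).symm f = photonRep g⁻¹ f := rfl

theorem photonRep_inv_sub : photonRep g⁻¹ (logShift h - logShift g) = logShift (g⁻¹ * h) := by
  have h1 := logShift_mul g (g⁻¹ * h)
  rw [mul_inv_cancel_left] at h1
  rw [h1, add_sub_cancel_left, ← photonRep_mul, inv_mul_cancel]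
  exact photonMap_one _

theorem norm_logShift_sub : ‖logShift g - logShift h‖ = ‖logShift (g⁻¹ * h)‖ := by
  rw [← photonRep_inv_sub, LinearIsometryEquiv.norm_map, norm_sub_rev]

/-- Membership in `SU(2)`, in terms of the matrix entries. -/
def IsRotation : Prop := g 1 1 = conj (g 0 0) ∧ g 1 0 = -conj (g 0 1)

variable {g h}

theorem IsRotation.inv (hg : IsRotation g) : IsRotation g⁻¹ := by
  obtain ⟨h1, h2⟩ := hg
  simp only [IsRotation, Matrix.SpecialLinearGroup.coe_inv, Matrix.adjugate_fin_two]
  simp [h1, h2]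

theorem IsRotation.mul (hg : IsRotation g) (hh : IsRotation h) : IsRotation (g * h) := by
  obtain ⟨h1, h2⟩ := hg
  obtain ⟨h3, h4⟩ := hh
  simp only [IsRotation, mul_apply, h1, h2, h3, h4, map_add, map_mul, map_neg, Complex.conj_conj]
  constructor <;> ring

theorem IsRotation.normSq_add (hg : IsRotation g) : ‖g 0 0‖ ^ 2 + ‖g 0 1‖ ^ 2 = 1 := by
  have h := det_eq g
  rw [hg.1, hg.2, mul_neg, sub_neg_eq_add, Complex.mul_conj, Complex.mul_conj,
    Complex.normSq_eq_norm_sq, Complex.normSq_eq_norm_sq] at h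
  exact_mod_cast h

theorem IsRotation.energy_eq (hg : IsRotation g) (ζ : ℂ) : energy g ζ = ‖ζ‖ ^ 2 + 1 := by
  have h1 : g 0 0 * conj (g 0 0) + g 0 1 * conj (g 0 1) = 1 := by
    have := det_eq g
    rw [hg.1, hg.2] at this
    linear_combination this
  have h2 : (energy g ζ : ℂ) = ζ * conj ζ + 1 := by
    rw [energy_eq_mul_conj, hg.1, hg.2]
    simp only [map_add, map_mul, map_neg, Complex.conj_conj]
    linear_combination (ζ * conj ζ + 1) * h1
  rw [Complex.mul_conj, Complex.normSq_eq_norm_sq] at h2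
  exact_mod_cast h2

theorem IsRotation.logShift_eq_zero (hg : IsRotation g) : logShift g = 0 := by
  rw [← logShift_one]
  refine logShift_congr _ _ fun ζ => ?_
  rw [hg.inv.energy_eq]
  simp [energy]

theorem IsRotation.logShift_mul_left (hg : IsRotation g) (k : SL(2, ℂ)) :
    logShift (g * k) = photonRep g (logShift k) := by
  rw [logShift_mul, hg.logShift_eq_zero, zero_add]

theorem IsRotation.logShift_mul_right (hg : IsRotation g) (k : SL(2, ℂ)) :
    logShift (k * g) = logShift k := by
  rw [logShift_mul, hg.logShift_eq_zero, map_zero, add_zero]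

theorem isRotation_rotation12 (t : ℝ) : IsRotation (rotation12 t) := by
  constructor <;> simp [rotation12, ← Complex.exp_conj, Complex.conj_ofNat, neg_div]

theorem isRotation_rotation13 (t : ℝ) : IsRotation (rotation13 t) := by
  constructor <;> simp [rotation13, ← Complex.cos_conj, ← Complex.sin_conj, Complex.conj_ofNat]

theorem rotation12_mul_boost (t s : ℝ) : rotation12 t * boost s = boost s * rotation12 t := by
  ext i j
  rw [mul_apply, mul_apply]
  fin_cases i <;> fin_cases j <;> simp [rotation12, boost, mul_comm]

theorem photonRep_rotation12_logShift_boost (t s : ℝ) :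
    photonRep (rotation12 t) (logShift (boost s)) = logShift (boost s) := by
  rw [← (isRotation_rotation12 t).logShift_mul_left, rotation12_mul_boost,
    (isRotation_rotation12 t).logShift_mul_right]

end Cocycle

/-! ### Integration over the celestial sphere -/

section Sphere
variable {E : Type*} [NormedAddCommGroup E] [NormedSpace ℝ E]

theorem polarCos_mem_Icc (ζ : ℂ) : polarCos ζ ∈ Set.Icc (-1 : ℝ) 1 := by
  have hM : 0 < ‖ζ‖ ^ 2 + 1 := by positivity
  rw [polarCos, Set.mem_Icc, le_div_iff₀ hM, div_le_iff₀ hM]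
  constructor <;> nlinarith [sq_nonneg ‖ζ‖]

theorem continuous_polarCos : Continuous polarCos := by
  unfold polarCos
  exact Continuous.div (by fun_prop) (by fun_prop) fun ζ => by positivity

/-- The area element `(1 + |ζ|²)⁻² d²ζ` of the sphere in polar coordinates. -/
theorem integral_sphere_eq_radial {f : ℂ → E} (hf : Continuous f) {C : ℝ} (hC : ∀ ζ, ‖f ζ‖ ≤ C) :
    ∫ ζ, ((‖ζ‖ ^ 2 + 1) ^ 2)⁻¹ • f ζ = ∫ r in Set.Ioi (0 : ℝ), (r / (r ^ 2 + 1) ^ 2) •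
      ∫ θ in (0 : ℝ)..2 * Real.pi, f (r * Complex.exp (θ * Complex.I)) := by
  have hpi : -Real.pi ≤ Real.pi := by linarith [Real.pi_pos]
  set F : ℝ × ℝ → E := fun p => (p.1 / (p.1 ^ 2 + 1) ^ 2) •
    f (p.1 * Complex.exp (p.2 * Complex.I)) with hF
  have hFc : Continuous F := by
    refine Continuous.smul (Continuous.div (by fun_prop) (by fun_prop) fun p => by positivity) ?_
    exact hf.comp (by fun_prop)
  have hint : IntegrableOn F (Set.Ioi (0 : ℝ) ×ˢ Set.Ioo (-Real.pi) Real.pi) := by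
    have h1 : Integrable (fun p : ℝ × ℝ => (1 + p.1 ^ 2)⁻¹ * C)
        ((volume.restrict (Set.Ioi 0)).prod (volume.restrict (Set.Ioo (-Real.pi) Real.pi))) :=
      (integrable_inv_one_add_sq.restrict).mul_prod (integrable_const C)
    rw [IntegrableOn, Measure.volume_eq_prod, ← Measure.prod_restrict]
    refine h1.mono' hFc.aestronglyMeasurable (Eventually.of_forall fun p => ?_)
    rw [hF, norm_smul]
    refine mul_le_mul ?_ (hC _) (norm_nonneg _) (by positivity)
    rw [Real.norm_eq_abs, abs_div, abs_of_pos (by positivity : (0 : ℝ) < (p.1 ^ 2 + 1) ^ 2),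
      div_le_iff₀ (by positivity), add_comm 1, sq (p.1 ^ 2 + 1), ← mul_assoc,
      inv_mul_cancel₀ (by positivity), one_mul]
    exact abs_le.2 ⟨by nlinarith [sq_nonneg (p.1 + 1)], by nlinarith [sq_nonneg (p.1 - 1)]⟩
  rw [← Complex.integral_comp_polarCoord_symm]
  have h1 : ∀ p ∈ polarCoord.target, p.1 • (((‖Complex.polarCoord.symm p‖ ^ 2 + 1) ^ 2)⁻¹ •
      f (Complex.polarCoord.symm p)) = F p := by
    intro p hp
    have hp1 : 0 < p.1 := hp.1
    rw [Complex.norm_polarCoord_symm, sq_abs, smul_smul, ← div_eq_mul_inv,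
      Complex.polarCoord_symm_apply]
    simp only [hF, Complex.exp_mul_I, Complex.ofReal_cos, Complex.ofReal_sin]
  rw [setIntegral_congr_fun polarCoord.open_target.measurableSet h1, polarCoord_target,
    Measure.volume_eq_prod, setIntegral_prod F hint]
  refine setIntegral_congr_fun measurableSet_Ioi fun r _ => ?_
  simp only [hF]
  rw [integral_smul]
  congr 1
  rw [← integral_Ioc_eq_integral_Ioo, ← intervalIntegral.integral_of_le hpi]
  have hper : Function.Periodic (fun θ : ℝ => f (r * Complex.exp (θ * Complex.I)))
      (2 * Real.pi) := by
    intro θ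
    simp only [Complex.ofReal_add, add_mul, Complex.ofReal_mul, Complex.ofReal_ofNat]
    rw [Complex.exp_periodic]
  have := hper.intervalIntegral_add_eq (-Real.pi) 0
  rw [zero_add, show -Real.pi + 2 * Real.pi = Real.pi by ring] at this
  exact this

/-- The area element of the sphere in the polar angle `φ = 2 arctan |ζ|`. -/
theorem integral_sphere_eq_angles {f : ℂ → E} (hf : Continuous f) {C : ℝ} (hC : ∀ ζ, ‖f ζ‖ ≤ C) :
    ∫ ζ, ((‖ζ‖ ^ 2 + 1) ^ 2)⁻¹ • f ζ = ∫ φ in (0 : ℝ)..Real.pi, (Real.sin φ / 4) •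
      ∫ θ in (0 : ℝ)..2 * Real.pi, f (Real.tan (φ / 2) * Complex.exp (θ * Complex.I)) := by
  rw [integral_sphere_eq_radial hf hC, intervalIntegral.integral_of_le Real.pi_pos.le,
    integral_Ioc_eq_integral_Ioo]
  have hcos : ∀ φ ∈ Set.Ioo 0 Real.pi, 0 < Real.cos (φ / 2) := fun φ hφ =>
    Real.cos_pos_of_mem_Ioo ⟨by linarith [hφ.1, Real.pi_pos], by linarith [hφ.2]⟩
  have himg : (fun φ => Real.tan (φ / 2)) '' Set.Ioo 0 Real.pi = Set.Ioi 0 := by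
    ext r
    constructor
    · rintro ⟨φ, hφ, rfl⟩
      exact Real.tan_pos_of_pos_of_lt_pi_div_two (by linarith [hφ.1]) (by linarith [hφ.2])
    · intro hr
      have h1 := Real.arctan_pos.2 (Set.mem_Ioi.1 hr)
      have h2 := Real.arctan_lt_pi_div_two r
      exact ⟨2 * Real.arctan r, ⟨by linarith, by linarith⟩, by
        simp [mul_div_cancel_left₀, Real.tan_arctan]⟩
  have hder : ∀ φ ∈ Set.Ioo 0 Real.pi, HasDerivWithinAt (fun φ => Real.tan (φ / 2))
      (1 / Real.cos (φ / 2) ^ 2 * (1 / 2)) (Set.Ioo 0 Real.pi) φ := fun φ hφ =>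
    (HasDerivAt.comp (h₂ := Real.tan) (h := fun φ => φ / 2) φ
      (Real.hasDerivAt_tan (hcos φ hφ).ne') ((hasDerivAt_id' φ).div_const 2)).hasDerivWithinAt
  have hinj : Set.InjOn (fun φ => Real.tan (φ / 2)) (Set.Ioo 0 Real.pi) := by
    intro x hx y hy hxy
    have := Real.injOn_tan ⟨by linarith [hx.1, Real.pi_pos], by linarith [hx.2]⟩
      ⟨by linarith [hy.1, Real.pi_pos], by linarith [hy.2]⟩ hxy
    linarith
  rw [← himg, integral_image_eq_integral_abs_deriv_smul measurableSet_Ioo hder hinj]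
  refine setIntegral_congr_fun measurableSet_Ioo fun φ hφ => ?_
  have hc := hcos φ hφ
  rw [smul_smul]
  congr 1
  rw [abs_of_pos (by positivity), Real.tan_eq_sin_div_cos]
  have h2 : Real.sin φ = 2 * Real.sin (φ / 2) * Real.cos (φ / 2) := by
    rw [← Real.sin_two_mul]; congr 1; ring
  have h3 : (Real.sin (φ / 2) / Real.cos (φ / 2)) ^ 2 + 1 = 1 / Real.cos (φ / 2) ^ 2 := by
    rw [div_pow, div_add_one (by positivity), Real.sin_sq_add_cos_sq]
  rw [h3, h2]
  field_simp
  ring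

theorem polarCos_tan_mul_exp {φ : ℝ} (hφ : Real.cos (φ / 2) ≠ 0) (θ : ℝ) :
    polarCos (Real.tan (φ / 2) * Complex.exp (θ * Complex.I)) = Real.cos φ := by
  have h3 : (Real.sin (φ / 2) / Real.cos (φ / 2)) ^ 2 + 1 = 1 / Real.cos (φ / 2) ^ 2 := by
    rw [div_pow, div_add_one (by positivity), Real.sin_sq_add_cos_sq]
  have h2 : Real.cos φ = 2 * Real.cos (φ / 2) ^ 2 - 1 := by
    rw [← Real.cos_two_mul]; congr 1; ring
  rw [polarCos, norm_mul, Complex.norm_exp_ofReal_mul_I, mul_one, Complex.norm_real,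
    Real.norm_eq_abs, sq_abs, Real.tan_eq_sin_div_cos, h3,
    show 1 - (Real.sin (φ / 2) / Real.cos (φ / 2)) ^ 2 =
      2 - ((Real.sin (φ / 2) / Real.cos (φ / 2)) ^ 2 + 1) by ring, h3, h2]
  field_simp

theorem integral_sin_mul_comp_cos {h : ℝ → ℝ} (hh : ContinuousOn h (Set.Icc (-1) 1)) :
    ∫ φ in (0 : ℝ)..Real.pi, Real.sin φ * h (Real.cos φ) = ∫ t in (-1 : ℝ)..1, h t := by
  have key := intervalIntegral.integral_comp_mul_deriv' (a := 0) (b := Real.pi) (f := Real.cos)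
    (f' := fun x => -Real.sin x) (g := h) (fun x _ => Real.hasDerivAt_cos x)
    (by fun_prop) (hh.mono (by
      rintro _ ⟨x, _, rfl⟩
      exact ⟨Real.neg_one_le_cos x, Real.cos_le_one x⟩))
  rw [Real.cos_zero, Real.cos_pi, intervalIntegral.integral_symm (-1) 1] at key
  rw [← neg_inj, ← key, ← intervalIntegral.integral_neg]
  refine intervalIntegral.integral_congr fun x _ => ?_
  simp only [Function.comp_apply]
  ring

/-- Integration over the sphere of a function with known mean over the azimuth. -/
theorem integral_sphere_of_azimuth_mean {f : ℂ → ℂ} (hf : Continuous f) {C : ℝ}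
    (hC : ∀ ζ, ‖f ζ‖ ≤ C) {h : ℝ → ℝ} (hh : ContinuousOn h (Set.Icc (-1) 1))
    (hm : ∀ r : ℝ, 0 < r → ∫ θ in (0 : ℝ)..2 * Real.pi, f (r * Complex.exp (θ * Complex.I)) =
      ((2 * Real.pi * h (polarCos r) : ℝ) : ℂ)) :
    ∫ ζ, ((‖ζ‖ ^ 2 + 1) ^ 2)⁻¹ • f ζ = ((Real.pi / 2 * ∫ t in (-1 : ℝ)..1, h t : ℝ) : ℂ) := by
  rw [integral_sphere_eq_angles hf hC, ← integral_sin_mul_comp_cos hh,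
    ← intervalIntegral.integral_const_mul, ← intervalIntegral.integral_ofReal,
    intervalIntegral.integral_of_le Real.pi_pos.le, intervalIntegral.integral_of_le Real.pi_pos.le,
    integral_Ioc_eq_integral_Ioo, integral_Ioc_eq_integral_Ioo]
  refine setIntegral_congr_fun measurableSet_Ioo fun φ hφ => ?_
  have hc : 0 < Real.cos (φ / 2) :=
    Real.cos_pos_of_mem_Ioo ⟨by linarith [hφ.1, Real.pi_pos], by linarith [hφ.2]⟩
  have ht : 0 < Real.tan (φ / 2) :=
    Real.tan_pos_of_pos_of_lt_pi_div_two (by linarith [hφ.1]) (by linarith [hφ.2])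
  have hp := polarCos_tan_mul_exp hc.ne' 0
  simp only [Complex.ofReal_zero, zero_mul, Complex.exp_zero, mul_one] at hp
  rw [hm _ ht, hp, Complex.real_smul, ← Complex.ofReal_mul]
  congr 1
  ring

theorem IsRotation.normSq_moebius_add_one {m : SL(2, ℂ)} (hm : IsRotation m) {ζ : ℂ}
    (hζ : m 1 0 * ζ + m 1 1 ≠ 0) :
    ‖moebius m ζ‖ ^ 2 + 1 = (‖ζ‖ ^ 2 + 1) / ‖m 1 0 * ζ + m 1 1‖ ^ 2 := by
  have : ‖m 1 0 * ζ + m 1 1‖ ≠ 0 := norm_ne_zero_iff.2 hζ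
  rw [← hm.energy_eq ζ, energy, moebius, norm_div, div_pow,
    div_add_one (pow_ne_zero 2 this)]

/-- Invariance of the area of the sphere under rotations. -/
theorem integral_sphere_comp_rotation {m : SL(2, ℂ)} (hm : IsRotation m) {f : ℂ → ℝ}
    (hf : Continuous f) (h0 : ∀ ζ, 0 ≤ f ζ) :
    ∫ ζ, ((‖ζ‖ ^ 2 + 1) ^ 2)⁻¹ • f (moebius m ζ) = ∫ ζ, ((‖ζ‖ ^ 2 + 1) ^ 2)⁻¹ • f ζ := by
  have hM : Measurable fun ζ : ℂ => ((‖ζ‖ ^ 2 + 1) ^ 2)⁻¹ := by fun_prop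
  rw [integral_eq_lintegral_of_nonneg_ae
      (Eventually.of_forall fun ζ => smul_nonneg (by positivity) (h0 _))
      (hM.smul (hf.measurable.comp (measurable_moebius m))).aestronglyMeasurable,
    integral_eq_lintegral_of_nonneg_ae
      (Eventually.of_forall fun ζ => smul_nonneg (by positivity) (h0 _))
      (hM.smul hf.measurable).aestronglyMeasurable]
  congr 1
  refine Eq.trans ?_ (lintegral_moebius m _)
  refine lintegral_congr_ae ?_
  filter_upwards [ae_denom_ne m] with ζ hζ
  have h2 := hm.normSq_moebius_add_one hζ
  set N := m 1 0 * ζ + m 1 1 with hN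
  have h3 : ‖moebiusDeriv m ζ‖ₑ ^ 2 = ENNReal.ofReal ((‖N‖ ^ 2)⁻¹ ^ 2) := by
    rw [← ofReal_norm, ← ENNReal.ofReal_pow (norm_nonneg _), moebiusDeriv, norm_inv, norm_pow]
  rw [h3, ← ENNReal.ofReal_mul (by positivity), h2]
  congr 1
  have : ‖N‖ ≠ 0 := by simpa using hζ
  rw [smul_eq_mul, smul_eq_mul]
  field_simp

end Sphere

/-! ### Inner products of the potentials -/

section Potentials

/-- The element `g₀₃(σ)⁻¹ g₁₃(φ) g₀₃(s)`. It carries `u` to the four-velocity with rapidity `s`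
and polar angle `φ`, as seen from a frame boosted by `σ`. -/
def boostRot (σ φ s : ℝ) : SL(2, ℂ) := boost (-σ) * rotation13 φ * boost s

/-- The time component of the four-velocity `boostRot σ φ s u`. -/
def velocityTime (σ φ s : ℝ) : ℝ :=
  Real.cosh s * Real.cosh σ - Real.sinh s * Real.sinh σ * Real.cos φ

/-- The component along the third axis of the four-velocity `boostRot σ φ s u`. -/
def velocityAxial (σ φ s : ℝ) : ℝ :=
  Real.sinh s * Real.cosh σ * Real.cos φ - Real.cosh s * Real.sinh σ

theorem boost_inv (s : ℝ) : (boost s)⁻¹ = boost (-s) := by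
  refine inv_eq_of_mul_eq_one_right ?_
  ext i j
  rw [mul_apply]
  fin_cases i <;> fin_cases j <;> simp [boost, ← Complex.exp_add] <;> ring_nf <;> simp

theorem boost_zero : boost 0 = 1 := by
  ext i j
  fin_cases i <;> fin_cases j <;> simp [boost]

theorem rotation13_inv (t : ℝ) : (rotation13 t)⁻¹ = rotation13 (-t) := by
  ext i j
  rw [Matrix.SpecialLinearGroup.coe_inv, Matrix.adjugate_fin_two]
  fin_cases i <;> fin_cases j <;> simp [rotation13, neg_div]

theorem rotation13_zero : rotation13 0 = 1 := by
  ext i j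
  fin_cases i <;> fin_cases j <;> simp [rotation13]

theorem boostRot_inv (σ φ s : ℝ) : (boostRot σ φ s)⁻¹ = boostRot s (-φ) σ := by
  rw [boostRot, boostRot, mul_inv_rev, mul_inv_rev, boost_inv, boost_inv, rotation13_inv, neg_neg,
    mul_assoc]

theorem boostRot_entries (σ φ s : ℝ) :
    boostRot σ φ s 0 0 = ((Real.exp ((s - σ) / 2) * Real.cos (φ / 2) : ℝ) : ℂ) ∧
    boostRot σ φ s 0 1 = ((-(Real.exp (-(s + σ) / 2) * Real.sin (φ / 2)) : ℝ) : ℂ) ∧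
    boostRot σ φ s 1 0 = ((Real.exp ((s + σ) / 2) * Real.sin (φ / 2) : ℝ) : ℂ) ∧
    boostRot σ φ s 1 1 = ((Real.exp ((σ - s) / 2) * Real.cos (φ / 2) : ℝ) : ℂ) := by
  have e1 : Complex.exp ((s - σ) / 2) = Complex.exp (-σ / 2) * Complex.exp (s / 2) := by
    rw [← Complex.exp_add]; congr 1; ring
  have e2 : Complex.exp (-(s + σ) / 2) = Complex.exp (-σ / 2) * Complex.exp (-(s / 2)) := by
    rw [← Complex.exp_add]; congr 1; ring
  have e3 : Complex.exp ((s + σ) / 2) = Complex.exp (σ / 2) * Complex.exp (s / 2) := by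
    rw [← Complex.exp_add]; congr 1; ring
  have e4 : Complex.exp ((σ - s) / 2) = Complex.exp (σ / 2) * Complex.exp (-(s / 2)) := by
    rw [← Complex.exp_add]; congr 1; ring
  have e5 : Complex.exp (-(-σ / 2)) = Complex.exp (σ / 2) := by congr 1; ring
  simp only [boostRot, mul_apply]
  push_cast
  rw [e1, e2, e3, e4]
  simp [boost, rotation13, e5]
  refine ⟨?_, ?_, ?_, ?_⟩ <;> ring

theorem conj_boostRot (σ φ s : ℝ) (i j : Fin 2) :
    conj (boostRot σ φ s i j) = boostRot σ φ s i j := by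
  obtain ⟨h1, h2, h3, h4⟩ := boostRot_entries σ φ s
  fin_cases i <;> fin_cases j
  · simp only [Fin.zero_eta, Fin.isValue]; rw [h1, Complex.conj_ofReal]
  · simp only [Fin.zero_eta, Fin.mk_one, Fin.isValue]; rw [h2, Complex.conj_ofReal]
  · simp only [Fin.zero_eta, Fin.mk_one, Fin.isValue]; rw [h3, Complex.conj_ofReal]
  · simp only [Fin.mk_one, Fin.isValue]; rw [h4, Complex.conj_ofReal]

theorem exp_half_sq (x : ℝ) : Real.exp (x / 2) ^ 2 = Real.exp x := by
  rw [← Real.exp_nat_mul]; congr 1; push_cast; ring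

/-- The entries of the Hermitian matrix `B Bᴴ` with `B = boostRot σ φ s`, in terms of the components
of the four-velocity; the last one up to sign. -/
theorem boostRot_quadratic (σ φ s : ℝ) :
    (Real.exp ((σ - s) / 2) * Real.cos (φ / 2)) ^ 2 +
      (Real.exp ((σ + s) / 2) * Real.sin (φ / 2)) ^ 2 =
        velocityTime σ φ s - velocityAxial σ φ s ∧
    (Real.exp (-(σ + s) / 2) * Real.sin (φ / 2)) ^ 2 +
      (Real.exp ((s - σ) / 2) * Real.cos (φ / 2)) ^ 2 =
        velocityTime σ φ s + velocityAxial σ φ s ∧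
    (Real.exp ((σ - s) / 2) * Real.cos (φ / 2)) * (Real.exp (-(σ + s) / 2) * Real.sin (φ / 2)) -
      (Real.exp ((σ + s) / 2) * Real.sin (φ / 2)) * (Real.exp ((s - σ) / 2) * Real.cos (φ / 2)) =
        -(Real.sinh s * Real.sin φ) := by
  have hc : Real.cos φ = 2 * Real.cos (φ / 2) ^ 2 - 1 := by
    rw [← Real.cos_two_mul]; congr 1; ring
  have hs : Real.sin φ = 2 * Real.sin (φ / 2) * Real.cos (φ / 2) := by
    rw [← Real.sin_two_mul]; congr 1; ring
  have hss := Real.sin_sq (φ / 2)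
  have e1 : Real.exp (σ - s) = Real.exp σ * Real.exp (-s) := by rw [← Real.exp_add]; rfl
  have e2 : Real.exp (σ + s) = Real.exp σ * Real.exp s := Real.exp_add _ _
  have e3 : Real.exp (-(σ + s)) = Real.exp (-σ) * Real.exp (-s) := by
    rw [← Real.exp_add]; congr 1; ring
  have e4 : Real.exp (s - σ) = Real.exp (-σ) * Real.exp s := by
    rw [← Real.exp_add]; congr 1; ring
  have e5 : Real.exp ((σ - s) / 2) * Real.exp (-(σ + s) / 2) = Real.exp (-s) := by
    rw [← Real.exp_add]; congr 1; ring
  have e6 : Real.exp ((σ + s) / 2) * Real.exp ((s - σ) / 2) = Real.exp s := by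
    rw [← Real.exp_add]; congr 1; ring
  refine ⟨?_, ?_, ?_⟩
  · rw [mul_pow, mul_pow, exp_half_sq, exp_half_sq, e1, e2, velocityTime, velocityAxial, hc, hss]
    simp only [Real.cosh_eq, Real.sinh_eq]
    ring
  · rw [mul_pow, mul_pow, exp_half_sq, exp_half_sq, e3, e4, velocityTime, velocityAxial, hc, hss]
    simp only [Real.cosh_eq, Real.sinh_eq]
    ring
  · rw [hs, Real.sinh_eq]
    linear_combination Real.cos (φ / 2) * Real.sin (φ / 2) * (e5 - e6)

theorem energy_boostRot_inv (σ φ s : ℝ) (ζ : ℂ) :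
    energy (boostRot σ φ s)⁻¹ ζ = (velocityTime σ φ s - velocityAxial σ φ s) * ‖ζ‖ ^ 2 -
      2 * (Real.sinh s * Real.sin φ) * ζ.re + (velocityTime σ φ s + velocityAxial σ φ s) := by
  obtain ⟨h1, h2, h3, h4⟩ := boostRot_entries s (-φ) σ
  obtain ⟨k1, k2, k3⟩ := boostRot_quadratic σ φ s
  have hn : ∀ (a b : ℝ), ‖(a : ℂ) * ζ + b‖ ^ 2 = a ^ 2 * ‖ζ‖ ^ 2 + 2 * (a * b) * ζ.re + b ^ 2 := by
    intro a b
    rw [← Complex.normSq_eq_norm_sq, ← Complex.normSq_eq_norm_sq, Complex.normSq_apply,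
      Complex.normSq_apply]
    simp
    ring
  rw [boostRot_inv, energy, h1, h2, h3, h4, hn, hn, ← k1, ← k2]
  simp only [neg_div, Real.cos_neg, Real.sin_neg, mul_neg, neg_neg] at k3 ⊢
  linear_combination 2 * ζ.re * k3

theorem energyDz_boostRot_inv (σ φ s : ℝ) (ζ : ℂ) :
    energyDz (boostRot σ φ s)⁻¹ ζ =
      ((velocityTime σ φ s - velocityAxial σ φ s : ℝ) : ℂ) * conj ζ -
        ((Real.sinh s * Real.sin φ : ℝ) : ℂ) := by
  obtain ⟨h1, h2, h3, h4⟩ := boostRot_entries s (-φ) σ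
  obtain ⟨k1, -, k3⟩ := boostRot_quadratic σ φ s
  rw [boostRot_inv, energyDz, h1, h2, h3, h4]
  simp only [map_add, map_mul, Complex.conj_ofReal]
  rw [← k1, ← neg_eq_iff_eq_neg.2 k3]
  simp only [neg_div, Real.cos_neg, Real.sin_neg, mul_neg, neg_neg]
  push_cast
  ring

theorem boostRot_zero_zero (x : ℝ) : boostRot 0 0 x = boost x := by
  rw [boostRot, neg_zero, boost_zero, rotation13_zero, one_mul, one_mul]

theorem boostRot_zero (t x : ℝ) : boostRot 0 t x = rotation13 t * boost x := by
  rw [boostRot, neg_zero, boost_zero, one_mul]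

theorem velocity_sq (σ φ s : ℝ) : velocityTime σ φ s ^ 2 =
    1 + (Real.sinh s * Real.sin φ) ^ 2 + velocityAxial σ φ s ^ 2 := by
  rw [velocityTime, velocityAxial]
  have h1 := Real.cosh_sq s
  have h2 := Real.cosh_sq σ
  have h3 := Real.sin_sq φ
  rw [mul_pow (Real.sinh s), h3]
  linear_combination (Real.cosh σ ^ 2 - Real.sinh σ ^ 2) * h1 +
    (1 + Real.sinh s ^ 2 - Real.sinh s ^ 2 * Real.cos φ ^ 2) * h2

theorem cosh_mul_exp_neg_abs_le (σ φ s : ℝ) :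
    Real.cosh s * Real.exp (-|σ|) ≤ velocityTime σ φ s := by
  have h1 : Real.exp (-|σ|) = Real.cosh σ - |Real.sinh σ| := by
    rw [Real.abs_sinh, ← Real.cosh_abs σ, Real.cosh_sub_sinh]
  have h2 : |Real.sinh s| ≤ Real.cosh s := by
    rw [Real.abs_sinh, ← Real.cosh_abs s]; exact (Real.sinh_lt_cosh _).le
  have h3 : Real.sinh s * Real.sinh σ * Real.cos φ ≤ Real.cosh s * |Real.sinh σ| := by
    refine (le_abs_self _).trans ?_
    rw [abs_mul, abs_mul]
    calc |Real.sinh s| * |Real.sinh σ| * |Real.cos φ|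
        ≤ |Real.sinh s| * |Real.sinh σ| * 1 := by
          gcongr; exact Real.abs_cos_le_one φ
      _ ≤ Real.cosh s * |Real.sinh σ| := by rw [mul_one]; gcongr
  rw [h1, velocityTime]
  linarith

theorem one_le_velocityTime (σ φ s : ℝ) : 1 ≤ velocityTime σ φ s := by
  have h0 : 0 < velocityTime σ φ s :=
    lt_of_lt_of_le (by have := Real.cosh_pos s; positivity) (cosh_mul_exp_neg_abs_le σ φ s)
  have h1 := velocity_sq σ φ s
  nlinarith [sq_nonneg (Real.sinh s * Real.sin φ), sq_nonneg (velocityAxial σ φ s)]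

/-- Polar coordinates of the four-velocity of `boostRot σ φ s`: it is obtained from `u` by a boost
along the third axis and a rotation in the `13` plane. -/
theorem exists_logShift_boostRot_eq (σ φ s : ℝ) : ∃ t : ℝ,
    logShift (boostRot σ φ s) =
      photonRep (rotation13 t) (logShift (boost (Real.arcosh (velocityTime σ φ s)))) := by
  have h1 := one_le_velocityTime σ φ s
  set x := Real.arcosh (velocityTime σ φ s) with hx
  have hcosh : Real.cosh x = velocityTime σ φ s := Real.cosh_arcosh h1
  set c : ℂ := ⟨velocityAxial σ φ s, Real.sinh s * Real.sin φ⟩ with hc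
  have hnorm : ‖c‖ = Real.sinh x := by
    rw [Real.sinh_arcosh h1, Complex.norm_def, Complex.normSq_apply, hc]
    congr 1
    linear_combination -velocity_sq σ φ s
  have hre : Real.sinh x * Real.cos c.arg = velocityAxial σ φ s := by
    rw [← hnorm, Complex.norm_mul_cos_arg]
  have him : Real.sinh x * Real.sin c.arg = Real.sinh s * Real.sin φ := by
    rw [← hnorm, Complex.norm_mul_sin_arg]
  refine ⟨c.arg, ?_⟩
  rw [← (isRotation_rotation13 _).logShift_mul_left, ← boostRot_zero]
  refine logShift_congr _ _ fun ζ => ?_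
  rw [energy_boostRot_inv, energy_boostRot_inv, him]
  have e1 : velocityTime 0 c.arg x = velocityTime σ φ s := by simp [velocityTime, hcosh]
  have e2 : velocityAxial 0 c.arg x = velocityAxial σ φ s := by simp [velocityAxial, hre]
  rw [e1, e2]

theorem inner_logShift (g h : SL(2, ℂ)) : ⟪logShift g, logShift h⟫_ℂ =
    ∫ ζ, conj (logEnergyDz g⁻¹ ζ - logEnergyDz 1 ζ) * (logEnergyDz h⁻¹ ζ - logEnergyDz 1 ζ) := by
  rw [L2.inner_def]
  refine integral_congr_ae ?_
  filter_upwards [logShift_ae g, logShift_ae h] with ζ h1 h2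
  rw [h1, h2, RCLike.inner_apply, mul_comm]

theorem logEnergyDz_conj {g : SL(2, ℂ)} (hg : ∀ i j, conj (g i j) = g i j) (ζ : ℂ) :
    logEnergyDz g (conj ζ) = conj (logEnergyDz g ζ) := by
  have hn : energy g (conj ζ) = energy g ζ := by
    have h : ∀ i, ‖g i 0 * conj ζ + g i 1‖ = ‖g i 0 * ζ + g i 1‖ := fun i => by
      rw [← RCLike.norm_conj (g i 0 * ζ + g i 1), map_add, map_mul, hg, hg]
    rw [energy, energy, h, h]
  rw [logEnergyDz, logEnergyDz, hn, map_div₀, Complex.conj_ofReal]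
  congr 1
  simp only [energyDz, map_add, map_mul, hg, Complex.conj_conj]

/-- The reflection `ζ ↦ conj ζ` shows that the potentials of real matrices have real inner
products. -/
theorem inner_logShift_im_eq_zero {g h : SL(2, ℂ)} (hg : ∀ i j, conj (g⁻¹ i j) = g⁻¹ i j)
    (hh : ∀ i j, conj (h⁻¹ i j) = h⁻¹ i j) : (⟪logShift g, logShift h⟫_ℂ).im = 0 := by
  rw [← Complex.conj_eq_iff_im, inner_logShift, ← integral_conj]
  have h1 := Complex.conjLIE.measurePreserving.integral_comp
    Complex.conjLIE.toHomeomorph.measurableEmbedding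
    fun ζ => conj (logEnergyDz g⁻¹ ζ - logEnergyDz 1 ζ) * (logEnergyDz h⁻¹ ζ - logEnergyDz 1 ζ)
  rw [← h1]
  refine integral_congr_ae (Eventually.of_forall fun ζ => ?_)
  have h2 : ∀ i j, conj ((1 : SL(2, ℂ)) i j) = (1 : SL(2, ℂ)) i j := by
    intro i j
    fin_cases i <;> fin_cases j <;> simp
  simp only [Complex.conjLIE_apply]
  rw [logEnergyDz_conj hg, logEnergyDz_conj hh, logEnergyDz_conj h2]
  simp only [map_mul, map_sub, Complex.conj_conj]

/-- The function `x coth x - 1`, continuous at `0`. -/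
def cothDefect (x : ℝ) : ℝ := if x = 0 then 0 else x * (Real.cosh x / Real.sinh x) - 1

theorem cosh_add_mul_sinh_pos (x : ℝ) {t : ℝ} (ht : t ∈ Set.Icc (-1 : ℝ) 1) :
    0 < Real.cosh x + t * Real.sinh x := by
  have h1 : 0 < Real.cosh x + Real.sinh x := by rw [Real.cosh_add_sinh]; positivity
  have h2 : 0 < Real.cosh x - Real.sinh x := by rw [Real.cosh_sub_sinh]; positivity
  rcases le_total 0 (Real.sinh x) with h | h
  · nlinarith [ht.1, ht.2]
  · nlinarith [ht.1, ht.2]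

/-- The integral over the polar cosine which gives the norm of the potential of a boost. -/
theorem integral_zonal_norm {x : ℝ} (hx : x ≠ 0) :
    ∫ t in (-1 : ℝ)..1, Real.sinh x ^ 2 * (1 - t ^ 2) / (Real.cosh x + t * Real.sinh x) ^ 2 =
      4 * cothDefect x := by
  set S := Real.sinh x with hS
  set Co := Real.cosh x with hCo
  have hS0 : S ≠ 0 := by rw [hS]; simpa using hx
  have hsq : Co ^ 2 = S ^ 2 + 1 := Real.cosh_sq x
  have hpos : ∀ t ∈ Set.uIcc (-1 : ℝ) 1, 0 < Co + t * S := by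
    intro t ht
    rw [Set.uIcc_of_le (by norm_num)] at ht
    exact cosh_add_mul_sinh_pos x ht
  have hder : ∀ t ∈ Set.uIcc (-1 : ℝ) 1, HasDerivAt
      (fun t => S⁻¹ * ((Co + t * S)⁻¹ + 2 * Co * Real.log (Co + t * S) - (Co + t * S)))
      (S ^ 2 * (1 - t ^ 2) / (Co + t * S) ^ 2) t := by
    intro t ht
    have hy := (hpos t ht).ne'
    have h1 : HasDerivAt (fun t => Co + t * S) S t := by
      simpa using ((hasDerivAt_id t).mul_const S).const_add Co
    refine ((((h1.inv hy).add ((h1.log hy).const_mul (2 * Co))).sub h1).const_mul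
      S⁻¹).congr_deriv ?_
    have h2 : S ^ 2 * (1 - t ^ 2) = -1 + 2 * Co * (Co + t * S) - (Co + t * S) ^ 2 := by
      linear_combination (-1 : ℝ) * hsq
    rw [h2]
    generalize Co + t * S = y at hy
    field_simp
  rw [intervalIntegral.integral_eq_sub_of_hasDerivAt hder]
  · rw [show Co + 1 * S = Real.exp x by rw [one_mul, Real.cosh_add_sinh],
      show Co + -1 * S = Real.exp (-x) by rw [← Real.cosh_sub_sinh]; ring, Real.log_exp,
      Real.log_exp, ← Real.exp_neg, ← Real.exp_neg, neg_neg, cothDefect, if_neg hx]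
    have : Real.exp x - Real.exp (-x) = 2 * S := by rw [hS, Real.sinh_eq]; ring
    rw [← hS, ← hCo]
    field_simp
    linear_combination (-2 : ℝ) * this
  · refine ContinuousOn.intervalIntegrable ?_
    exact ContinuousOn.div (by fun_prop) (by fun_prop) fun t ht => by
      have := hpos t ht; positivity

theorem norm_logShift_boost_sq (x : ℝ) :
    ‖logShift (boost x)‖ ^ 2 = 2 * Real.pi * cothDefect x := by
  rcases eq_or_ne x 0 with rfl | hx
  · simp [boost_zero, logShift_one, cothDefect]
  have h1 : (((‖logShift (boost x)‖ ^ 2 : ℝ)) : ℂ) =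
      ⟪logShift (boost x), logShift (boost x)⟫_ℂ := by
    rw [inner_self_eq_norm_sq_to_K]; push_cast; rfl
  set f : ℂ → ℂ := fun ζ => ((4 * Real.sinh x ^ 2 * ‖ζ‖ ^ 2 /
    (Real.exp (-x) * ‖ζ‖ ^ 2 + Real.exp x) ^ 2 : ℝ) : ℂ) with hf
  have hE : ∀ ζ : ℂ, 0 < Real.exp (-x) * ‖ζ‖ ^ 2 + Real.exp x := fun ζ => by positivity
  have hfc : Continuous f := by
    refine Complex.continuous_ofReal.comp (Continuous.div (by fun_prop) (by fun_prop) fun ζ => ?_)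
    exact (pow_pos (hE ζ) 2).ne'
  have hee : Real.exp (-x) * Real.exp x = 1 := by rw [← Real.exp_add]; simp
  have hfC : ∀ ζ, ‖f ζ‖ ≤ Real.sinh x ^ 2 := by
    intro ζ
    rw [hf, Complex.norm_real, Real.norm_of_nonneg (by positivity),
      div_le_iff₀ (pow_pos (hE ζ) 2), mul_comm (4 : ℝ), mul_assoc]
    refine mul_le_mul_of_nonneg_left ?_ (by positivity)
    nlinarith [sq_nonneg (Real.exp (-x) * ‖ζ‖ ^ 2 - Real.exp x)]
  have h2 : ⟪logShift (boost x), logShift (boost x)⟫_ℂ = ∫ ζ, ((‖ζ‖ ^ 2 + 1) ^ 2)⁻¹ • f ζ := by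
    rw [inner_logShift]
    refine integral_congr_ae (Eventually.of_forall fun ζ => ?_)
    have e1 : energy (boost x)⁻¹ ζ = Real.exp (-x) * ‖ζ‖ ^ 2 + Real.exp x := by
      rw [← boostRot_zero_zero, energy_boostRot_inv]
      simp [velocityTime, velocityAxial, Real.cosh_sub_sinh, Real.cosh_add_sinh]
    have e2 : energyDz (boost x)⁻¹ ζ = Real.exp (-x) * conj ζ := by
      rw [← boostRot_zero_zero, energyDz_boostRot_inv]
      simp [velocityTime, velocityAxial, ← Complex.cosh_sub_sinh]
    have e3 : energy 1 ζ = ‖ζ‖ ^ 2 + 1 := by simp [energy]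
    have e4 : energyDz 1 ζ = conj ζ := by simp [energyDz]
    have hE' : ((Real.exp (-x) * ‖ζ‖ ^ 2 + Real.exp x : ℝ) : ℂ) ≠ 0 := by
      exact_mod_cast (hE ζ).ne'
    have hM' : ((‖ζ‖ ^ 2 + 1 : ℝ) : ℂ) ≠ 0 := by
      have : 0 < ‖ζ‖ ^ 2 + 1 := by positivity
      exact_mod_cast this.ne'
    have hD : logEnergyDz (boost x)⁻¹ ζ - logEnergyDz 1 ζ = conj ζ *
        ((-2 * Real.sinh x /
          ((Real.exp (-x) * ‖ζ‖ ^ 2 + Real.exp x) * (‖ζ‖ ^ 2 + 1)) : ℝ) : ℂ) := by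
      rw [logEnergyDz, logEnergyDz, e1, e2, e3, e4]
      have : (-2 * Real.sinh x) = Real.exp (-x) - Real.exp x := by rw [Real.sinh_eq]; ring
      rw [this]
      push_cast at hE' hM' ⊢
      field_simp
      ring
    simp only
    rw [hD, map_mul, Complex.conj_conj, Complex.conj_ofReal, hf, Complex.real_smul]
    have hz : ζ * conj ζ = ((‖ζ‖ ^ 2 : ℝ) : ℂ) := by
      rw [Complex.mul_conj, Complex.normSq_eq_norm_sq]
    calc _ = (ζ * conj ζ) * (((-2 * Real.sinh x / ((Real.exp (-x) * ‖ζ‖ ^ 2 + Real.exp x) *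
          (‖ζ‖ ^ 2 + 1)) : ℝ) : ℂ)) ^ 2 := by ring
      _ = _ := by
        rw [hz, ← Complex.ofReal_pow, ← Complex.ofReal_mul, ← Complex.ofReal_mul]
        congr 1
        field_simp
        ring
  have h3 := integral_sphere_of_azimuth_mean hfc hfC
    (h := fun t => Real.sinh x ^ 2 * (1 - t ^ 2) / (Real.cosh x + t * Real.sinh x) ^ 2) ?_ ?_
  · rw [integral_zonal_norm hx] at h3
    rw [← h2, ← h1] at h3
    have h4 : ‖logShift (boost x)‖ ^ 2 = Real.pi / 2 * (4 * cothDefect x) := by exact_mod_cast h3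
    rw [h4]; ring
  · refine ContinuousOn.div (by fun_prop) (by fun_prop) fun t ht => ?_
    have := cosh_add_mul_sinh_pos x ht
    positivity
  · intro r hr
    have h7 : ∀ θ : ℝ, f (r * Complex.exp (θ * Complex.I)) = ((Real.sinh x ^ 2 *
        (1 - polarCos r ^ 2) / (Real.cosh x + polarCos r * Real.sinh x) ^ 2 : ℝ) : ℂ) := by
      intro θ
      have hr2 : r ^ 2 + 1 ≠ 0 := by positivity
      have e : Real.cosh x + (1 - r ^ 2) / (r ^ 2 + 1) * Real.sinh x =
          (Real.exp (-x) * r ^ 2 + Real.exp x) / (r ^ 2 + 1) := by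
        rw [Real.cosh_eq, Real.sinh_eq]
        field_simp
        ring
      simp only [hf, polarCos, norm_mul, Complex.norm_exp_ofReal_mul_I, mul_one, Complex.norm_real,
        Real.norm_eq_abs, sq_abs]
      rw [e]
      have : Real.exp (-x) * r ^ 2 + Real.exp x ≠ 0 := by positivity
      congr 1
      field_simp
      ring
    simp only [h7, intervalIntegral.integral_const, sub_zero, Complex.real_smul]
    push_cast
    ring

end Potentials

/-! ### Overlaps of the moving charge states -/

section Overlaps

/-- The state `U(g)|u⟩`. -/
def ketVelocity (q : ℝ) (n : ℤ) (g : SL(2, ℂ)) : Fock Photon := lorentz q n g ketU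

/-- The overlap of two states `|v⟩`, `|v'⟩` as a function of `c = v · v'`; the truncation at `1`
makes it continuous on the whole line. -/
def overlapKernel (z c : ℝ) : ℝ := Real.exp (-z * cothDefect (Real.arcosh (max c 1)))

variable (q : ℝ) (n : ℤ)

theorem ketVelocity_eq (g : SL(2, ℂ)) : ketVelocity q n g =
    Complex.exp (-(‖coulombShift q n g‖ ^ 2 / 2 : ℝ)) • expVec (coulombShift q n g) :=
  affineUnitary_vacuum _ _

theorem IsRotation.lorentz_ketVelocity {a : SL(2, ℂ)} (ha : IsRotation a) (g : SL(2, ℂ)) :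
    lorentz q n a (ketVelocity q n g) = ketVelocity q n (a * g) := by
  have h0 : coulombShift q n a = 0 := by
    rw [coulombShift_eq, ha.logShift_eq_zero, smul_zero]
  have h1 : coulombShift q n (a * g) = photonRep a (coulombShift q n g) := by
    rw [coulombShift_eq, coulombShift_eq, ha.logShift_mul_left, map_smul]
  rw [ketVelocity_eq, ketVelocity_eq, h1, map_smul, lorentz, affineUnitary_expVec, h0,
    LinearIsometryEquiv.norm_map]
  simp

theorem IsRotation.ketVelocity_mul {a : SL(2, ℂ)} (ha : IsRotation a) (g : SL(2, ℂ)) :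
    ketVelocity q n (g * a) = ketVelocity q n g := by
  have h1 : coulombShift q n (g * a) = coulombShift q n g := by
    rw [coulombShift_eq, coulombShift_eq, ha.logShift_mul_right]
  rw [ketVelocity_eq, ketVelocity_eq, h1]

theorem norm_ketVelocity (g : SL(2, ℂ)) : ‖ketVelocity q n g‖ = 1 := by
  rw [ketVelocity, LinearIsometryEquiv.norm_map, ketU, vacuum, norm_eq_sqrt_re_inner (𝕜 := ℂ),
    inner_expVec]
  simp

theorem coulombShift_sub (g h : SL(2, ℂ)) : coulombShift q n g - coulombShift q n h =
    (-Complex.I * (n * q / Real.pi)) • (logShift g - logShift h) := by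
  rw [coulombShift_eq, coulombShift_eq, smul_sub]

theorem norm_charge_sq :
    ‖(-Complex.I * (n * q / Real.pi) : ℂ)‖ ^ 2 = couplingZ q n / Real.pi := by
  have h : (-Complex.I * (n * q / Real.pi) : ℂ) = -Complex.I * ((n * q / Real.pi : ℝ) : ℂ) := by
    push_cast; rfl
  rw [h, norm_mul, norm_neg, Complex.norm_I, one_mul, Complex.norm_real, Real.norm_eq_abs, sq_abs,
    couplingZ]
  field_simp

theorem inner_coulombShift (g h : SL(2, ℂ)) : ⟪coulombShift q n g, coulombShift q n h⟫_ℂ =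
    ((couplingZ q n / Real.pi : ℝ) : ℂ) * ⟪logShift g, logShift h⟫_ℂ := by
  rw [coulombShift_eq, coulombShift_eq, inner_smul_left, inner_smul_right, ← norm_charge_sq,
    ← mul_assoc, ← Complex.normSq_eq_conj_mul_self, Complex.normSq_eq_norm_sq]

theorem inner_ketVelocity {g h : SL(2, ℂ)} (hgh : (⟪logShift g, logShift h⟫_ℂ).im = 0) :
    ⟪ketVelocity q n g, ketVelocity q n h⟫_ℂ =
      (Real.exp (-(couplingZ q n / (2 * Real.pi) * ‖logShift (g⁻¹ * h)‖ ^ 2)) : ℝ) := by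
  rw [ketVelocity_eq, ketVelocity_eq, inner_coherent_of_im_eq_zero, coulombShift_sub, norm_smul,
    mul_pow, norm_charge_sq, norm_logShift_sub]
  · congr 3
    field_simp
  · rw [inner_coulombShift, Complex.im_ofReal_mul, hgh, mul_zero]

/-- The Euler decomposition of a rotation. -/
theorem IsRotation.exists_euler {A : SL(2, ℂ)} (hA : IsRotation A) :
    ∃ θ φ ϑ : ℝ, A = rotation12 θ * rotation13 φ * rotation12 ϑ ∧
      Real.cos φ = 2 * ‖A 0 0‖ ^ 2 - 1 := by
  have hn := hA.normSq_add
  have h10 : ‖A 1 0‖ = ‖A 0 1‖ := by rw [hA.2, norm_neg, RCLike.norm_conj]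
  set φ := Real.arccos (2 * ‖A 0 0‖ ^ 2 - 1) with hφ
  have hcos : Real.cos φ = 2 * ‖A 0 0‖ ^ 2 - 1 :=
    Real.cos_arccos (by nlinarith [sq_nonneg ‖A 0 0‖]) (by nlinarith [sq_nonneg ‖A 0 1‖])
  have hφ0 : 0 ≤ φ := Real.arccos_nonneg _
  have hφπ : φ ≤ Real.pi := Real.arccos_le_pi _
  have hc : Real.cos (φ / 2) = ‖A 0 0‖ := by
    have h1 : 0 ≤ Real.cos (φ / 2) :=
      Real.cos_nonneg_of_mem_Icc ⟨by linarith [Real.pi_pos], by linarith⟩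
    have h2 : Real.cos φ = 2 * Real.cos (φ / 2) ^ 2 - 1 := by
      rw [← Real.cos_two_mul]; congr 1; ring
    exact (sq_eq_sq₀ h1 (norm_nonneg _)).1 (by linarith)
  have hs : Real.sin (φ / 2) = ‖A 1 0‖ := by
    have h1 : 0 ≤ Real.sin (φ / 2) :=
      Real.sin_nonneg_of_nonneg_of_le_pi (by linarith) (by linarith)
    have h2 := Real.sin_sq_add_cos_sq (φ / 2)
    rw [hc] at h2
    rw [h10]
    exact (sq_eq_sq₀ h1 (norm_nonneg _)).1 (by linarith)
  set u := (A 0 0).arg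
  set v := (A 1 0).arg
  have e0 : A 0 0 = Real.cos (φ / 2) * Complex.exp (u * Complex.I) := by
    rw [hc, Complex.norm_mul_exp_arg_mul_I]
  have e1 : A 1 0 = Real.sin (φ / 2) * Complex.exp (v * Complex.I) := by
    rw [hs, Complex.norm_mul_exp_arg_mul_I]
  refine ⟨v - u, φ, -(u + v), ?_, hcos⟩
  have hR : IsRotation (rotation12 (v - u) * rotation13 φ * rotation12 (-(u + v))) :=
    ((isRotation_rotation12 _).mul (isRotation_rotation13 _)).mul (isRotation_rotation12 _)
  have f0 : (rotation12 (v - u) * rotation13 φ * rotation12 (-(u + v))) 0 0 = A 0 0 := by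
    rw [e0, mul_apply, mul_apply, mul_apply]
    have : Complex.exp (u * Complex.I) = Complex.exp (-(Complex.I * (v - u) / 2)) *
        Complex.exp (-(Complex.I * -(u + v) / 2)) := by
      rw [← Complex.exp_add]; congr 1; ring
    rw [this]
    simp [rotation12, rotation13]
    ring
  have f1 : (rotation12 (v - u) * rotation13 φ * rotation12 (-(u + v))) 1 0 = A 1 0 := by
    rw [e1, mul_apply, mul_apply, mul_apply]
    have : Complex.exp (v * Complex.I) = Complex.exp (Complex.I * (v - u) / 2) *
        Complex.exp (-(Complex.I * -(u + v) / 2)) := by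
      rw [← Complex.exp_add]; congr 1; ring
    rw [this]
    simp [rotation12, rotation13]
    ring
  have g1 : A 0 1 = -conj (A 1 0) := by rw [hA.2]; simp
  have g2 : (rotation12 (v - u) * rotation13 φ * rotation12 (-(u + v))) 0 1 =
      -conj ((rotation12 (v - u) * rotation13 φ * rotation12 (-(u + v))) 1 0) := by
    rw [hR.2]; simp
  ext i j
  fin_cases i <;> fin_cases j
  · exact f0.symm
  · change A 0 1 = _
    rw [g1, ← f1]; exact g2.symm
  · exact f1.symm
  · change A 1 1 = _
    rw [hA.1, ← f0]; exact hR.1.symm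

theorem norm_logShift_boostRot_sq (σ φ s : ℝ) : ‖logShift (boostRot σ φ s)‖ ^ 2 =
    2 * Real.pi * cothDefect (Real.arcosh (velocityTime σ φ s)) := by
  obtain ⟨t, ht⟩ := exists_logShift_boostRot_eq σ φ s
  rw [ht, LinearIsometryEquiv.norm_map, norm_logShift_boost_sq]

theorem conj_inv_boostRot (σ φ s : ℝ) (i j : Fin 2) :
    conj ((boostRot σ φ s)⁻¹ i j) = (boostRot σ φ s)⁻¹ i j := by
  rw [boostRot_inv, conj_boostRot]

theorem rotation12_inv (t : ℝ) : (rotation12 t)⁻¹ = rotation12 (-t) := by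
  ext i j
  rw [Matrix.SpecialLinearGroup.coe_inv, Matrix.adjugate_fin_two]
  fin_cases i <;> fin_cases j <;> simp [rotation12, neg_div]

theorem inner_photonRep_left (g : SL(2, ℂ)) (f f' : Photon) :
    ⟪photonRep g f, f'⟫_ℂ = ⟪f, photonRep g⁻¹ f'⟫_ℂ := by
  rw [← (photonRep g⁻¹).inner_map_map, ← photonRep_mul, inv_mul_cancel]
  congr 1
  exact photonMap_one f

/-- By the Euler decomposition and the invariance of the axial potentials under rotations about the
third axis, only rotations in the `13` plane, whose matrices are real, have to be considered. -/
theorem inner_logShift_rotation_im_eq_zero {a a' : SL(2, ℂ)} (ha : IsRotation a)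
    (ha' : IsRotation a') (s t : ℝ) :
    (⟪logShift (a * boost s), logShift (a' * boost t)⟫_ℂ).im = 0 := by
  obtain ⟨θ, φ, ϑ, hA, -⟩ := (ha.inv.mul ha').exists_euler
  rw [ha.logShift_mul_left, ha'.logShift_mul_left, inner_photonRep_left, ← photonRep_mul, hA,
    photonRep_mul, photonRep_mul, photonRep_rotation12_logShift_boost,
    ← (isRotation_rotation13 φ).logShift_mul_left]
  have h := inner_photonRep_left (rotation12 (-θ)) (logShift (boost s))
    (logShift (rotation13 φ * boost t))
  rw [photonRep_rotation12_logShift_boost, rotation12_inv, neg_neg] at h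
  rw [← h, ← boostRot_zero, ← boostRot_zero_zero s]
  exact inner_logShift_im_eq_zero (conj_inv_boostRot _ _ _) (conj_inv_boostRot _ _ _)

/-- The overlap of two moving states depends only on their relative rapidity, whose hyperbolic
cosine is `cosh s cosh t - sinh s sinh t cos φ`, where `φ` is the angle between the directions of
motion and `cos φ = 2 ‖(a⁻¹ a')₀₀‖² - 1`. -/
theorem inner_ketVelocity_rotation {a a' : SL(2, ℂ)} (ha : IsRotation a) (ha' : IsRotation a')
    (s t : ℝ) : ⟪ketVelocity q n (a * boost s), ketVelocity q n (a' * boost t)⟫_ℂ =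
      (overlapKernel (couplingZ q n) (Real.cosh s * Real.cosh t -
        Real.sinh s * Real.sinh t * (2 * ‖(a⁻¹ * a') 0 0‖ ^ 2 - 1)) : ℝ) := by
  rw [inner_ketVelocity q n (inner_logShift_rotation_im_eq_zero ha ha' s t)]
  obtain ⟨θ, φ, ϑ, hA, hφ⟩ := (ha.inv.mul ha').exists_euler
  have h1 : (a * boost s)⁻¹ * (a' * boost t) =
      rotation12 θ * (boostRot s φ t * rotation12 ϑ) := by
    calc (a * boost s)⁻¹ * (a' * boost t) = boost (-s) * (a⁻¹ * a') * boost t := by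
          rw [mul_inv_rev, boost_inv]; group
      _ = rotation12 θ * (boostRot s φ t * rotation12 ϑ) := by
          rw [hA, boostRot]
          simp only [mul_assoc]
          rw [rotation12_mul_boost ϑ t, ← mul_assoc, ← rotation12_mul_boost]
          simp only [mul_assoc]
  rw [h1, (isRotation_rotation12 θ).logShift_mul_left, LinearIsometryEquiv.norm_map,
    (isRotation_rotation12 ϑ).logShift_mul_right, norm_logShift_boostRot_sq, overlapKernel]
  have h2 : Real.cosh s * Real.cosh t - Real.sinh s * Real.sinh t *
      (2 * ‖(a⁻¹ * a') 0 0‖ ^ 2 - 1) = velocityTime s φ t := by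
    rw [velocityTime, hφ]; ring
  rw [h2, max_eq_left (one_le_velocityTime s φ t)]
  congr 2
  have := Real.pi_ne_zero
  field_simp

theorem cothDefect_nonneg (x : ℝ) : 0 ≤ cothDefect x := by
  have h := norm_logShift_boost_sq x
  have h1 : 0 ≤ 2 * Real.pi * cothDefect x := by rw [← h]; positivity
  exact nonneg_of_mul_nonneg_right h1 (by positivity)

theorem continuous_cothDefect : Continuous cothDefect := by
  rw [continuous_iff_continuousAt]
  intro x
  rcases eq_or_ne x 0 with rfl | hx
  · rw [continuousAt_iff_punctured_nhds, cothDefect, if_pos rfl]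
    have h1 : Tendsto (fun x : ℝ => x⁻¹ * Real.sinh x) (𝓝[≠] 0) (𝓝 1) := by
      have := (Real.hasDerivAt_sinh 0).tendsto_slope_zero
      simpa using this
    have h2 : Tendsto (fun x : ℝ => Real.cosh x) (𝓝[≠] 0) (𝓝 1) := by
      have := (Real.continuous_cosh.tendsto 0).mono_left (nhdsWithin_le_nhds (s := {0}ᶜ))
      simpa using this
    have h3 := (h2.div h1 one_ne_zero).sub_const 1
    rw [div_one, sub_self] at h3
    refine h3.congr' ?_
    filter_upwards [self_mem_nhdsWithin] with y hy
    have hy0 : y ≠ 0 := hy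
    have hs : Real.sinh y ≠ 0 := by simpa using hy0
    simp only [Pi.div_apply]
    rw [cothDefect, if_neg hy0]
    field_simp
  · have hs : Real.sinh x ≠ 0 := by simpa using hx
    have h1 : ContinuousAt (fun y : ℝ => y * (Real.cosh y / Real.sinh y) - 1) x :=
      (continuousAt_id.mul (Real.continuous_cosh.continuousAt.div
        Real.continuous_sinh.continuousAt hs)).sub_const 1
    refine h1.congr ?_
    filter_upwards [isOpen_ne.mem_nhds hx] with y hy
    rw [cothDefect, if_neg hy]

theorem continuous_overlapKernel (z : ℝ) : Continuous (overlapKernel z) := by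
  have h1 : Continuous fun c : ℝ => Real.arcosh (max c 1) :=
    Real.continuousOn_arcosh.comp_continuous (by fun_prop) fun c => le_max_right c 1
  exact Real.continuous_exp.comp (continuous_const.mul (continuous_cothDefect.comp h1))

theorem overlapKernel_pos (z c : ℝ) : 0 < overlapKernel z c := Real.exp_pos _

theorem overlapKernel_le_one {z : ℝ} (hz : 0 ≤ z) (c : ℝ) : overlapKernel z c ≤ 1 :=
  Real.exp_le_one_iff.2 (by nlinarith [cothDefect_nonneg (Real.arcosh (max c 1))])

theorem continuous_rotation_entry (b : SL(2, ℂ)) (i j : Fin 2) :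
    Continuous fun p : ℝ × ℝ => (b * (rotation12 p.1 * rotation13 p.2)) i j := by
  have h1 : ∀ i j, Continuous fun p : ℝ × ℝ => rotation12 p.1 i j := by
    intro i j
    fin_cases i <;> fin_cases j <;> simp [rotation12] <;> fun_prop
  have h2 : ∀ i j, Continuous fun p : ℝ × ℝ => rotation13 p.2 i j := by
    intro i j
    fin_cases i <;> fin_cases j <;> simp [rotation13] <;> fun_prop
  simp only [mul_apply]
  have := h1 0 0; have := h1 0 1; have := h1 1 0; have := h1 1 1
  have := h2 0 0; have := h2 0 1; have := h2 1 0; have := h2 1 1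
  fin_cases j <;> fun_prop

theorem isRotation_euler (θ φ : ℝ) : IsRotation (rotation12 θ * rotation13 φ) :=
  (isRotation_rotation12 _).mul (isRotation_rotation13 _)

/-- Strong continuity on the states, read off from their overlaps. -/
theorem continuous_ketVelocity_rotation (s : ℝ) : Continuous fun p : ℝ × ℝ =>
    ketVelocity q n (rotation12 p.1 * rotation13 p.2 * boost s) := by
  rw [continuous_iff_continuousAt]
  intro p
  rw [ContinuousAt, tendsto_iff_norm_sub_tendsto_zero]
  set a := rotation12 p.1 * rotation13 p.2 with ha
  set k : ℝ × ℝ → ℝ := fun p' => overlapKernel (couplingZ q n) (Real.cosh s * Real.cosh s -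
        Real.sinh s * Real.sinh s *
          (2 * ‖(a⁻¹ * (rotation12 p'.1 * rotation13 p'.2)) 0 0‖ ^ 2 - 1)) with hk
  have h1 : ∀ p' : ℝ × ℝ, ‖ketVelocity q n (rotation12 p'.1 * rotation13 p'.2 * boost s) -
      ketVelocity q n (a * boost s)‖ = √(2 - 2 * k p') := by
    intro p'
    rw [norm_sub_rev, ← Real.sqrt_sq (norm_nonneg _), @norm_sub_sq ℂ, norm_ketVelocity,
      norm_ketVelocity,
      inner_ketVelocity_rotation q n (isRotation_euler p.1 p.2) (isRotation_euler p'.1 p'.2)]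
    congr 1
    simp only [RCLike.re_to_complex, Complex.ofReal_re, hk]
    ring
  simp_rw [h1]
  have h2 : Continuous fun p' => √(2 - 2 * k p') := by
    have := continuous_rotation_entry a⁻¹ 0 0
    have h3 : Continuous k := (continuous_overlapKernel _).comp (by fun_prop)
    fun_prop
  have h4 := h2.tendsto p
  have h5 : √(2 - 2 * k p) = 0 := by
    rw [← h1 p, ← ha, sub_self, norm_zero]
  rwa [h5] at h4

end Overlaps

/-! ### Rotation means and their Gram matrix -/

section Mean
variable (q : ℝ) (n : ℤ)

/-- The third Euler angle drops out of the mean, because rotations about the axis of the boost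
commute with it and leave `|u⟩` invariant. -/
theorem rotationMean_ketVelocity (s : ℝ) :
    (rotationMean fun a => lorentz q n a (lorentz q n (boost s) ketU)) =
      ∫ θ in (0 : ℝ)..2 * Real.pi, ∫ φ in (0 : ℝ)..Real.pi, (Real.sin φ / (4 * Real.pi)) •
        ketVelocity q n (rotation12 θ * rotation13 φ * boost s) := by
  have h : ∀ θ φ ϑ : ℝ, lorentz q n (rotation12 θ * rotation13 φ * rotation12 ϑ)
      (lorentz q n (boost s) ketU) =
        ketVelocity q n (rotation12 θ * rotation13 φ * boost s) := by
    intro θ φ ϑ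
    have h1 := ((isRotation_euler θ φ).mul (isRotation_rotation12 ϑ)).lorentz_ketVelocity q n
      (boost s)
    rw [ketVelocity] at h1
    rw [h1, mul_assoc (rotation12 θ * rotation13 φ), rotation12_mul_boost, ← mul_assoc,
      (isRotation_rotation12 ϑ).ketVelocity_mul]
  simp only [rotationMean, h, intervalIntegral.integral_const, smul_smul, sub_zero]
  refine intervalIntegral.integral_congr fun θ _ => intervalIntegral.integral_congr fun φ _ => ?_
  have := Real.pi_ne_zero
  congr 1
  field_simp
  ring

theorem inner_iterated_integral {E : Type*} [NormedAddCommGroup E] [InnerProductSpace ℂ E]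
    [CompleteSpace E] (X : E) {F : ℝ → ℝ → E} (hF : Continuous (Function.uncurry F))
    {w : ℝ → ℝ} (hw : Continuous w) (a b c d : ℝ) :
    ⟪X, ∫ θ in a..b, ∫ φ in c..d, w φ • F θ φ⟫_ℂ =
      ∫ θ in a..b, ∫ φ in c..d, w φ • ⟪X, F θ φ⟫_ℂ := by
  have hc : Continuous (Function.uncurry fun θ φ : ℝ => w φ • F θ φ) :=
    (hw.comp continuous_snd).smul hF
  have h1 : Continuous fun θ : ℝ => ∫ φ in c..d, w φ • F θ φ :=
    intervalIntegral.continuous_parametric_intervalIntegral_of_continuous' hc _ _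
  rw [← innerSL_apply_apply ℂ X,
    ← (innerSL ℂ X).intervalIntegral_comp_comm (h1.intervalIntegrable _ _)]
  refine intervalIntegral.integral_congr fun θ _ => ?_
  have h2 : Continuous fun φ : ℝ => w φ • F θ φ :=
    hc.comp (by fun_prop : Continuous fun φ : ℝ => (θ, φ))
  change innerSL ℂ X (∫ φ in c..d, w φ • F θ φ) = _
  rw [← (innerSL ℂ X).intervalIntegral_comp_comm (h2.intervalIntegrable _ _)]
  refine intervalIntegral.integral_congr fun φ _ => ?_
  simp only [innerSL_apply_apply, inner_smul_right_eq_smul]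

theorem inner_rotationMean_ketVelocity (X : Fock Photon) (s : ℝ) :
    ⟪X, rotationMean fun a => lorentz q n a (lorentz q n (boost s) ketU)⟫_ℂ =
      ∫ θ in (0 : ℝ)..2 * Real.pi, ∫ φ in (0 : ℝ)..Real.pi, (Real.sin φ / (4 * Real.pi)) •
        ⟪X, ketVelocity q n (rotation12 θ * rotation13 φ * boost s)⟫_ℂ := by
  rw [rotationMean_ketVelocity]
  exact inner_iterated_integral X
    (F := fun θ φ => ketVelocity q n (rotation12 θ * rotation13 φ * boost s))
    (continuous_ketVelocity_rotation q n s)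
    (w := fun φ => Real.sin φ / (4 * Real.pi)) (by fun_prop) _ _ _ _

/-- The mean over the Euler angles of a function of the direction is the mean over the sphere. -/
theorem integral_euler_comp {b : SL(2, ℂ)} (hb : IsRotation b) {k : ℝ → ℝ} (hk : Continuous k)
    (h0 : ∀ t, 0 ≤ k t) {C : ℝ} (hC : ∀ t, k t ≤ C) :
    ∫ θ in (0 : ℝ)..2 * Real.pi, ∫ φ in (0 : ℝ)..Real.pi, Real.sin φ / (4 * Real.pi) *
      k (2 * ‖(b * (rotation12 θ * rotation13 φ)) 0 0‖ ^ 2 - 1) =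
        1 / 2 * ∫ t in (-1 : ℝ)..1, k t := by
  set f : ℂ → ℝ := fun ζ => k (2 * (‖b 0 0 + b 0 1 * ζ‖ ^ 2 / (‖ζ‖ ^ 2 + 1)) - 1) with hf
  have hfc : Continuous f := by
    refine hk.comp (Continuous.sub (continuous_const.mul ?_) continuous_const)
    exact Continuous.div (by fun_prop) (by fun_prop) fun ζ => by positivity
  have hkC : ∀ t, ‖k t‖ ≤ C := fun t => by rw [Real.norm_of_nonneg (h0 t)]; exact hC t
  -- The rotation taking the spinor `(conj b₀₁, conj b₀₀)` to the pole `ζ = 0`: the argument of `k`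
  -- is the polar cosine of `m ζ`.
  set m : SL(2, ℂ) := ⟨!![conj (b 0 0), -conj (b 0 1); b 0 1, b 0 0], by
    rw [Matrix.det_fin_two_of]
    have h1 := det_eq b
    rw [hb.1, hb.2] at h1
    linear_combination h1⟩ with hm
  have m10 : m 1 0 = b 0 1 := rfl
  have m11 : m 1 1 = b 0 0 := rfl
  have hmR : IsRotation m := by
    constructor
    · change b 0 0 = conj (conj (b 0 0)); simp
    · change b 0 1 = -conj (-conj (b 0 1)); simp
  have h1 : ∫ ζ, ((‖ζ‖ ^ 2 + 1) ^ 2)⁻¹ • f ζ =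
      ∫ ζ, ((‖ζ‖ ^ 2 + 1) ^ 2)⁻¹ • k (polarCos (moebius m ζ)) := by
    refine integral_congr_ae ?_
    filter_upwards [ae_denom_ne m] with ζ hζ
    have h2 := hmR.normSq_moebius_add_one hζ
    have h3 : ‖b 0 0 + b 0 1 * ζ‖ ≠ 0 := by
      rw [m10, m11, add_comm] at hζ; exact norm_ne_zero_iff.2 hζ
    rw [m10, m11, add_comm (b 0 1 * ζ)] at h2
    have h4 : (‖ζ‖ ^ 2 + 1) ≠ 0 := by positivity
    rw [hf, polarCos, show 1 - ‖moebius m ζ‖ ^ 2 = 2 - (‖moebius m ζ‖ ^ 2 + 1) by ring, h2]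
    congr 2
    field_simp
  have h2 := integral_sphere_eq_angles hfc (C := C) fun ζ => hkC _
  rw [h1, integral_sphere_comp_rotation hmR (f := fun ζ => k (polarCos ζ))
    (hk.comp continuous_polarCos) (fun ζ => h0 _),
    integral_sphere_eq_angles (f := fun ζ => k (polarCos ζ)) (hk.comp continuous_polarCos)
      (C := C) (fun ζ => hkC _)] at h2
  have h3 : ∀ φ ∈ Set.Ioo 0 Real.pi, Real.cos (φ / 2) ≠ 0 := fun φ hφ =>
    (Real.cos_pos_of_mem_Ioo ⟨by linarith [hφ.1, Real.pi_pos], by linarith [hφ.2]⟩).ne'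
  have hswap : Continuous (Function.uncurry fun θ φ : ℝ => Real.sin φ / (4 * Real.pi) *
      k (2 * ‖(b * (rotation12 θ * rotation13 φ)) 0 0‖ ^ 2 - 1)) := by
    have := continuous_rotation_entry b 0 0
    simp only [Function.uncurry_def]
    fun_prop
  rw [intervalIntegral_intervalIntegral_swap]
  · have h4 : ∫ φ in (0 : ℝ)..Real.pi, ∫ θ in (0 : ℝ)..2 * Real.pi, Real.sin φ / (4 * Real.pi) *
        k (2 * ‖(b * (rotation12 θ * rotation13 φ)) 0 0‖ ^ 2 - 1) =
        (1 / Real.pi) * ∫ φ in (0 : ℝ)..Real.pi, (Real.sin φ / 4) • ∫ θ in (0 : ℝ)..2 * Real.pi,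
          f (Real.tan (φ / 2) * Complex.exp (θ * Complex.I)) := by
      rw [← intervalIntegral.integral_const_mul, intervalIntegral.integral_of_le Real.pi_pos.le,
        intervalIntegral.integral_of_le Real.pi_pos.le, integral_Ioc_eq_integral_Ioo,
        integral_Ioc_eq_integral_Ioo]
      refine setIntegral_congr_fun measurableSet_Ioo fun φ hφ => ?_
      simp only [smul_eq_mul]
      rw [intervalIntegral.integral_const_mul, ← mul_assoc]
      congr 1
      · field_simp
      refine intervalIntegral.integral_congr fun θ _ => ?_
      simp only [hf]
      congr 3
      have hc := h3 φ hφ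
      have hc' : (Real.cos (φ / 2) : ℂ) ≠ 0 := by exact_mod_cast hc
      have e1 : (b * (rotation12 θ * rotation13 φ)) 0 0 = Complex.exp (-(Complex.I * θ / 2)) *
          (Real.cos (φ / 2) *
            (b 0 0 + b 0 1 * (Real.tan (φ / 2) * Complex.exp (θ * Complex.I)))) := by
        have e2 : Complex.exp (Complex.I * θ / 2) =
            Complex.exp (-(Complex.I * θ / 2)) * Complex.exp (θ * Complex.I) := by
          rw [← Complex.exp_add]; congr 1; ring
        rw [Real.tan_eq_sin_div_cos]
        push_cast at hc' ⊢
        rw [mul_apply, mul_apply, mul_apply]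
        simp [rotation12, rotation13, e2]
        field_simp
      have e3 : ‖Complex.exp (-(Complex.I * θ / 2))‖ = 1 := by
        rw [Complex.norm_exp]; simp
      have e4 : Real.tan (φ / 2) ^ 2 + 1 = 1 / Real.cos (φ / 2) ^ 2 := by
        rw [Real.tan_eq_sin_div_cos, div_pow, div_add_one (by positivity),
          Real.sin_sq_add_cos_sq]
      rw [e1, norm_mul, norm_mul, e3, one_mul, mul_pow, norm_mul (Real.tan (φ / 2) : ℂ),
        Complex.norm_exp_ofReal_mul_I, mul_one, Complex.norm_real, Complex.norm_real,
        Real.norm_eq_abs, Real.norm_eq_abs, sq_abs, sq_abs, e4]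
      field_simp
    rw [h4, ← h2]
    have h5 : ∫ φ in (0 : ℝ)..Real.pi, (Real.sin φ / 4) • ∫ θ in (0 : ℝ)..2 * Real.pi,
        k (polarCos (Real.tan (φ / 2) * Complex.exp (θ * Complex.I))) =
        ∫ φ in (0 : ℝ)..Real.pi, Real.pi / 2 * (Real.sin φ * k (Real.cos φ)) := by
      rw [intervalIntegral.integral_of_le Real.pi_pos.le,
        intervalIntegral.integral_of_le Real.pi_pos.le, integral_Ioc_eq_integral_Ioo,
        integral_Ioc_eq_integral_Ioo]
      refine setIntegral_congr_fun measurableSet_Ioo fun φ hφ => ?_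
      simp only [polarCos_tan_mul_exp (h3 φ hφ),
        intervalIntegral.integral_const, smul_eq_mul]
      ring
    have h6 := integral_sin_mul_comp_cos hk.continuousOn
    rw [h5, intervalIntegral.integral_const_mul, h6]
    have := Real.pi_ne_zero
    field_simp
  · exact ((hswap.continuousOn (s := Set.uIcc 0 (2 * Real.pi) ×ˢ Set.uIcc 0
      Real.pi)).integrableOn_compact (isCompact_uIcc.prod isCompact_uIcc)).mono_set
        (Set.prod_mono Set.uIoc_subset_uIcc Set.uIoc_subset_uIcc)

/-- The function `∫₀^y sinh x exp(-z (x coth x - 1)) dx`. -/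
def kernelPrimitive (z y : ℝ) : ℝ :=
  ∫ x in (0 : ℝ)..y, Real.sinh x * Real.exp (-z * (x * (Real.cosh x / Real.sinh x) - 1))

theorem overlapKernel_cosh (z : ℝ) {x : ℝ} (hx : 0 ≤ x) :
    overlapKernel z (Real.cosh x) = Real.exp (-z * cothDefect x) := by
  rw [overlapKernel, max_eq_left (Real.one_le_cosh x), Real.arcosh_cosh hx]

theorem cothDefect_neg (x : ℝ) : cothDefect (-x) = cothDefect x := by
  simp only [cothDefect, neg_eq_zero, Real.cosh_neg, Real.sinh_neg]
  split_ifs with h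
  · rfl
  · have hs : Real.sinh x ≠ 0 := by simpa using h
    field_simp

theorem cothDefect_abs (x : ℝ) : cothDefect |x| = cothDefect x := by
  rcases abs_choice x with h | h <;> rw [h]
  exact cothDefect_neg x

theorem kernelPrimitive_eq_integral_sinh (z y : ℝ) :
    kernelPrimitive z y = ∫ x in (0 : ℝ)..y, Real.sinh x * overlapKernel z (Real.cosh x) := by
  refine intervalIntegral.integral_congr fun x _ => ?_
  rcases eq_or_ne x 0 with rfl | hx
  · simp
  · rw [← Real.cosh_abs x, overlapKernel_cosh z (abs_nonneg x), cothDefect_abs, cothDefect,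
      if_neg hx, Real.cosh_abs]

theorem kernelPrimitive_eq (z y : ℝ) :
    kernelPrimitive z y = ∫ c in (1 : ℝ)..Real.cosh y, overlapKernel z c := by
  have h := intervalIntegral.integral_comp_mul_deriv (a := 0) (b := y) (f := Real.cosh)
    (f' := Real.sinh) (g := overlapKernel z) (fun x _ => Real.hasDerivAt_cosh x)
    (by fun_prop) (continuous_overlapKernel z)
  rw [Real.cosh_zero] at h
  rw [kernelPrimitive_eq_integral_sinh, ← h]
  exact intervalIntegral.integral_congr fun x _ => mul_comm _ _

theorem integral_overlapKernel (z : ℝ) {s t : ℝ} (hs : 0 < s) (ht : 0 < t) :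
    1 / 2 * ∫ x in (-1 : ℝ)..1, overlapKernel z
      (Real.cosh s * Real.cosh t - Real.sinh s * Real.sinh t * x) =
    (kernelPrimitive z (s + t) - kernelPrimitive z (s - t)) /
      (2 * (Real.sinh s * Real.sinh t)) := by
  have hD : Real.sinh s * Real.sinh t ≠ 0 :=
    (mul_pos (Real.sinh_pos_iff.2 hs) (Real.sinh_pos_iff.2 ht)).ne'
  have hi : ∀ a b, IntervalIntegrable (overlapKernel z) volume a b :=
    fun a b => (continuous_overlapKernel z).intervalIntegrable _ _
  rw [intervalIntegral.integral_comp_sub_mul _ hD, kernelPrimitive_eq, kernelPrimitive_eq,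
    intervalIntegral.integral_interval_sub_left (hi _ _) (hi _ _), Real.cosh_add, Real.cosh_sub,
    mul_one, mul_neg_one, sub_neg_eq_add, smul_eq_mul]
  field_simp

/-- The Gram matrix of the rotation means. -/
theorem inner_rotationMean (hz : 0 ≤ couplingZ q n) (s t : ℝ) :
    ⟪rotationMean fun a => lorentz q n a (lorentz q n (boost s) ketU),
      rotationMean fun a => lorentz q n a (lorentz q n (boost t) ketU)⟫_ℂ =
    ((1 / 2 * ∫ x in (-1 : ℝ)..1, overlapKernel (couplingZ q n)
      (Real.cosh s * Real.cosh t - Real.sinh s * Real.sinh t * x) : ℝ) : ℂ) := by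
  set M := 1 / 2 * ∫ x in (-1 : ℝ)..1, overlapKernel (couplingZ q n)
      (Real.cosh s * Real.cosh t - Real.sinh s * Real.sinh t * x) with hM
  have h1 : ∀ θ' φ' : ℝ, ⟪rotationMean fun a => lorentz q n a (lorentz q n (boost s) ketU),
      ketVelocity q n (rotation12 θ' * rotation13 φ' * boost t)⟫_ℂ = (M : ℂ) := by
    intro θ' φ'
    have hb := isRotation_euler θ' φ'
    have h2 := integral_euler_comp hb.inv
      (k := fun x => overlapKernel (couplingZ q n)
        (Real.cosh s * Real.cosh t - Real.sinh s * Real.sinh t * x))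
      ((continuous_overlapKernel _).comp (by fun_prop)) (fun x => (overlapKernel_pos _ _).le)
      (fun x => overlapKernel_le_one hz _)
    have h3 : ⟪ketVelocity q n (rotation12 θ' * rotation13 φ' * boost t),
        rotationMean fun a => lorentz q n a (lorentz q n (boost s) ketU)⟫_ℂ = (M : ℂ) := by
      rw [inner_rotationMean_ketVelocity, hM, ← h2, ← intervalIntegral.integral_ofReal]
      simp_rw [← intervalIntegral.integral_ofReal]
      refine intervalIntegral.integral_congr fun θ _ =>
        intervalIntegral.integral_congr fun φ _ => ?_
      rw [inner_ketVelocity_rotation q n hb (isRotation_euler θ φ), Complex.real_smul,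
        ← Complex.ofReal_mul, mul_comm (Real.cosh t), mul_comm (Real.sinh t)]
    rw [← inner_conj_symm, h3, Complex.conj_ofReal]
  rw [inner_rotationMean_ketVelocity]
  simp_rw [h1]
  simp only [intervalIntegral.integral_const, intervalIntegral.integral_smul_const,
    intervalIntegral.integral_div, integral_sin]
  simp only [Real.cos_zero, Real.cos_pi, Complex.real_smul, smul_eq_mul]
  have := Real.pi_ne_zero
  rw [show (2 * Real.pi - 0) * (1 - -1) / (4 * Real.pi) = 1 by field_simp; ring]
  simp

end Mean

/-! ### Asymptotics of the overlaps and existence of the bound state -/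

section Asymptotic

theorem tendsto_sinh_mul_exp_neg :
    Tendsto (fun x : ℝ => Real.sinh x * Real.exp (-x)) atTop (𝓝 (1 / 2)) := by
  have h1 : Tendsto (fun x : ℝ => (1 - Real.exp (-(2 * x))) / 2) atTop (𝓝 ((1 - 0) / 2)) := by
    refine (tendsto_const_nhds.sub (Real.tendsto_exp_atBot.comp ?_)).div_const 2
    exact tendsto_neg_atTop_atBot.comp (tendsto_id.const_mul_atTop two_pos)
  rw [sub_zero] at h1
  refine h1.congr fun x => ?_
  have h2 : Real.exp x * Real.exp (-x) = 1 := by rw [← Real.exp_add]; simp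
  have h3 : Real.exp (-(2 * x)) = Real.exp (-x) * Real.exp (-x) := by
    rw [← Real.exp_add]; congr 1; ring
  rw [Real.sinh_eq, h3]
  linear_combination (-1 / 2 : ℝ) * h2

theorem tendsto_cothDefect_sub : Tendsto (fun x => cothDefect x - x) atTop (𝓝 (-1)) := by
  have h0 : Tendsto (fun x : ℝ => x * Real.exp (-x)) atTop (𝓝 0) := by
    simpa using Real.tendsto_pow_mul_exp_neg_atTop_nhds_zero 1
  have h1 : Tendsto (fun x : ℝ => Real.exp (-x)) atTop (𝓝 0) :=
    Real.tendsto_exp_atBot.comp tendsto_neg_atTop_atBot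
  have h2 := ((h0.mul h1).div tendsto_sinh_mul_exp_neg (by norm_num)).sub_const 1
  rw [mul_zero, zero_div, zero_sub] at h2
  refine h2.congr' ?_
  filter_upwards [eventually_gt_atTop 0] with x hx
  have hs : Real.sinh x ≠ 0 := (Real.sinh_pos_iff.2 hx).ne'
  have he := Real.exp_ne_zero (-x)
  have hc : Real.cosh x = Real.sinh x + Real.exp (-x) := by rw [← Real.cosh_sub_sinh]; ring
  simp only [Pi.div_apply]
  rw [cothDefect, if_neg hx.ne', hc]
  field_simp
  ring

theorem sub_one_le_cothDefect {x : ℝ} (hx : 0 ≤ x) : x - 1 ≤ cothDefect x := by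
  rcases hx.eq_or_lt with rfl | hx
  · simp [cothDefect]
  · rw [cothDefect, if_neg hx.ne']
    have hs := Real.sinh_pos_iff.2 hx
    have h1 : 1 ≤ Real.cosh x / Real.sinh x := by
      rw [le_div_iff₀ hs, one_mul]; exact (Real.sinh_lt_cosh x).le
    nlinarith

theorem overlapKernel_cosh_le {z : ℝ} (hz : 0 ≤ z) {x : ℝ} (hx : 0 ≤ x) :
    overlapKernel z (Real.cosh x) ≤ Real.exp z * Real.exp (-(z * x)) := by
  rw [overlapKernel_cosh z hx, ← Real.exp_add, Real.exp_le_exp]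
  nlinarith [sub_one_le_cothDefect hx]

theorem tendsto_overlapKernel_cosh (z : ℝ) :
    Tendsto (fun x : ℝ => overlapKernel z (Real.cosh x) * Real.exp (z * x)) atTop
      (𝓝 (Real.exp z)) := by
  have h1 := (Real.continuous_exp.tendsto _).comp (tendsto_cothDefect_sub.const_mul (-z))
  rw [mul_neg_one, neg_neg] at h1
  refine h1.congr' ?_
  filter_upwards [eventually_ge_atTop 0] with x hx
  rw [overlapKernel_cosh z hx, ← Real.exp_add, Function.comp_apply]
  congr 1
  ring

variable {z : ℝ}

theorem sinh_mul_overlapKernel_le (hz : 0 ≤ z) {x : ℝ} (hx : 0 ≤ x) :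
    Real.sinh x * overlapKernel z (Real.cosh x) ≤
      Real.exp z / 2 * Real.exp ((1 - z) * x) := by
  have h1 : Real.sinh x ≤ Real.exp x / 2 := by
    rw [Real.sinh_eq]; linarith [Real.exp_pos (-x)]
  calc Real.sinh x * overlapKernel z (Real.cosh x)
      ≤ Real.exp x / 2 * (Real.exp z * Real.exp (-(z * x))) :=
        mul_le_mul h1 (overlapKernel_cosh_le hz hx) (overlapKernel_pos _ _).le (by positivity)
    _ = Real.exp z / 2 * Real.exp ((1 - z) * x) := by
        rw [show (1 - z) * x = x + -(z * x) by ring, Real.exp_add]; ring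

/-- The growth of the kernel integral: `kernelPrimitive z y` is asymptotic to
`exp z / (2 (1 - z)) * exp ((1 - z) y)`; this is where `z < 1` is used. -/
theorem tendsto_kernelPrimitive (hz : 0 ≤ z) (hz1 : z < 1) :
    Tendsto (fun y => kernelPrimitive z y * Real.exp (-((1 - z) * y))) atTop
      (𝓝 (Real.exp z / (2 * (1 - z)))) := by
  have hlim : ∫ t in Set.Ioi (0 : ℝ), Real.exp z / 2 * Real.exp (-(1 - z) * t) =
      Real.exp z / (2 * (1 - z)) := by
    rw [integral_const_mul, integral_exp_mul_Ioi (by linarith)]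
    have : 1 - z ≠ 0 := by linarith
    rw [mul_zero, Real.exp_zero, neg_div_neg_eq]
    field_simp
  rw [← hlim]
  set F : ℝ → ℝ → ℝ := fun y t => (Set.Ioc 0 y).indicator (fun t =>
    Real.sinh (y - t) * overlapKernel z (Real.cosh (y - t)) * Real.exp (-((1 - z) * y))) t with hF
  have hcont : ∀ y, Continuous fun t : ℝ =>
      Real.sinh (y - t) * overlapKernel z (Real.cosh (y - t)) * Real.exp (-((1 - z) * y)) := by
    intro y
    have := (continuous_overlapKernel z).comp
      (by fun_prop : Continuous fun t : ℝ => Real.cosh (y - t))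
    simp only [Function.comp_def] at this
    fun_prop
  have hD := tendsto_integral_filter_of_dominated_convergence (l := atTop) (F := F)
    (f := fun t => Real.exp z / 2 * Real.exp (-(1 - z) * t))
    (μ := volume.restrict (Set.Ioi (0 : ℝ)))
    (fun t => Real.exp z / 2 * Real.exp (-(1 - z) * t))
    (Eventually.of_forall fun y =>
      ((hcont y).measurable.indicator measurableSet_Ioc).aestronglyMeasurable) ?_
    ((integrableOn_exp_mul_Ioi (by linarith) 0).const_mul _) ?_
  · refine hD.congr' ?_
    filter_upwards [eventually_ge_atTop 0] with y hy
    rw [hF, setIntegral_indicator measurableSet_Ioc,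
      show Set.Ioi (0 : ℝ) ∩ Set.Ioc 0 y = Set.Ioc 0 y from
        Set.inter_eq_right.2 fun t ht => ht.1, ← intervalIntegral.integral_of_le hy,
      intervalIntegral.integral_mul_const, kernelPrimitive_eq_integral_sinh,
      intervalIntegral.integral_comp_sub_left
        (fun x => Real.sinh x * overlapKernel z (Real.cosh x)) y]
    simp
  · refine Eventually.of_forall fun y => Eventually.of_forall fun t => ?_
    simp only [hF]
    by_cases ht : t ∈ Set.Ioc 0 y
    · have h0 : 0 ≤ y - t := by linarith [ht.2]
      rw [Set.indicator_of_mem ht, Real.norm_of_nonneg]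
      · calc _ ≤ Real.exp z / 2 * Real.exp ((1 - z) * (y - t)) * Real.exp (-((1 - z) * y)) :=
              mul_le_mul_of_nonneg_right (sinh_mul_overlapKernel_le hz h0) (Real.exp_pos _).le
          _ = _ := by
              rw [mul_assoc, ← Real.exp_add]; congr 2; ring
      · have := Real.sinh_nonneg_iff.2 h0
        have := overlapKernel_pos z (Real.cosh (y - t))
        positivity
    · rw [Set.indicator_of_notMem ht, norm_zero]
      positivity
  · refine (ae_restrict_iff' measurableSet_Ioi).2 (Eventually.of_forall fun t ht => ?_)
    have h1 : Tendsto (fun y : ℝ => y - t) atTop atTop :=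
      tendsto_atTop_add_const_right _ _ tendsto_id
    have h2 := ((tendsto_sinh_mul_exp_neg.mul (tendsto_overlapKernel_cosh z)).comp h1).mul_const
      (Real.exp (-(1 - z) * t))
    rw [show 1 / 2 * Real.exp z = Real.exp z / 2 by ring] at h2
    refine h2.congr' ?_
    filter_upwards [eventually_ge_atTop t] with y hy
    simp only [hF, Function.comp_apply]
    rw [Set.indicator_of_mem (show t ∈ Set.Ioc 0 y from ⟨ht, hy⟩)]
    have h3 : Real.exp (-((1 - z) * y)) = Real.exp (-(y - t)) * Real.exp (z * (y - t)) *
        Real.exp (-(1 - z) * t) := by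
      rw [← Real.exp_add, ← Real.exp_add]; congr 1; ring
    rw [h3]
    ring

theorem kernelPrimitive_le (hz : 0 ≤ z) (hz1 : z < 1) {y : ℝ} (hy : 0 ≤ y) :
    kernelPrimitive z y ≤ Real.exp z / (2 * (1 - z)) * Real.exp ((1 - z) * y) := by
  have hz' : 0 < 1 - z := by linarith
  have h1 : kernelPrimitive z y ≤ ∫ x in (0 : ℝ)..y, Real.exp z / 2 * Real.exp ((1 - z) * x) := by
    rw [kernelPrimitive_eq_integral_sinh]
    refine intervalIntegral.integral_mono_on hy ?_ ?_ fun x hx =>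
      sinh_mul_overlapKernel_le hz hx.1
    · have := (continuous_overlapKernel z).comp Real.continuous_cosh
      exact (Real.continuous_sinh.mul this).intervalIntegrable _ _
    · exact (by fun_prop : Continuous fun x : ℝ =>
        Real.exp z / 2 * Real.exp ((1 - z) * x)).intervalIntegrable _ _
  refine h1.trans ?_
  rw [intervalIntegral.integral_const_mul, intervalIntegral.integral_comp_mul_left _ hz'.ne',
    integral_exp, mul_zero, Real.exp_zero, smul_eq_mul, ← mul_assoc,
    show Real.exp z / (2 * (1 - z)) = Real.exp z / 2 * (1 - z)⁻¹ by field_simp]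
  exact mul_le_mul_of_nonneg_left (by linarith) (by positivity)

theorem kernelPrimitive_abs (y : ℝ) : kernelPrimitive z |y| = kernelPrimitive z y := by
  rw [kernelPrimitive_eq, kernelPrimitive_eq, Real.cosh_abs]

theorem kernelPrimitive_nonneg (y : ℝ) : 0 ≤ kernelPrimitive z y := by
  rw [kernelPrimitive_eq]
  exact intervalIntegral.integral_nonneg (Real.one_le_cosh y) fun c _ => (overlapKernel_pos z c).le

theorem kernelPrimitive_pos {y : ℝ} (hy : 0 < y) : 0 < kernelPrimitive z y := by
  rw [kernelPrimitive_eq]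
  exact intervalIntegral.intervalIntegral_pos_of_pos
    ((continuous_overlapKernel z).intervalIntegrable _ _) (overlapKernel_pos z)
    (Real.one_lt_cosh.2 hy.ne')

theorem normFactor_eq (s : ℝ) :
    normFactor z s = √2 * Real.sinh s / √(kernelPrimitive z (2 * s)) := rfl

/-- The normalization factor grows like `exp (z s)`. -/
theorem tendsto_normFactor (hz : 0 ≤ z) (hz1 : z < 1) : ∃ c : ℝ, 0 < c ∧
    Tendsto (fun s => normFactor z s * Real.exp (-(z * s))) atTop (𝓝 c) := by
  have hL : 0 < Real.exp z / (2 * (1 - z)) := by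
    have : 0 < 1 - z := by linarith
    positivity
  have h2 : Tendsto (fun s : ℝ => 2 * s) atTop atTop := tendsto_id.const_mul_atTop two_pos
  have h3 := (tendsto_sinh_mul_exp_neg.const_mul √2).div
    ((tendsto_kernelPrimitive hz hz1).comp h2).sqrt (Real.sqrt_pos.2 hL).ne'
  refine ⟨_, by positivity, h3.congr fun s => ?_⟩
  simp only [Pi.div_apply, Function.comp_apply]
  rw [normFactor_eq, Real.sqrt_mul (kernelPrimitive_nonneg _),
    show -((1 - z) * (2 * s)) = -((1 - z) * s) + -((1 - z) * s) by ring, Real.exp_add,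
    Real.sqrt_mul_self (Real.exp_pos _).le,
    show Real.exp (-s) = Real.exp (-((1 - z) * s)) * Real.exp (-(z * s)) by
      rw [← Real.exp_add]; congr 1; ring]
  have := Real.exp_ne_zero (-((1 - z) * s))
  field_simp

variable (q : ℝ) (n : ℤ)

/-- The Gram matrix of the approximants; the rapidities `s + t` and `s - t` come from parallel and
opposite directions of motion. -/
theorem inner_boundStateApprox (hz : 0 ≤ couplingZ q n) {s t : ℝ} (hs : 0 < s) (ht : 0 < t) :
    ⟪boundStateApprox q n s, boundStateApprox q n t⟫_ℂ =
      (((kernelPrimitive (couplingZ q n) (s + t) - kernelPrimitive (couplingZ q n) (s - t)) /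
        (√(kernelPrimitive (couplingZ q n) (2 * s)) *
          √(kernelPrimitive (couplingZ q n) (2 * t))) : ℝ) : ℂ) := by
  have h1 := (Real.sqrt_pos.2 (kernelPrimitive_pos (z := couplingZ q n)
    (by linarith : 0 < 2 * s))).ne'
  have h2 := (Real.sqrt_pos.2 (kernelPrimitive_pos (z := couplingZ q n)
    (by linarith : 0 < 2 * t))).ne'
  have h3 := (Real.sinh_pos_iff.2 hs).ne'
  have h4 := (Real.sinh_pos_iff.2 ht).ne'
  rw [boundStateApprox, boundStateApprox, inner_smul_left_eq_smul, inner_smul_right_eq_smul,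
    inner_rotationMean q n hz, integral_overlapKernel _ hs ht, Complex.real_smul,
    Complex.real_smul, ← Complex.ofReal_mul, ← Complex.ofReal_mul, normFactor_eq, normFactor_eq]
  congr 1
  have h5 : √2 * √2 = 2 := Real.mul_self_sqrt (by norm_num)
  field_simp
  linear_combination (kernelPrimitive (couplingZ q n) (s + t) -
    kernelPrimitive (couplingZ q n) (s - t)) * h5

theorem norm_boundStateApprox (hz : 0 ≤ couplingZ q n) {s : ℝ} (hs : 0 < s) :
    ‖boundStateApprox q n s‖ = 1 := by
  have h1 := kernelPrimitive_pos (z := couplingZ q n) (by linarith : 0 < 2 * s)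
  have h2 : ‖boundStateApprox q n s‖ ^ 2 = 1 := by
    rw [@norm_sq_eq_re_inner ℂ, inner_boundStateApprox q n hz hs hs, sub_self,
      Real.mul_self_sqrt h1.le, ← two_mul]
    simp [kernelPrimitive_eq _ 0, h1.ne']
  exact (pow_eq_one_iff_of_nonneg (norm_nonneg _) two_ne_zero).1 h2

/-- The overlaps of the approximants tend to `1`: their numerator is dominated by the
exponentially large `kernelPrimitive z (s + t)`. -/
theorem tendsto_gram (hz : 0 ≤ z) (hz1 : z < 1) :
    Tendsto (fun p : ℝ × ℝ => (kernelPrimitive z (p.1 + p.2) - kernelPrimitive z (p.1 - p.2)) /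
      (√(kernelPrimitive z (2 * p.1)) * √(kernelPrimitive z (2 * p.2)))) atTop (𝓝 1) := by
  have hz' : 0 < 1 - z := by linarith
  set L := Real.exp z / (2 * (1 - z)) with hLdef
  have hL : 0 < L := by positivity
  set R : ℝ → ℝ := fun y => kernelPrimitive z y * Real.exp (-((1 - z) * y)) with hR
  have hRlim : Tendsto R atTop (𝓝 L) := tendsto_kernelPrimitive hz hz1
  rw [← prod_atTop_atTop_eq]
  have t1 : Tendsto (fun p : ℝ × ℝ => p.1) (atTop ×ˢ atTop) atTop := tendsto_fst
  have t2 : Tendsto (fun p : ℝ × ℝ => p.2) (atTop ×ˢ atTop) atTop := tendsto_snd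
  have a1 := (hRlim.comp (t1.const_mul_atTop two_pos)).sqrt
  have a2 := (hRlim.comp (t2.const_mul_atTop two_pos)).sqrt
  have a3 := hRlim.comp (t1.atTop_add_atTop t2)
  have e1 : ∀ {f : ℝ × ℝ → ℝ}, Tendsto f (atTop ×ˢ atTop) atTop →
      Tendsto (fun p => L * Real.exp (-(2 * (1 - z)) * f p)) (atTop ×ˢ atTop) (𝓝 0) := by
    intro f hf
    have := (Real.tendsto_exp_atBot.comp
      (hf.const_mul_atTop_of_neg (by linarith : -(2 * (1 - z)) < 0))).const_mul L
    simpa using this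
  have a4 : Tendsto (fun p : ℝ × ℝ => kernelPrimitive z (p.1 - p.2) *
      Real.exp (-((1 - z) * (p.1 + p.2)))) (atTop ×ˢ atTop) (𝓝 0) := by
    have h := (e1 t1).add (e1 t2)
    rw [add_zero] at h
    refine squeeze_zero (fun p => mul_nonneg (kernelPrimitive_nonneg _) (Real.exp_pos _).le)
      (fun p => ?_) h
    have h1 : kernelPrimitive z (p.1 - p.2) ≤
        L * (Real.exp ((1 - z) * (p.1 - p.2)) + Real.exp ((1 - z) * (p.2 - p.1))) := by
      rw [← kernelPrimitive_abs]
      refine (kernelPrimitive_le hz hz1 (abs_nonneg _)).trans ?_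
      refine mul_le_mul_of_nonneg_left ?_ hL.le
      rcases abs_choice (p.1 - p.2) with h | h <;> rw [h]
      · linarith [Real.exp_pos ((1 - z) * (p.2 - p.1))]
      · rw [neg_sub]; linarith [Real.exp_pos ((1 - z) * (p.1 - p.2))]
    refine (mul_le_mul_of_nonneg_right h1 (Real.exp_pos _).le).trans (le_of_eq ?_)
    rw [mul_assoc, add_mul, ← Real.exp_add, ← Real.exp_add, mul_add, add_comm]
    congr 3 <;> ring
  have h := (a3.sub a4).div (a1.mul a2) (by have := Real.sqrt_pos.2 hL; positivity)
  rw [sub_zero, Real.mul_self_sqrt hL.le, div_self hL.ne'] at h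
  refine h.congr fun p => ?_
  simp only [Pi.div_apply, Function.comp_apply, hR]
  have h3 : ∀ s : ℝ, √(kernelPrimitive z (2 * s) * Real.exp (-((1 - z) * (2 * s)))) =
      √(kernelPrimitive z (2 * s)) * Real.exp (-((1 - z) * s)) := by
    intro s
    rw [Real.sqrt_mul (kernelPrimitive_nonneg _),
      show -((1 - z) * (2 * s)) = -((1 - z) * s) + -((1 - z) * s) by ring, Real.exp_add,
      Real.sqrt_mul_self (Real.exp_pos _).le]
  rw [h3, h3, ← sub_mul, show -((1 - z) * (p.1 + p.2)) = -((1 - z) * p.1) + -((1 - z) * p.2) by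
    ring, Real.exp_add, mul_mul_mul_comm, mul_div_mul_right]
  positivity

theorem exists_boundState (hz : 0 ≤ couplingZ q n) (hz1 : couplingZ q n < 1) :
    ∃ b : Fock Photon, Tendsto (boundStateApprox q n) atTop (𝓝 b) ∧ ‖b‖ = 1 := by
  have hC : CauchySeq (boundStateApprox q n) := by
    rw [cauchySeq_iff_tendsto_dist_atTop_0]
    have h := ((tendsto_gram hz hz1).const_mul (-2)).const_add 2 |>.sqrt
    rw [mul_one, add_neg_cancel, Real.sqrt_zero] at h
    refine h.congr' ?_
    rw [← prod_atTop_atTop_eq]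
    filter_upwards [(eventually_gt_atTop (0 : ℝ)).prod_mk (eventually_gt_atTop (0 : ℝ))]
      with p hp
    rw [dist_eq_norm, ← Real.sqrt_sq (norm_nonneg _), @norm_sub_sq ℂ,
      norm_boundStateApprox q n hz hp.1, norm_boundStateApprox q n hz hp.2,
      inner_boundStateApprox q n hz hp.1 hp.2]
    congr 1
    simp only [RCLike.re_to_complex, Complex.ofReal_re]
    ring
  obtain ⟨b, hb⟩ := cauchySeq_tendsto_of_complete hC
  refine ⟨b, hb, tendsto_nhds_unique hb.norm ?_⟩
  refine tendsto_const_nhds.congr' ?_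
  filter_upwards [eventually_gt_atTop (0 : ℝ)] with s hs
  exact (norm_boundStateApprox q n hz hs).symm

end Asymptotic

/-! ### The pairing of the potentials with the zonal photon states -/

section Zonal

theorem sq_sub_sq_pos_of_abs_lt {α β : ℝ} (h : |β| < α) : 0 < α ^ 2 - β ^ 2 := by
  have := sq_lt_sq' (by linarith [neg_abs_le β]) ((le_abs_self β).trans_lt h)
  linarith

theorem sub_mul_cos_pos {α β : ℝ} (h : |β| < α) (θ : ℝ) : 0 < α - β * Real.cos θ := by
  have h1 : |β * Real.cos θ| ≤ |β| := by
    rw [abs_mul]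
    exact mul_le_of_le_one_right (abs_nonneg _) (Real.abs_cos_le_one θ)
  linarith [le_abs_self (β * Real.cos θ)]

/-- The mean value property of `(1 + ρ w) / (1 - ρ w)`, whose real part on the unit circle is the
Poisson kernel. -/
theorem integral_inv_sub_mul_cos {α β : ℝ} (h : |β| < α) :
    ∫ θ in (0 : ℝ)..2 * Real.pi, (α - β * Real.cos θ)⁻¹ = 2 * Real.pi / √(α ^ 2 - β ^ 2) := by
  have hα : 0 < α := (abs_nonneg β).trans_lt h
  set Δ := √(α ^ 2 - β ^ 2) with hΔ
  have hΔ0 : 0 < Δ := Real.sqrt_pos.2 (sq_sub_sq_pos_of_abs_lt h)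
  have hΔ2 : Δ ^ 2 = α ^ 2 - β ^ 2 := Real.sq_sqrt (sq_sub_sq_pos_of_abs_lt h).le
  set ρ := β / (α + Δ) with hρ
  have hρ1 : |ρ| < 1 := by
    rw [hρ, abs_div, abs_of_pos (by positivity : 0 < α + Δ), div_lt_one (by positivity)]
    linarith
  have hden : ∀ w ∈ Metric.closedBall (0 : ℂ) |1|, 1 - ρ * w ≠ 0 := by
    intro w hw h0
    rw [abs_one, mem_closedBall_zero_iff] at hw
    have h1 : ‖(ρ : ℂ) * w‖ = 1 := by rw [← sub_eq_zero.1 h0, norm_one]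
    rw [norm_mul, Complex.norm_real, Real.norm_eq_abs] at h1
    nlinarith [abs_nonneg ρ, norm_nonneg w]
  have hd : DiffContOnCl ℂ (fun w : ℂ => (1 + ρ * w) / (1 - ρ * w)) (Metric.ball 0 |1|) := by
    refine DifferentiableOn.diffContOnCl ?_
    rw [closure_ball _ (by norm_num)]
    exact DifferentiableOn.div (by fun_prop) (by fun_prop) hden
  have hm := hd.circleAverage
  rw [Real.circleAverage_def] at hm
  have hc : Continuous fun θ : ℝ => (1 + ρ * circleMap 0 1 θ) / (1 - ρ * circleMap 0 1 θ) := by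
    refine Continuous.div (by fun_prop) (by fun_prop) fun θ => hden _ ?_
    simp
  have hre : ∀ θ : ℝ, ((1 + ρ * circleMap 0 1 θ) / (1 - ρ * circleMap 0 1 θ)).re =
      Δ * (α - β * Real.cos θ)⁻¹ := by
    intro θ
    have hne := hden (circleMap 0 1 θ) (by simp)
    have hp := sub_mul_cos_pos h θ
    have e1 : circleMap 0 1 θ = (Real.cos θ : ℂ) + Real.sin θ * Complex.I := by
      simp [circleMap, Complex.exp_mul_I]
    have e2 : Complex.normSq (1 - ρ * circleMap 0 1 θ) = 1 - 2 * ρ * Real.cos θ + ρ ^ 2 := by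
      rw [e1, Complex.normSq_apply]
      simp [-Complex.ofReal_cos, -Complex.ofReal_sin]
      linear_combination ρ ^ 2 * Real.sin_sq_add_cos_sq θ
    have e3 : 1 - 2 * ρ * Real.cos θ + ρ ^ 2 ≠ 0 := by
      rw [← e2]; exact (Complex.normSq_pos.2 hne).ne'
    have e4 : (1 - 2 * ρ * Real.cos θ + ρ ^ 2) * (α + Δ) = 2 * (α - β * Real.cos θ) := by
      rw [hρ]; field_simp; linear_combination hΔ2
    have e5 : (1 - ρ ^ 2) * (α + Δ) = 2 * Δ := by
      rw [hρ]; field_simp; linear_combination (-1 : ℝ) * hΔ2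
    rw [Complex.div_re, e2, e1]
    simp [-Complex.ofReal_cos, -Complex.ofReal_sin]
    have e6 : (1 + ρ * Real.cos θ) * (1 - ρ * Real.cos θ) / (1 - 2 * ρ * Real.cos θ + ρ ^ 2) -
        ρ * Real.sin θ * (ρ * Real.sin θ) / (1 - 2 * ρ * Real.cos θ + ρ ^ 2) =
        (1 - ρ ^ 2) / (1 - 2 * ρ * Real.cos θ + ρ ^ 2) := by
      rw [← sub_div]; congr 1
      linear_combination -ρ ^ 2 * Real.sin_sq_add_cos_sq θ
    have e7 : (1 - ρ ^ 2) / (1 - 2 * ρ * Real.cos θ + ρ ^ 2) = Δ * (α - β * Real.cos θ)⁻¹ := by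
      rw [div_eq_iff e3, mul_assoc, mul_comm, inv_mul_eq_div, div_mul_eq_mul_div, eq_div_iff hp.ne']
      have h9 : (1 - ρ ^ 2) * (α - β * Real.cos θ) * (α + Δ) =
          (1 - 2 * ρ * Real.cos θ + ρ ^ 2) * Δ * (α + Δ) := by
        linear_combination (α - β * Real.cos θ) * e5 - Δ * e4
      exact mul_right_cancel₀ (by positivity) h9
    linarith [e6, e7, neg_div (1 - 2 * ρ * Real.cos θ + ρ ^ 2)
      (ρ * Real.sin θ * (ρ * Real.sin θ))]
  have h1 := congrArg Complex.re hm
  rw [Complex.smul_re, ← Complex.reCLM_apply, ← Complex.reCLM.intervalIntegral_comp_comm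
    (hc.intervalIntegrable _ _)] at h1
  simp only [Complex.reCLM_apply, hre, intervalIntegral.integral_const_mul] at h1
  have hpi := Real.pi_ne_zero
  rw [eq_div_iff hΔ0.ne']
  generalize ∫ θ in (0 : ℝ)..2 * Real.pi, (α - β * Real.cos θ)⁻¹ = J at h1 ⊢
  simp at h1
  field_simp at h1
  linarith

theorem integral_sin_div_sub_mul_cos (α β : ℝ) :
    ∫ θ in (0 : ℝ)..2 * Real.pi, Real.sin θ * (α - β * Real.cos θ)⁻¹ = 0 := by
  have h := intervalIntegral.integral_comp_sub_left (a := 0) (b := 2 * Real.pi)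
    (fun θ => Real.sin θ * (α - β * Real.cos θ)⁻¹) (2 * Real.pi)
  simp only [sub_self, sub_zero, Real.sin_two_pi_sub, Real.cos_two_pi_sub, neg_mul,
    intervalIntegral.integral_neg] at h
  linarith

/-- The one-photon vector `∂ P_l(polarCos) / ∂ζ`. -/
def zonalVec (l : ℕ) : Photon := (memLp_dz_legendre_polarCos l).toLp _

theorem zonalPhoton_eq (l : ℕ) : zonalPhoton l =
    (√((2 * l + 1) / (Real.pi * l * (l + 1))) : ℂ) • zonalVec l := rfl

theorem zonalVec_ae (l : ℕ) : zonalVec l =ᵐ[volume] fun ζ =>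
    ((legendre l).derivative.eval (polarCos ζ) : ℝ) *
      (-2 * conj ζ / ((‖ζ‖ ^ 2 + 1 : ℝ) : ℂ) ^ 2) :=
  (MemLp.coeFn_toLp _).trans (Eventually.of_forall fun ζ => dz_legendre_polarCos l ζ)

theorem photonRep_rotation12_zonalVec (t : ℝ) (l : ℕ) :
    photonRep (rotation12 t) (zonalVec l) = zonalVec l := by
  apply Lp.ext
  filter_upwards [photonMap_ae (rotation12 t) (zonalVec l), zonalVec_ae l,
    (quasiMeasurePreserving_moebius (rotation12 t)⁻¹).ae (zonalVec_ae l)] with ζ h1 h2 h3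
  change photonMap _ _ ζ = _
  rw [h1, h3, h2, rotation12_inv]
  have e0 : moebius (rotation12 (-t)) ζ = Complex.exp (t * Complex.I) * ζ := by
    simp only [moebius, rotation12]
    simp
    rw [div_eq_iff (Complex.exp_ne_zero _), mul_right_comm, ← Complex.exp_add]
    congr 2
    ring
  have e1 : moebiusDeriv (rotation12 (-t)) ζ = Complex.exp (t * Complex.I) := by
    simp only [moebiusDeriv, rotation12]
    simp
    rw [← Complex.exp_nat_mul, ← Complex.exp_neg]
    congr 1
    push_cast
    ring
  have e2 : ‖Complex.exp (t * Complex.I) * ζ‖ = ‖ζ‖ := by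
    rw [norm_mul, Complex.norm_exp_ofReal_mul_I, one_mul]
  have e3 : Complex.exp (t * Complex.I) * conj (Complex.exp (t * Complex.I)) = 1 := by
    rw [Complex.mul_conj, Complex.normSq_eq_norm_sq, Complex.norm_exp_ofReal_mul_I]; simp
  rw [e0, e1, polarCos, polarCos, e2, map_mul]
  linear_combination ((legendre l).derivative.eval ((1 - ‖ζ‖ ^ 2) / (‖ζ‖ ^ 2 + 1)) : ℝ) *
      (-2 * conj ζ / ((‖ζ‖ ^ 2 + 1 : ℝ) : ℂ) ^ 2) * e3

/-- The mean over the azimuth of `2 Re (ζ ∂ log energy)`, up to sign and a constant, at polar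
cosine `t`; it tends to a sign function for light-like velocities. -/
def axialProfile (v₀ v₃ t : ℝ) : ℝ := (v₀ * t + v₃) / √((v₀ * t + v₃) ^ 2 + (1 - t ^ 2))

theorem abs_velocityAxial_lt (σ φ s : ℝ) : |velocityAxial σ φ s| < velocityTime σ φ s := by
  have h1 := velocity_sq σ φ s
  have h2 := one_le_velocityTime σ φ s
  refine abs_lt_of_sq_lt_sq ?_ (by linarith)
  nlinarith [sq_nonneg (Real.sinh s * Real.sin φ)]

theorem axialProfile_radicand_pos {v₀ v₃ : ℝ} (hv : |v₃| < v₀) {t : ℝ}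
    (ht : t ∈ Set.Icc (-1 : ℝ) 1) : 0 < (v₀ * t + v₃) ^ 2 + (1 - t ^ 2) := by
  have h0 := abs_lt.1 hv
  rcases ht.1.eq_or_lt with h | h
  · rw [← h]; nlinarith
  rcases ht.2.eq_or_lt with h' | h'
  · rw [h']; nlinarith
  nlinarith [sq_nonneg (v₀ * t + v₃)]

theorem continuousOn_axialProfile {v₀ v₃ : ℝ} (hv : |v₃| < v₀) :
    ContinuousOn (axialProfile v₀ v₃) (Set.Icc (-1) 1) := by
  refine ContinuousOn.div (by fun_prop) (by fun_prop) fun t ht => ?_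
  exact (Real.sqrt_pos.2 (axialProfile_radicand_pos hv ht)).ne'

theorem abs_axialProfile_le (v₀ v₃ : ℝ) {t : ℝ} (ht : t ∈ Set.Icc (-1 : ℝ) 1) :
    |axialProfile v₀ v₃ t| ≤ 1 := by
  have h1 : 0 ≤ 1 - t ^ 2 := by nlinarith [ht.1, ht.2]
  rw [axialProfile, abs_div, abs_of_nonneg (Real.sqrt_nonneg _)]
  refine div_le_one_of_le₀ ?_ (Real.sqrt_nonneg _)
  exact Real.abs_le_sqrt (by linarith)

/-- The pairing of the potential of a four-velocity with a zonal harmonic. -/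
def zonalPairing (l : ℕ) (v₀ v₃ : ℝ) : ℝ :=
  ∫ t in (-1 : ℝ)..1, (legendre l).derivative.eval t * (t - axialProfile v₀ v₃ t)

/-- The azimuthal mean of the integrand is computed by `integral_inv_sub_mul_cos`; the part of the
integrand which is odd under reflection of the azimuth drops out. -/
theorem inner_logShift_zonalVec (l : ℕ) (σ φ s : ℝ) :
    ⟪logShift (boostRot σ φ s), zonalVec l⟫_ℂ =
      ((-(Real.pi / 2) * zonalPairing l (velocityTime σ φ s) (velocityAxial σ φ s) : ℝ) : ℂ) := by
  set g := boostRot σ φ s with hg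
  set v₀ := velocityTime σ φ s with hv0
  set v₃ := velocityAxial σ φ s with hv3
  set v₁ := Real.sinh s * Real.sin φ with hv1
  have hv : |v₃| < v₀ := abs_velocityAxial_lt σ φ s
  have hsq : v₀ ^ 2 = 1 + v₁ ^ 2 + v₃ ^ 2 := velocity_sq σ φ s
  set P := (legendre l).derivative with hP
  set D : ℂ → ℂ := fun ζ => logEnergyDz g⁻¹ ζ - logEnergyDz 1 ζ with hD
  set f : ℂ → ℂ := fun ζ => -2 * (P.eval (polarCos ζ) : ℝ) * conj (ζ * D ζ) with hf
  have hDc : Continuous D := by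
    have : ∀ k : SL(2, ℂ), Continuous (logEnergyDz k) := fun k => by
      unfold logEnergyDz energyDz energy
      refine Continuous.div (by fun_prop) (by fun_prop) fun ζ => ?_
      have := energy_pos k ζ
      rw [energy] at this
      exact_mod_cast this.ne'
    exact (this _).sub (this _)
  have hfc : Continuous f := by
    have h1 : Continuous fun ζ => P.eval (polarCos ζ) := P.continuous.comp continuous_polarCos
    have h2 := Complex.continuous_conj.comp (continuous_id.mul hDc)
    exact (continuous_const.mul (Complex.continuous_ofReal.comp h1)).mul h2
  obtain ⟨C, hC⟩ := (isCompact_Icc (a := (-1 : ℝ)) (b := 1)).exists_bound_of_continuousOn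
    P.continuous.continuousOn
  have hfb : ∀ ζ, ‖f ζ‖ ≤ 2 * C * frame g⁻¹ := by
    intro ζ
    have h1 := hC _ (polarCos_mem_Icc ζ)
    have h2 := norm_dz_log_energyRatio_le g ζ
    have h3 : dz (fun ζ => Real.log (energyRatio g ζ)) ζ = D ζ := by
      rw [dz_log_energyRatio]
      simp [hD, logEnergyDz, energyDz, energy]
    rw [h3, le_div_iff₀ (by positivity)] at h2
    have h4 : ‖ζ‖ ≤ ‖ζ‖ ^ 2 + 1 := by nlinarith [sq_nonneg (‖ζ‖ - 1), norm_nonneg ζ]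
    have h5 : ‖ζ‖ * ‖D ζ‖ ≤ frame g⁻¹ := by nlinarith [norm_nonneg (D ζ)]
    rw [hf]
    simp only [norm_mul, norm_neg, RCLike.norm_ofNat, Complex.norm_real, RCLike.norm_conj]
    have h6 : 0 ≤ C := (norm_nonneg _).trans h1
    have := mul_le_mul h1 h5 (by positivity) h6
    linarith
  have h1 : ⟪logShift g, zonalVec l⟫_ℂ = ∫ ζ, ((‖ζ‖ ^ 2 + 1) ^ 2)⁻¹ • f ζ := by
    rw [L2.inner_def]
    refine integral_congr_ae ?_
    filter_upwards [logShift_ae g, zonalVec_ae l] with ζ h1 h2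
    rw [h1, h2, RCLike.inner_apply, Complex.real_smul]
    simp only [hf, hD, map_mul]
    push_cast
    ring
  have hE : ∀ r : ℝ, 0 < r → |2 * v₁ * r| < (v₀ - v₃) * r ^ 2 + (v₀ + v₃) := by
    intro r hr
    have h0 := abs_lt.1 hv
    refine abs_lt_of_sq_lt_sq ?_ (by nlinarith)
    nlinarith [sq_nonneg ((v₀ - v₃) * r ^ 2 - (v₀ + v₃)), sq_nonneg r]
  rw [h1, integral_sphere_of_azimuth_mean hfc hfb
    (h := fun t => -(P.eval t * (t - axialProfile v₀ v₃ t)))]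
  · rw [intervalIntegral.integral_neg, zonalPairing]
    congr 1
    ring
  · exact (P.continuous.continuousOn.mul
      (continuousOn_id.sub (continuousOn_axialProfile hv))).neg
  · intro r hr
    set α := (v₀ - v₃) * r ^ 2 + (v₀ + v₃) with hα
    set β := 2 * v₁ * r with hβ
    have hαβ := hE r hr
    set t := polarCos r with ht
    set Δ := √(α ^ 2 - β ^ 2) with hΔ
    have hr1 : r ^ 2 + 1 ≠ 0 := by positivity
    have htr : t = (1 - r ^ 2) / (r ^ 2 + 1) := by
      rw [ht, polarCos, Complex.norm_real, Real.norm_eq_abs, sq_abs]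
    have hfr : ∀ θ : ℝ, f (r * Complex.exp (θ * Complex.I)) =
        ((-2 * P.eval t * (1 / 2 + ((v₀ - v₃) * r ^ 2 - (v₀ + v₃)) / 2 * (α - β * Real.cos θ)⁻¹ -
          r ^ 2 / (r ^ 2 + 1)) : ℝ) : ℂ) +
        Complex.I * ((-2 * P.eval t * (v₁ * r) *
          (Real.sin θ * (α - β * Real.cos θ)⁻¹) : ℝ) : ℂ) := by
      intro θ
      set ζ : ℂ := r * Complex.exp (θ * Complex.I) with hζ
      have n1 : ‖ζ‖ = r := by
        rw [hζ, norm_mul, Complex.norm_exp_ofReal_mul_I, mul_one, Complex.norm_real,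
          Real.norm_of_nonneg hr.le]
      have n2 : ζ = ((r * Real.cos θ : ℝ) : ℂ) + ((r * Real.sin θ : ℝ) : ℂ) * Complex.I := by
        rw [hζ, Complex.exp_mul_I]; push_cast; ring
      have n3 : ζ * conj ζ = ((r ^ 2 : ℝ) : ℂ) := by
        rw [Complex.mul_conj, Complex.normSq_eq_norm_sq, n1]
      have n4 : energy g⁻¹ ζ = α - β * Real.cos θ := by
        have n4' : ζ.re = r * Real.cos θ := by
          rw [n2]; simp [-Complex.ofReal_cos, -Complex.ofReal_sin]
        rw [hg, energy_boostRot_inv, n1, n4']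
        ring
      have n5 : ζ * energyDz g⁻¹ ζ = (((v₀ - v₃) * r ^ 2 - v₁ * (r * Real.cos θ) : ℝ) : ℂ) -
          ((v₁ * (r * Real.sin θ) : ℝ) : ℂ) * Complex.I := by
        rw [hg, energyDz_boostRot_inv]
        have : ζ * (((v₀ - v₃ : ℝ) : ℂ) * conj ζ - (v₁ : ℂ)) =
          ((v₀ - v₃ : ℝ) : ℂ) * (ζ * conj ζ) - v₁ * ζ := by ring
        rw [this, n3, n2]
        push_cast
        ring
      have n6 : energy 1 ζ = r ^ 2 + 1 := by rw [← n1]; simp [energy]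
      have n7 : energyDz 1 ζ = conj ζ := by simp [energyDz]
      have n8 : polarCos ζ = t := by
        rw [ht, polarCos, polarCos, n1, Complex.norm_real, Real.norm_of_nonneg hr.le]
      have hp : α - β * Real.cos θ ≠ 0 := (sub_mul_cos_pos hαβ θ).ne'
      have n9 : ζ * D ζ = ζ * energyDz g⁻¹ ζ * (((α - β * Real.cos θ)⁻¹ : ℝ) : ℂ) -
          ((r ^ 2 / (r ^ 2 + 1) : ℝ) : ℂ) := by
        have : ((r ^ 2 / (r ^ 2 + 1) : ℝ) : ℂ) = ζ * conj ζ / ((r ^ 2 + 1 : ℝ) : ℂ) := by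
          rw [n3]; push_cast; rfl
        simp only [this, hD, logEnergyDz, n4, n6, n7]
        push_cast
        ring
      have n10 : (v₀ - v₃) * r ^ 2 - v₁ * (r * Real.cos θ) =
          1 / 2 * (α - β * Real.cos θ) + ((v₀ - v₃) * r ^ 2 - (v₀ + v₃)) / 2 := by
        rw [hα, hβ]; ring
      have n11 : (1 / 2 * (α - β * Real.cos θ) + ((v₀ - v₃) * r ^ 2 - (v₀ + v₃)) / 2) *
          (α - β * Real.cos θ)⁻¹ =
          1 / 2 + ((v₀ - v₃) * r ^ 2 - (v₀ + v₃)) / 2 * (α - β * Real.cos θ)⁻¹ := by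
        rw [add_mul, mul_assoc, mul_inv_cancel₀ hp, mul_one]
      simp only [hf]
      rw [n8, n9, n5, n10, sub_mul, ← Complex.ofReal_mul, n11]
      simp only [map_sub, map_mul, Complex.conj_ofReal, Complex.conj_I]
      push_cast
      ring
    have hci : Continuous fun θ : ℝ => (α - β * Real.cos θ)⁻¹ :=
      Continuous.inv₀ (by fun_prop) fun θ => (sub_mul_cos_pos hαβ θ).ne'
    simp_rw [hfr]
    rw [intervalIntegral.integral_add, intervalIntegral.integral_const_mul,
      intervalIntegral.integral_ofReal, intervalIntegral.integral_ofReal,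
      intervalIntegral.integral_const_mul, intervalIntegral.integral_const_mul,
      integral_sin_div_sub_mul_cos, mul_zero, Complex.ofReal_zero, mul_zero, add_zero]
    · congr 1
      rw [intervalIntegral.integral_sub, intervalIntegral.integral_add,
        intervalIntegral.integral_const_mul, integral_inv_sub_mul_cos hαβ]
      · simp only [intervalIntegral.integral_const, smul_eq_mul, sub_zero]
        have k0 : 0 < r ^ 2 + 1 := by positivity
        have k1 : (v₀ - v₃) * r ^ 2 - (v₀ + v₃) = -((r ^ 2 + 1) * (v₀ * t + v₃)) := by
          rw [htr]; field_simp; ring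
        have k2 : α ^ 2 - β ^ 2 = (r ^ 2 + 1) ^ 2 * ((v₀ * t + v₃) ^ 2 + (1 - t ^ 2)) := by
          rw [htr, hα, hβ]; field_simp; linear_combination (4 * r ^ 2 : ℝ) * hsq
        have k3 : √(α ^ 2 - β ^ 2) = (r ^ 2 + 1) * √((v₀ * t + v₃) ^ 2 + (1 - t ^ 2)) := by
          rw [k2, Real.sqrt_mul (by positivity), Real.sqrt_sq k0.le]
        have k4 : 0 < √((v₀ * t + v₃) ^ 2 + (1 - t ^ 2)) :=
          Real.sqrt_pos.2 (axialProfile_radicand_pos hv (polarCos_mem_Icc _))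
        have k5 : r ^ 2 / (r ^ 2 + 1) = (1 - t) / 2 := by rw [htr]; field_simp; ring
        rw [k3, k1, k5, axialProfile]
        generalize √((v₀ * t + v₃) ^ 2 + (1 - t ^ 2)) = S at k4
        field_simp
        ring
      · exact intervalIntegrable_const
      · exact (hci.const_mul _).intervalIntegrable _ _
      · exact (by fun_prop : Continuous fun θ : ℝ => 1 / 2 + ((v₀ - v₃) * r ^ 2 - (v₀ + v₃)) / 2 *
          (α - β * Real.cos θ)⁻¹).intervalIntegrable _ _
      · exact intervalIntegrable_const
    · refine Continuous.intervalIntegrable (Complex.continuous_ofReal.comp ?_) _ _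
      fun_prop
    · refine Continuous.intervalIntegrable (continuous_const.mul
        (Complex.continuous_ofReal.comp ?_)) _ _
      fun_prop

end Zonal

/-! ### Legendre transforms of powers -/

section Rodrigues
open Polynomial

/-- `∫ (t² - 1)^l (cosh σ - t sinh σ)^μ dt` over `[-1, 1]`. -/
def zonalMoment (l : ℕ) (μ σ : ℝ) : ℝ :=
  ∫ t in (-1 : ℝ)..1, (t ^ 2 - 1) ^ l * (Real.cosh σ - t * Real.sinh σ) ^ μ

theorem cosh_sub_mul_sinh_pos (σ : ℝ) {t : ℝ} (ht : t ∈ Set.Icc (-1 : ℝ) 1) :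
    0 < Real.cosh σ - t * Real.sinh σ := by
  simpa [sub_eq_add_neg] using cosh_add_mul_sinh_pos (-σ) ht

theorem continuousOn_cosh_sub_mul_sinh_rpow (σ w : ℝ) :
    ContinuousOn (fun t => (Real.cosh σ - t * Real.sinh σ) ^ w) (Set.Icc (-1 : ℝ) 1) :=
  ContinuousOn.rpow_const (by fun_prop) fun _ ht => Or.inl (cosh_sub_mul_sinh_pos σ ht).ne'

theorem eval_iterate_derivative_rodrigues_eq_zero {l k : ℕ} (hk : k < l) {x : ℝ}
    (hx : x ^ 2 = 1) : (derivative^[k] (((X : ℝ[X]) ^ 2 - 1) ^ l)).eval x = 0 := by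
  obtain ⟨p, hp⟩ := pow_sub_dvd_iterate_derivative_pow ((X : ℝ[X]) ^ 2 - 1) l k
  rw [hp]
  simp [hx, Nat.sub_ne_zero_of_lt hk]

/-- Repeated integration by parts; the boundary terms vanish since `(X ^ 2 - 1) ^ l` has zeros of
order `l` at `±1`. -/
theorem integral_iterate_derivative_mul_rpow (l : ℕ) (σ : ℝ) {k : ℕ} (hk : k ≤ l) (w : ℝ) :
    ∫ t in (-1 : ℝ)..1, (derivative^[k] (((X : ℝ[X]) ^ 2 - 1) ^ l)).eval t *
        (Real.cosh σ - t * Real.sinh σ) ^ w =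
      Real.sinh σ ^ k * (∏ j ∈ Finset.range k, (w - j)) * zonalMoment l (w - k) σ := by
  induction k generalizing w with
  | zero => simp [zonalMoment]
  | succ k ih =>
    have huIcc : Set.uIcc (-1 : ℝ) 1 = Set.Icc (-1) 1 := Set.uIcc_of_le (by norm_num)
    set R : ℝ[X] := derivative^[k] ((X ^ 2 - 1) ^ l) with hR
    have hR' : derivative^[k + 1] (((X : ℝ[X]) ^ 2 - 1) ^ l) = derivative R :=
      Function.iterate_succ_apply' _ _ _
    have h := intervalIntegral.integral_mul_deriv_eq_deriv_mul (a := -1) (b := 1)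
      (u := fun t => (Real.cosh σ - t * Real.sinh σ) ^ w)
      (u' := fun t => -Real.sinh σ * w * (Real.cosh σ - t * Real.sinh σ) ^ (w - 1))
      (v := fun t => R.eval t) (v' := fun t => (derivative R).eval t)
      (fun t ht => ?_) (fun t _ => R.hasDerivAt t) ?_
      ((derivative R).continuous.intervalIntegrable _ _)
    · rw [hR', eval_iterate_derivative_rodrigues_eq_zero (by lia) (by norm_num),
        eval_iterate_derivative_rodrigues_eq_zero (by lia) (by norm_num)] at *
      have h2 := ih (by lia) (w - 1)
      rw [Finset.prod_range_succ', Nat.cast_zero, sub_zero, pow_succ, Nat.cast_succ,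
        show w - (k + 1 : ℝ) = w - 1 - k by ring]
      simp only [Nat.cast_succ]
      have h3 : ∀ j : ℕ, w - (j + 1 : ℝ) = w - 1 - j := fun j => by ring
      simp only [h3]
      simp only [mul_comm ((derivative R).eval _)]
      rw [h]
      simp only [mul_assoc, intervalIntegral.integral_const_mul]
      simp only [mul_comm _ (R.eval _)]
      rw [h2]
      ring
    · rw [huIcc] at ht
      have h1 : HasDerivAt (fun t => Real.cosh σ - t * Real.sinh σ) (-Real.sinh σ) t := by
        simpa using ((hasDerivAt_id t).mul_const (Real.sinh σ)).const_sub (Real.cosh σ)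
      exact h1.rpow_const (Or.inl (cosh_sub_mul_sinh_pos σ ht).ne')
    · refine ContinuousOn.intervalIntegrable ?_
      rw [huIcc]
      exact (continuousOn_cosh_sub_mul_sinh_rpow σ _).const_mul _

/-- Rodrigues' formula and `l` integrations by parts. -/
theorem integral_legendre_mul_rpow (l : ℕ) (σ w : ℝ) :
    ∫ t in (-1 : ℝ)..1, (legendre l).eval t * (Real.cosh σ - t * Real.sinh σ) ^ w =
      (2 ^ l * l.factorial : ℝ)⁻¹ * (Real.sinh σ ^ l * (∏ j ∈ Finset.range l, (w - j)) *
        zonalMoment l (w - l) σ) := by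
  rw [← integral_iterate_derivative_mul_rpow l σ le_rfl w,
    ← intervalIntegral.integral_const_mul]
  simp only [legendre, eval_mul, eval_C, mul_assoc]

theorem integral_legendre {l : ℕ} (hl : 1 ≤ l) :
    ∫ t in (-1 : ℝ)..1, (legendre l).eval t = 0 := by
  have h := integral_legendre_mul_rpow l 0 0
  simpa [Nat.ne_of_gt hl] using h

theorem zonalMoment_neg (l : ℕ) (μ σ : ℝ) : zonalMoment l μ (-σ) = zonalMoment l μ σ := by
  have h := intervalIntegral.integral_comp_neg (a := -1) (b := 1)
    (fun t : ℝ => (t ^ 2 - 1) ^ l * (Real.cosh σ - t * Real.sinh σ) ^ μ)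
  rw [neg_neg] at h
  rw [zonalMoment, zonalMoment, ← h]
  simp

theorem zonalMoment_ne_zero (l : ℕ) (μ σ : ℝ) : zonalMoment l μ σ ≠ 0 := by
  have h : 0 < ∫ t in (-1 : ℝ)..1, (1 - t ^ 2) ^ l * (Real.cosh σ - t * Real.sinh σ) ^ μ := by
    refine intervalIntegral.intervalIntegral_pos_of_pos_on ?_ (fun t ht => ?_) (by norm_num)
    · refine ContinuousOn.intervalIntegrable ?_
      rw [Set.uIcc_of_le (by norm_num)]
      exact ContinuousOn.mul (by fun_prop) (continuousOn_cosh_sub_mul_sinh_rpow σ μ)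
    · have h1 := Real.rpow_pos_of_pos (cosh_sub_mul_sinh_pos σ (Set.Ioo_subset_Icc_self ht)) μ
      have h2 : 0 < 1 - t ^ 2 := by nlinarith [ht.1, ht.2]
      positivity
  have h2 : zonalMoment l μ σ = (-1) ^ l *
      ∫ t in (-1 : ℝ)..1, (1 - t ^ 2) ^ l * (Real.cosh σ - t * Real.sinh σ) ^ μ := by
    rw [zonalMoment, ← intervalIntegral.integral_const_mul]
    congr 1
    ext t
    rw [← mul_assoc, ← mul_pow]
    ring
  rw [h2]
  exact mul_ne_zero (pow_ne_zero _ (by norm_num)) h.ne'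

/-- The integrand extends holomorphically to complex rapidities near `0`. -/
theorem analyticAt_zonalMoment (l : ℕ) (μ : ℝ) :
    AnalyticAt ℝ (fun σ : ℝ => (zonalMoment l μ σ : ℂ)) 0 := by
  have hcont : ContinuousAt (fun w : ℂ => ‖Complex.cosh w - 1‖ + ‖Complex.sinh w‖) 0 := by
    fun_prop
  have hlt : ∀ᶠ w : ℂ in 𝓝 0, ‖Complex.cosh w - 1‖ + ‖Complex.sinh w‖ < 1 :=
    hcont.eventually_lt continuousAt_const (by simp)
  obtain ⟨ε, hε, hball⟩ := Metric.eventually_nhds_iff_ball.1 hlt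
  set s : Set ℂ := Metric.closedBall 0 (ε / 2) with hs
  set B : ℂ → ℝ → ℂ := fun w t => Complex.cosh w - t * Complex.sinh w with hB
  have hslit : ∀ w ∈ s, ∀ t ∈ Set.Icc (-1 : ℝ) 1, B w t ∈ Complex.slitPlane := by
    intro w hw t ht
    refine Or.inl ?_
    have h1 := hball w (Metric.closedBall_subset_ball (by linarith) hw)
    have h2 : ‖Complex.cosh w - 1 - t * Complex.sinh w‖ < 1 := by
      refine (norm_sub_le _ _).trans_lt (lt_of_le_of_lt ?_ h1)
      rw [norm_mul, Complex.norm_real, Real.norm_eq_abs]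
      have := mul_le_of_le_one_left (norm_nonneg (Complex.sinh w)) (abs_le.2 ht)
      linarith
    have h3 := (Complex.abs_re_le_norm _).trans_lt h2
    have h4 := (abs_lt.1 h3).1
    simp only [hB, Complex.sub_re, Complex.one_re] at h4 ⊢
    linarith
  set F : ℂ → ℝ → ℂ := fun w t => ((t : ℂ) ^ 2 - 1) ^ l * B w t ^ (μ : ℂ) with hF
  set F' : ℂ → ℝ → ℂ := fun w t => ((t : ℂ) ^ 2 - 1) ^ l *
    (μ * B w t ^ ((μ : ℂ) - 1) * (Complex.sinh w - t * Complex.cosh w)) with hF'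
  have hBc : Continuous fun p : ℂ × ℝ => B p.1 p.2 := by
    simp only [hB]; fun_prop
  have hFc : ContinuousOn (fun p : ℂ × ℝ => F p.1 p.2) (s ×ˢ Set.Icc (-1) 1) :=
    ContinuousOn.mul (by fun_prop)
      (hBc.continuousOn.cpow_const fun p hp => hslit _ hp.1 _ hp.2)
  have hF'c : ContinuousOn (fun p : ℂ × ℝ => F' p.1 p.2) (s ×ˢ Set.Icc (-1) 1) :=
    ContinuousOn.mul (by fun_prop) (ContinuousOn.mul (ContinuousOn.mul (by fun_prop)
      (hBc.continuousOn.cpow_const fun p hp => hslit _ hp.1 _ hp.2)) (by fun_prop))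
  obtain ⟨C, hC⟩ := ((isCompact_closedBall (0 : ℂ) (ε / 2)).prod
    (isCompact_Icc (a := (-1 : ℝ)) (b := 1))).exists_bound_of_continuousOn hF'c
  have huIcc : Set.uIcc (-1 : ℝ) 1 = Set.Icc (-1) 1 := Set.uIcc_of_le (by norm_num)
  have huIoc : Set.uIoc (-1 : ℝ) 1 ⊆ Set.Icc (-1) 1 := huIcc ▸ Set.uIoc_subset_uIcc
  have hsec : ∀ {G : ℂ → ℝ → ℂ}, ContinuousOn (fun p : ℂ × ℝ => G p.1 p.2) (s ×ˢ Set.Icc (-1) 1) →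
      ∀ w ∈ s, IntervalIntegrable (G w) volume (-1) 1 := by
    intro G hG w hw
    refine ContinuousOn.intervalIntegrable ?_
    rw [huIcc]
    exact hG.comp (f := fun t : ℝ => (w, t)) (by fun_prop) fun t ht => ⟨hw, ht⟩
  have hdiff : DifferentiableOn ℂ (fun w => ∫ t in (-1 : ℝ)..1, F w t)
      (Metric.ball 0 (ε / 2)) := by
    intro w hw
    have hsw : s ∈ 𝓝 w := mem_of_superset (Metric.isOpen_ball.mem_nhds hw)
      Metric.ball_subset_closedBall
    have hw' : w ∈ s := mem_of_mem_nhds hsw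
    have key := intervalIntegral.hasDerivAt_integral_of_dominated_loc_of_deriv_le
      (μ := volume) (a := -1) (b := 1) (F := F) (F' := F') (bound := fun _ => C) hsw
      (Filter.eventually_of_mem hsw fun w' hw' =>
        (intervalIntegrable_iff.1 (hsec hFc w' hw')).aestronglyMeasurable)
      (hsec hFc w hw')
      (intervalIntegrable_iff.1 (hsec hF'c w hw')).aestronglyMeasurable
      (Eventually.of_forall fun t ht w' hw' => hC (w', t) ⟨hw', huIoc ht⟩)
      intervalIntegrable_const
      (Eventually.of_forall fun t ht w' hw' => ?_)
    · exact key.2.differentiableAt.differentiableWithinAt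
    · have h1 : HasDerivAt (fun w => B w t) (Complex.sinh w' - t * Complex.cosh w') w' :=
        (Complex.hasDerivAt_cosh w').sub ((Complex.hasDerivAt_sinh w').const_mul (t : ℂ))
      exact (h1.cpow_const (hslit w' hw' t (huIoc ht))).const_mul _
  have hana : AnalyticAt ℂ (fun w => ∫ t in (-1 : ℝ)..1, F w t) ((0 : ℝ) : ℂ) := by
    rw [Complex.ofReal_zero]
    exact hdiff.analyticAt (Metric.ball_mem_nhds _ (by positivity))
  have hreal := (hana.restrictScalars (𝕜 := ℝ)).comp
    (Complex.ofRealCLM.analyticAt (0 : ℝ))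
  refine hreal.congr (Eventually.of_forall fun σ => ?_)
  simp only [Function.comp_apply, hF, hB, zonalMoment]
  rw [← intervalIntegral.integral_ofReal]
  refine intervalIntegral.integral_congr fun t ht => ?_
  rw [huIcc] at ht
  simp only [Complex.ofReal_mul, Complex.ofReal_cpow (cosh_sub_mul_sinh_pos σ ht).le]
  push_cast
  rfl

end Rodrigues

section Taylor

theorem isBigO_sub_sq_of_even {E : Type*} [NormedAddCommGroup E] [NormedSpace ℝ E] {f : ℝ → E}
    (hf : AnalyticAt ℝ f 0) (he : ∀ x, f (-x) = f x) :
    (fun x => f x - f 0) =O[𝓝 0] fun x => x ^ 2 := by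
  obtain ⟨p, hp⟩ := hf
  have h1 := hp.isBigO_sub_partialSum_pow 2
  have h2 : Tendsto (fun x : ℝ => -x) (𝓝 0) (𝓝 0) := by
    simpa only [neg_zero] using continuous_neg.tendsto (0 : ℝ)
  have h3 := h1.comp_tendsto h2
  have h4 := (h1.add (h3.congr_right fun x => by simp)).const_smul_left (2⁻¹ : ℝ)
  refine (h4.congr_left fun x => ?_).congr_right fun x => by simp
  have h5 : (p 1 fun _ => -x) = -(p 1 fun _ => x) := by simp
  have h6 : (p 0 fun _ => x) = f 0 := hp.coeff_zero _
  have h7 : (p 0 fun _ => -x) = f 0 := hp.coeff_zero _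
  simp only [Function.comp_apply, zero_add, he, FormalMultilinearSeries.partialSum,
    Finset.sum_range_succ, Finset.sum_range_zero, h5, h6, h7, Pi.smul_apply]
  module

/-- If `h` is even and analytic at `0`, then `sinh^l h` has no term of order `l + 1` at `0`, since
`sinh σ / σ` is even and analytic as well. -/
theorem isBigO_sinh_pow_mul_sub {h : ℝ → ℂ} (hh : AnalyticAt ℝ h 0) (he : ∀ x, h (-x) = h x)
    (l : ℕ) : (fun σ : ℝ => (Real.sinh σ : ℂ) ^ l * h σ - h 0 * (σ : ℂ) ^ l) =O[𝓝 0]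
      fun σ : ℝ => σ ^ (l + 2) := by
  set d : ℝ → ℝ := dslope Real.sinh 0 with hd
  have hd1 : ∀ σ, Real.sinh σ = σ * d σ := fun σ => by
    have := sub_smul_dslope Real.sinh 0 σ
    simpa using this.symm
  have hd0 : d 0 = 1 := by simp [hd, dslope_same]
  have hde : ∀ σ, d (-σ) = d σ := fun σ => by
    rcases eq_or_ne σ 0 with rfl | h0
    · simp
    · have h1 := hd1 (-σ)
      rw [Real.sinh_neg, hd1 σ] at h1
      exact mul_left_cancel₀ h0 (by linarith)
  have hda : AnalyticAt ℝ d 0 := by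
    obtain ⟨p, hp⟩ := (Real.analyticAt_sinh (x := 0))
    exact ⟨_, hp.has_fpower_series_dslope_fslope⟩
  have hdc : AnalyticAt ℝ (fun σ => (d σ : ℂ)) 0 :=
    (Complex.ofRealCLM.analyticAt _).comp hda
  have h1 := isBigO_sub_sq_of_even (f := fun σ => (d σ : ℂ) ^ l * h σ) ((hdc.pow l).mul hh)
    (fun x => by rw [hde, he])
  have h2 : (fun σ : ℝ => (σ : ℂ) ^ l) =O[𝓝 0] fun σ : ℝ => σ ^ l :=
    Asymptotics.isBigO_of_le _ fun σ => by simp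
  refine ((h2.mul h1).congr_left fun σ => ?_).congr_right fun σ => by ring
  rw [hd0, hd1 σ]
  push_cast
  ring

end Taylor

/-! ### Matrix elements of the approximants -/

section MatrixElements
variable (q : ℝ) (n : ℤ)

/-- The state `U(σ) c_{l,0}⁺ |u⟩`. -/
def boostedExcitation (l : ℕ) (σ : ℝ) : Fock Photon :=
  lorentz q n (boost σ) (cPlus q l ⟨ketU, ketU_mem_cPlus_domain q l⟩)

theorem inner_expVec_boostedExcitation (l : ℕ) (σ : ℝ) (φ : Photon) :
    ⟪expVec φ, boostedExcitation q n l σ⟫_ℂ = (2 * √Real.pi * q : ℂ) *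
      (⟪expVec φ, ketVelocity q n (boost σ)⟫_ℂ *
        ⟪photonRep (boost σ)⁻¹ (φ - coulombShift q n (boost σ)), zonalPhoton l⟫_ℂ) := by
  have h1 : boostedExcitation q n l σ = (2 * √Real.pi * q : ℂ) •
      affineUnitary (photonRep (boost σ)) (coulombShift q n (boost σ))
        (creation (zonalPhoton l) ⟨vacuum Photon, vacuum_mem_creation_domain (zonalPhoton l)⟩) := by
    rw [← map_smul]; rfl
  rw [h1, inner_smul_right, inner_expVec_affineUnitary_creation, ketVelocity_eq, inner_smul_right,
    inner_expVec, Complex.exp_add, photonRep_symm]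

/-- The scalar in front of the real matrix elements `inner_ketVelocity_boostedExcitation`. -/
def excitationFactor (l : ℕ) : ℂ :=
  (2 * √Real.pi * q : ℂ) * (conj (-Complex.I * (n * q / Real.pi) : ℂ) *
    ((√((2 * l + 1) / (Real.pi * l * (l + 1))) : ℂ) * ((-(Real.pi / 2) : ℝ) : ℂ)))

theorem excitationFactor_ne_zero (hz : 0 < couplingZ q n) {l : ℕ} (hl : 1 ≤ l) :
    excitationFactor q n l ≠ 0 := by
  have hpi := Real.pi_ne_zero
  have hn : (n : ℝ) ≠ 0 := by rintro h; simp [couplingZ, h] at hz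
  have hq : q ≠ 0 := by rintro h; simp [couplingZ, h] at hz
  have hn' : (n : ℂ) ≠ 0 := by exact_mod_cast hn
  have hl' : (0 : ℝ) < l := by exact_mod_cast hl
  have h1 : √Real.pi ≠ 0 := (Real.sqrt_pos.2 Real.pi_pos).ne'
  have h2 : √((2 * l + 1) / (Real.pi * l * (l + 1))) ≠ 0 :=
    (Real.sqrt_pos.2 (by have := Real.pi_pos; positivity)).ne'
  have h3 : (((-(Real.pi / 2) : ℝ) : ℂ)) ≠ 0 := by
    rw [Complex.ofReal_ne_zero]
    simp
  refine mul_ne_zero (by simp [hq, h1]) (mul_ne_zero ?_ (mul_ne_zero (by simpa using h2) h3))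
  rw [map_ne_zero]
  simp [hq, hpi, hn']

/-- The azimuth `θ` drops out by the invariance of the zonal photon states. -/
theorem inner_ketVelocity_boostedExcitation (l : ℕ) (σ θ φ s : ℝ) :
    ⟪ketVelocity q n (rotation12 θ * rotation13 φ * boost s), boostedExcitation q n l σ⟫_ℂ =
      excitationFactor q n l * ((overlapKernel (couplingZ q n) (velocityTime σ φ s) *
        zonalPairing l (velocityTime σ φ s) (velocityAxial σ φ s) : ℝ) : ℂ) := by
  set a := rotation12 θ * rotation13 φ with ha
  have h1 : ⟪ketVelocity q n (a * boost s), boostedExcitation q n l σ⟫_ℂ =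
      (2 * √Real.pi * q : ℂ) *
      (⟪ketVelocity q n (a * boost s), ketVelocity q n (boost σ)⟫_ℂ *
        ⟪photonRep (boost σ)⁻¹ (coulombShift q n (a * boost s) - coulombShift q n (boost σ)),
          zonalPhoton l⟫_ℂ) := by
    rw [ketVelocity_eq q n (a * boost s), inner_smul_left, inner_smul_left,
      inner_expVec_boostedExcitation]
    ring
  have h2 : ⟪ketVelocity q n (a * boost s), ketVelocity q n (boost σ)⟫_ℂ =
      (overlapKernel (couplingZ q n) (velocityTime σ φ s) : ℝ) := by
    have h := inner_ketVelocity_rotation q n (isRotation_euler θ φ)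
      (isRotation_rotation12 0) s σ
    have h0 : rotation12 0 = 1 := by
      ext i j
      fin_cases i <;> fin_cases j <;> simp [rotation12]
    rw [h0, one_mul, mul_one] at h
    rw [h, velocityTime]
    have e : ‖(rotation12 θ * rotation13 φ)⁻¹ 0 0‖ ^ 2 = Real.cos (φ / 2) ^ 2 := by
      have e1 : (rotation12 θ * rotation13 φ)⁻¹ 0 0 =
          ((Real.cos (φ / 2) : ℝ) : ℂ) * Complex.exp ((θ / 2 : ℝ) * Complex.I) := by
        rw [mul_inv_rev, rotation13_inv, rotation12_inv, mul_apply]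
        simp [rotation12, rotation13]
        rw [neg_div, Complex.cos_neg]
        congr 2
        ring
      rw [e1, norm_mul, Complex.norm_exp_ofReal_mul_I, mul_one, Complex.norm_real,
        Real.norm_eq_abs, sq_abs]
    have e2 : 2 * Real.cos (φ / 2) ^ 2 - 1 = Real.cos φ := by
      rw [← Real.cos_two_mul]; congr 1; ring
    rw [e, e2]
  have h3 : ⟪photonRep (boost σ)⁻¹ (coulombShift q n (a * boost s) - coulombShift q n (boost σ)),
      zonalPhoton l⟫_ℂ = conj (-Complex.I * (n * q / Real.pi) : ℂ) *
      ((√((2 * l + 1) / (Real.pi * l * (l + 1))) : ℂ) *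
      ((-(Real.pi / 2) * zonalPairing l (velocityTime σ φ s) (velocityAxial σ φ s) : ℝ) : ℂ)) := by
    have e : (boost σ)⁻¹ * (a * boost s) = rotation12 θ * boostRot σ φ s := by
      rw [ha, boostRot, boost_inv]
      simp only [← mul_assoc]
      rw [← rotation12_mul_boost]
    rw [coulombShift_sub, map_smul, photonRep_inv_sub, e,
      (isRotation_rotation12 θ).logShift_mul_left, zonalPhoton_eq, inner_smul_left,
      inner_smul_right, ← inner_logShift_zonalVec, ← photonRep_rotation12_zonalVec θ l,
      LinearIsometryEquiv.inner_map_map, photonRep_rotation12_zonalVec]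
  rw [h1, h2, h3, excitationFactor]
  push_cast
  ring

theorem inner_boundStateApprox_boostedExcitation (l : ℕ) (σ s : ℝ) :
    ⟪boundStateApprox q n s, boostedExcitation q n l σ⟫_ℂ = excitationFactor q n l *
      ((normFactor (couplingZ q n) s * (2⁻¹ * ∫ φ in (0 : ℝ)..Real.pi, Real.sin φ *
        (overlapKernel (couplingZ q n) (velocityTime σ φ s) *
          zonalPairing l (velocityTime σ φ s) (velocityAxial σ φ s))) : ℝ) : ℂ) := by
  set X := boostedExcitation q n l σ with hX
  set k : ℝ → ℝ := fun φ => overlapKernel (couplingZ q n) (velocityTime σ φ s) *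
    zonalPairing l (velocityTime σ φ s) (velocityAxial σ φ s) with hk
  have h1 : ∀ θ φ : ℝ, ⟪X, ketVelocity q n (rotation12 θ * rotation13 φ * boost s)⟫_ℂ =
      conj (excitationFactor q n l) * (k φ : ℂ) := fun θ φ => by
    rw [← inner_conj_symm, inner_ketVelocity_boostedExcitation, map_mul, Complex.conj_ofReal]
  have h2 : ⟪X, boundStateApprox q n s⟫_ℂ = conj (excitationFactor q n l) *
      ((normFactor (couplingZ q n) s * (2⁻¹ * ∫ φ in (0 : ℝ)..Real.pi, Real.sin φ * k φ) : ℝ) :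
        ℂ) := by
    rw [boundStateApprox, inner_smul_right_eq_smul, inner_rotationMean_ketVelocity]
    simp only [h1]
    have h3 : ∀ φ : ℝ, (Real.sin φ / (4 * Real.pi)) • (conj (excitationFactor q n l) * (k φ : ℂ)) =
        (conj (excitationFactor q n l) * ((4 * Real.pi)⁻¹ : ℝ)) * ((Real.sin φ * k φ : ℝ) : ℂ) := by
      intro φ
      rw [Complex.real_smul]
      push_cast
      ring
    simp only [h3, intervalIntegral.integral_const_mul, intervalIntegral.integral_ofReal,
      intervalIntegral.integral_const]
    have hpi : (Real.pi : ℂ) ≠ 0 := by exact_mod_cast Real.pi_ne_zero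
    rw [Complex.real_smul, Complex.real_smul]
    push_cast
    field_simp
    ring
  rw [← inner_conj_symm, h2, map_mul, Complex.conj_conj, Complex.conj_ofReal]

end MatrixElements

/-! ### The limit of infinite rapidity -/

section Limit
open Polynomial

/-- Integration of the derivative of `P_l` against a sign function. -/
theorem integral_derivative_legendre_mul_sub_sign {l : ℕ} (hl : 1 ≤ l) {τ : ℝ}
    (hτ : τ ∈ Set.Icc (-1 : ℝ) 1) :
    ∫ t in (-1 : ℝ)..1, (legendre l).derivative.eval t * (t - (t - τ) / |t - τ|) =
      2 * (legendre l).eval τ := by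
  set P := legendre l with hP
  have hderiv : ∀ a b : ℝ, ∫ t in a..b, P.derivative.eval t = P.eval b - P.eval a := fun a b =>
    intervalIntegral.integral_eq_sub_of_hasDerivAt (fun t _ => P.hasDerivAt t)
      (P.derivative.continuous.intervalIntegrable _ _)
  have hmul : ∫ t in (-1 : ℝ)..1, P.derivative.eval t * t = P.eval 1 + P.eval (-1) := by
    have h := intervalIntegral.integral_mul_deriv_eq_deriv_mul (a := -1) (b := 1)
      (u := fun t : ℝ => t) (u' := fun _ => 1) (v := fun t => P.eval t)
      (v' := fun t => P.derivative.eval t) (fun t _ => hasDerivAt_id t) (fun t _ => P.hasDerivAt t)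
      intervalIntegrable_const (P.derivative.continuous.intervalIntegrable _ _)
    simp only [one_mul, hP, integral_legendre hl] at h
    simp only [mul_comm (P.derivative.eval _)]
    rw [hP, h]
    ring
  have hle : ∀ t ∈ Set.uIoo (-1) τ, -P.derivative.eval t =
      P.derivative.eval t * ((t - τ) / |t - τ|) := by
    intro t ht
    rw [Set.uIoo_of_le hτ.1] at ht
    have h1 : t - τ < 0 := by linarith [ht.2]
    rw [abs_of_neg h1, div_neg, div_self h1.ne]
    ring
  have hge : ∀ t ∈ Set.uIoo τ 1, P.derivative.eval t =
      P.derivative.eval t * ((t - τ) / |t - τ|) := by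
    intro t ht
    rw [Set.uIoo_of_le hτ.2] at ht
    have h1 : 0 < t - τ := by linarith [ht.1]
    rw [abs_of_pos h1, div_self h1.ne', mul_one]
  have hi1 : IntervalIntegrable (fun t => P.derivative.eval t * ((t - τ) / |t - τ|)) volume
      (-1) τ := (P.derivative.continuous.neg.intervalIntegrable _ _).congr_uIoo hle
  have hi2 : IntervalIntegrable (fun t => P.derivative.eval t * ((t - τ) / |t - τ|)) volume
      τ 1 := (P.derivative.continuous.intervalIntegrable _ _).congr_uIoo hge
  have hi0 : IntervalIntegrable (fun t => P.derivative.eval t * t) volume (-1) 1 :=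
    (P.derivative.continuous.mul continuous_id).intervalIntegrable _ _
  simp only [mul_sub]
  rw [intervalIntegral.integral_sub hi0 (hi1.trans hi2), hmul,
    ← intervalIntegral.integral_add_adjacent_intervals hi1 hi2,
    ← intervalIntegral.integral_congr_uIoo hle, ← intervalIntegral.integral_congr_uIoo hge,
    intervalIntegral.integral_neg, hderiv, hderiv]
  ring

theorem exists_abs_zonalPairing_le (l : ℕ) : ∃ C : ℝ, ∀ v₀ v₃, |zonalPairing l v₀ v₃| ≤ C := by
  obtain ⟨M, hM⟩ := (isCompact_Icc (a := (-1 : ℝ)) (b := 1)).exists_bound_of_continuousOn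
    (legendre l).derivative.continuous.continuousOn
  refine ⟨M * 2 * |1 - (-1)|, fun v₀ v₃ => ?_⟩
  rw [← Real.norm_eq_abs, zonalPairing]
  refine intervalIntegral.norm_integral_le_of_norm_le_const fun t ht => ?_
  rw [Set.uIoc_of_le (by norm_num)] at ht
  have ht' : t ∈ Set.Icc (-1 : ℝ) 1 := Set.Ioc_subset_Icc_self ht
  rw [norm_mul]
  have h1 := hM t ht'
  refine mul_le_mul h1 ?_ (norm_nonneg _) ((norm_nonneg _).trans h1)
  rw [Real.norm_eq_abs]
  refine (abs_sub _ _).trans ?_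
  linarith [abs_le.2 ht', abs_axialProfile_le v₀ v₃ ht']

/-- For light-like velocities `axialProfile` becomes a sign function. -/
theorem tendsto_zonalPairing {l : ℕ} (hl : 1 ≤ l) {v₀ v₃ : ℝ → ℝ} {τ : ℝ}
    (hv : ∀ s, |v₃ s| < v₀ s) (h0 : Tendsto v₀ atTop atTop)
    (h3 : Tendsto (fun s => v₃ s / v₀ s) atTop (𝓝 (-τ))) (hτ : τ ∈ Set.Icc (-1 : ℝ) 1) :
    Tendsto (fun s => zonalPairing l (v₀ s) (v₃ s)) atTop (𝓝 (2 * (legendre l).eval τ)) := by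
  obtain ⟨M, hM⟩ := (isCompact_Icc (a := (-1 : ℝ)) (b := 1)).exists_bound_of_continuousOn
    (legendre l).derivative.continuous.continuousOn
  have hIoc : Set.uIoc (-1 : ℝ) 1 ⊆ Set.Icc (-1) 1 := by
    rw [Set.uIoc_of_le (by norm_num)]; exact Set.Ioc_subset_Icc_self
  rw [← integral_derivative_legendre_mul_sub_sign hl hτ]
  refine intervalIntegral.tendsto_integral_filter_of_dominated_convergence (fun _ => M * 2)
    (Eventually.of_forall fun s => ?_) (Eventually.of_forall fun s => ?_)
    intervalIntegrable_const ?_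
  · refine (ContinuousOn.aestronglyMeasurable ?_ measurableSet_Icc).mono_set hIoc
    exact (legendre l).derivative.continuous.continuousOn.mul
      (continuousOn_id.sub (continuousOn_axialProfile (hv s)))
  · refine Eventually.of_forall fun t ht => ?_
    have ht' := hIoc ht
    rw [norm_mul]
    refine mul_le_mul (hM t ht') ?_ (norm_nonneg _) ((norm_nonneg _).trans (hM t ht'))
    rw [Real.norm_eq_abs]
    refine (abs_sub _ _).trans ?_
    linarith [abs_le.2 ht', abs_axialProfile_le (v₀ s) (v₃ s) ht']
  · have hne : ∀ᵐ t : ℝ, t ≠ τ := by simp [ae_iff]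
    filter_upwards [hne] with t hne ht
    refine (tendsto_const_nhds.sub ?_).const_mul _
    have h4 : ∀ s, axialProfile (v₀ s) (v₃ s) t =
        (t + v₃ s / v₀ s) / √((t + v₃ s / v₀ s) ^ 2 + (1 - t ^ 2) * (v₀ s)⁻¹ ^ 2) := by
      intro s
      have hp : 0 < v₀ s := (abs_nonneg _).trans_lt (hv s)
      have e : (v₀ s * t + v₃ s) ^ 2 + (1 - t ^ 2) =
          v₀ s ^ 2 * ((t + v₃ s / v₀ s) ^ 2 + (1 - t ^ 2) * (v₀ s)⁻¹ ^ 2) := by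
        field_simp
      rw [axialProfile, e, Real.sqrt_mul (sq_nonneg _), Real.sqrt_sq hp.le,
        show v₀ s * t + v₃ s = v₀ s * (t + v₃ s / v₀ s) by field_simp,
        mul_div_mul_left _ _ hp.ne']
    simp only [h4]
    have h5 := h3.const_add t
    have h6 := (h5.pow 2).add (((tendsto_inv_atTop_zero.comp h0).pow 2).const_mul (1 - t ^ 2))
    have h8 : √((t + -τ) ^ 2 + (1 - t ^ 2) * 0 ^ 2) = |t - τ| := by
      rw [← sub_eq_add_neg, ← Real.sqrt_sq_eq_abs]; simp
    have h7 := h5.div h6.sqrt (by rw [h8]; simpa [sub_eq_zero] using hne)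
    rw [h8, ← sub_eq_add_neg] at h7
    exact h7

variable {z : ℝ}

theorem tendsto_cosh_mul_exp_neg :
    Tendsto (fun s => Real.cosh s * Real.exp (-s)) atTop (𝓝 2⁻¹) := by
  have h := (Real.tendsto_exp_neg_atTop_nhds_zero.pow 2).const_add 1 |>.const_mul 2⁻¹
  refine (h.congr fun s => ?_).trans (by simp)
  rw [Real.cosh_eq]
  have := Real.exp_pos s
  rw [Real.exp_neg]
  field_simp

theorem tendsto_velocityTime (σ φ : ℝ) :
    Tendsto (fun s => velocityTime σ φ s * Real.exp (-s)) atTop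
      (𝓝 (2⁻¹ * (Real.cosh σ - Real.cos φ * Real.sinh σ))) := by
  have h := (tendsto_cosh_mul_exp_neg.mul_const (Real.cosh σ)).sub
    (tendsto_sinh_mul_exp_neg.mul_const (Real.sinh σ * Real.cos φ))
  refine (h.congr fun s => ?_).trans (le_of_eq ?_)
  · rw [velocityTime]; ring
  · congr 1; ring

theorem tendsto_velocityAxial (σ φ : ℝ) :
    Tendsto (fun s => velocityAxial σ φ s * Real.exp (-s)) atTop
      (𝓝 (2⁻¹ * (Real.cosh σ * Real.cos φ - Real.sinh σ))) := by
  have h := (tendsto_sinh_mul_exp_neg.mul_const (Real.cosh σ * Real.cos φ)).sub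
    (tendsto_cosh_mul_exp_neg.mul_const (Real.sinh σ))
  refine (h.congr fun s => ?_).trans (le_of_eq ?_)
  · rw [velocityAxial]; ring
  · congr 1; ring

theorem cosh_sub_cos_mul_sinh_pos (σ φ : ℝ) : 0 < Real.cosh σ - Real.cos φ * Real.sinh σ :=
  cosh_sub_mul_sinh_pos σ ⟨Real.neg_one_le_cos φ, Real.cos_le_one φ⟩

theorem tendsto_velocityTime_atTop (σ φ : ℝ) : Tendsto (velocityTime σ φ) atTop atTop := by
  refine ((tendsto_velocityTime σ φ).pos_mul_atTop
    (by have := cosh_sub_cos_mul_sinh_pos σ φ; positivity) Real.tendsto_exp_atTop).congr fun s => ?_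
  rw [mul_assoc, ← Real.exp_add, neg_add_cancel, Real.exp_zero, mul_one]

/-- The aberration formula for the cosine of the polar angle under the boost `σ`, composed with a
reflection, which makes it an involution of `[-1, 1]`. -/
def aberration (σ t : ℝ) : ℝ :=
  (Real.sinh σ - t * Real.cosh σ) / (Real.cosh σ - t * Real.sinh σ)

theorem aberration_mem_Icc (σ : ℝ) {t : ℝ} (ht : t ∈ Set.Icc (-1 : ℝ) 1) :
    aberration σ t ∈ Set.Icc (-1 : ℝ) 1 := by
  have h := cosh_sub_mul_sinh_pos σ ht
  have h1 : 0 < Real.cosh σ + Real.sinh σ := by rw [Real.cosh_add_sinh]; positivity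
  have h2 : 0 < Real.cosh σ - Real.sinh σ := by rw [Real.cosh_sub_sinh]; positivity
  rw [aberration, Set.mem_Icc, le_div_iff₀ h, div_le_iff₀ h]
  constructor <;> nlinarith [ht.1, ht.2]

theorem tendsto_zonalPairing_velocity {l : ℕ} (hl : 1 ≤ l) (σ φ : ℝ) :
    Tendsto (fun s => zonalPairing l (velocityTime σ φ s) (velocityAxial σ φ s)) atTop
      (𝓝 (2 * (legendre l).eval (aberration σ (Real.cos φ)))) := by
  have hp := cosh_sub_cos_mul_sinh_pos σ φ
  refine tendsto_zonalPairing hl (abs_velocityAxial_lt σ φ) (tendsto_velocityTime_atTop σ φ) ?_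
    (aberration_mem_Icc σ ⟨Real.neg_one_le_cos φ, Real.cos_le_one φ⟩)
  have h := (tendsto_velocityAxial σ φ).div (tendsto_velocityTime σ φ) (by positivity)
  refine (h.congr fun s => ?_).trans (le_of_eq ?_)
  · exact mul_div_mul_right _ _ (Real.exp_ne_zero _)
  · congr 1
    rw [aberration, mul_div_mul_left _ _ (by norm_num), ← neg_div]
    congr 1
    ring

theorem tendsto_overlapKernel_velocityTime (z σ φ : ℝ) :
    Tendsto (fun s => overlapKernel z (velocityTime σ φ s) * Real.exp (z * s)) atTop
      (𝓝 (Real.exp z * (Real.cosh σ - Real.cos φ * Real.sinh σ) ^ (-z))) := by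
  have hp := cosh_sub_cos_mul_sinh_pos σ φ
  set x : ℝ → ℝ := fun s => Real.arcosh (velocityTime σ φ s) with hx
  have hcosh : ∀ s, Real.cosh (x s) = velocityTime σ φ s := fun s =>
    Real.cosh_arcosh (one_le_velocityTime σ φ s)
  have hexp : ∀ s, Real.exp (x s) = 2 * velocityTime σ φ s - Real.exp (-x s) := fun s => by
    rw [← hcosh, Real.cosh_eq]; ring
  have hxtop : Tendsto x atTop atTop := by
    rw [← Real.tendsto_exp_comp_atTop]
    refine tendsto_atTop_mono (fun s => ?_) (tendsto_velocityTime_atTop σ φ)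
    rw [← hcosh, ← Real.cosh_add_sinh]
    linarith [Real.sinh_nonneg_iff.2 (Real.arcosh_nonneg (one_le_velocityTime σ φ s))]
  have hshift : Tendsto (fun s => Real.exp (x s - s)) atTop
      (𝓝 (Real.cosh σ - Real.cos φ * Real.sinh σ)) := by
    have h := ((tendsto_velocityTime σ φ).const_mul 2).sub
      ((Real.tendsto_exp_neg_atTop_nhds_zero.comp hxtop).mul Real.tendsto_exp_neg_atTop_nhds_zero)
    refine (h.congr fun s => ?_).trans (le_of_eq ?_)
    · rw [sub_eq_add_neg (x s), Real.exp_add, hexp]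
      simp only [Function.comp_apply]
      ring
    · congr 1; ring
  have h := ((tendsto_overlapKernel_cosh z).comp hxtop).mul
    (hshift.rpow_const (p := -z) (Or.inl hp.ne'))
  refine h.congr fun s => ?_
  rw [Function.comp_apply, hcosh, ← Real.exp_mul, mul_assoc, ← Real.exp_add]
  congr 2
  ring

/-- A bound uniform in the direction and in `s`, which dominates the approach to the limit. -/
theorem overlapKernel_velocityTime_le (hz : 0 ≤ z) (σ φ s : ℝ) :
    overlapKernel z (velocityTime σ φ s) * Real.exp (z * s) ≤
      Real.exp z * Real.exp (z * (|σ| + Real.log 2)) := by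
  set x := Real.arcosh (velocityTime σ φ s) with hx
  have hx0 : 0 ≤ x := Real.arcosh_nonneg (one_le_velocityTime σ φ s)
  have hcosh : Real.cosh x = velocityTime σ φ s := Real.cosh_arcosh (one_le_velocityTime σ φ s)
  have h1 : s ≤ x + (|σ| + Real.log 2) := by
    rw [← Real.exp_le_exp, Real.exp_add, Real.exp_add, Real.exp_log two_pos]
    have h2 := cosh_mul_exp_neg_abs_le σ φ s
    rw [← hcosh, Real.exp_neg, ← div_eq_mul_inv, div_le_iff₀ (Real.exp_pos _)] at h2
    have h3 : Real.exp s ≤ 2 * Real.cosh s := by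
      rw [Real.cosh_eq]; linarith [Real.exp_pos (-s)]
    have h4 : Real.cosh x ≤ Real.exp x := by
      rw [← Real.cosh_add_sinh]; linarith [Real.sinh_nonneg_iff.2 hx0]
    nlinarith [Real.exp_pos |σ|]
  rw [← hcosh]
  refine (mul_le_mul_of_nonneg_right (overlapKernel_cosh_le hz hx0) (Real.exp_pos _).le).trans ?_
  rw [mul_assoc, ← Real.exp_add]
  gcongr
  nlinarith

theorem aestronglyMeasurable_zonalPairing (l : ℕ) (σ s : ℝ) (μ : Measure ℝ) :
    AEStronglyMeasurable
      (fun φ => zonalPairing l (velocityTime σ φ s) (velocityAxial σ φ s)) μ := by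
  have h1 : Measurable fun p : ℝ × ℝ => (legendre l).derivative.eval p.2 * (p.2 -
      axialProfile (velocityTime σ p.1 s) (velocityAxial σ p.1 s) p.2) := by
    have h2 : Measurable fun t : ℝ => (legendre l).derivative.eval t :=
      (legendre l).derivative.continuous.measurable
    unfold axialProfile velocityTime velocityAxial
    fun_prop
  simp only [zonalPairing, intervalIntegral.integral_of_le (by norm_num : (-1 : ℝ) ≤ 1)]
  exact (h1.stronglyMeasurable.integral_prod_right'
    (ν := volume.restrict (Set.Ioc (-1 : ℝ) 1))).aestronglyMeasurable

theorem tendsto_integral_overlapKernel_mul_zonalPairing (hz : 0 ≤ z) {l : ℕ} (hl : 1 ≤ l)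
    (σ : ℝ) :
    Tendsto (fun s => (∫ φ in (0 : ℝ)..Real.pi, Real.sin φ *
        (overlapKernel z (velocityTime σ φ s) *
          zonalPairing l (velocityTime σ φ s) (velocityAxial σ φ s))) * Real.exp (z * s)) atTop
      (𝓝 (2 * Real.exp z * ∫ φ in (0 : ℝ)..Real.pi, Real.sin φ *
        ((Real.cosh σ - Real.cos φ * Real.sinh σ) ^ (-z) *
          (legendre l).eval (aberration σ (Real.cos φ))))) := by
  obtain ⟨C, hC⟩ := exists_abs_zonalPairing_le l
  have h := intervalIntegral.tendsto_integral_filter_of_dominated_convergence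
    (μ := volume) (a := 0) (b := Real.pi) (l := atTop)
    (F := fun s φ => Real.sin φ *
      ((overlapKernel z (velocityTime σ φ s) * Real.exp (z * s)) *
        zonalPairing l (velocityTime σ φ s) (velocityAxial σ φ s)))
    (f := fun φ => Real.sin φ *
      ((Real.exp z * (Real.cosh σ - Real.cos φ * Real.sinh σ) ^ (-z)) *
        (2 * (legendre l).eval (aberration σ (Real.cos φ)))))
    (fun _ => 1 * (Real.exp z * Real.exp (z * (|σ| + Real.log 2)) * C))
    (Eventually.of_forall fun s => ?_) (Eventually.of_forall fun s => ?_)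
    intervalIntegrable_const ?_
  · refine (h.congr fun s => ?_).trans (le_of_eq ?_)
    · rw [← intervalIntegral.integral_mul_const]
      congr 1
      ext φ
      ring
    · rw [← intervalIntegral.integral_const_mul]
      congr 2
      ext φ
      ring
  · refine Real.continuous_sin.aestronglyMeasurable.mul (AEStronglyMeasurable.mul ?_
      (aestronglyMeasurable_zonalPairing l σ s _))
    refine (Continuous.mul ((continuous_overlapKernel z).comp ?_)
      continuous_const).aestronglyMeasurable
    unfold velocityTime
    fun_prop
  · refine Eventually.of_forall fun φ _ => ?_
    rw [norm_mul, norm_mul]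
    refine mul_le_mul (Real.abs_sin_le_one φ) (mul_le_mul ?_ (hC _ _) (norm_nonneg _)
      (by positivity)) (by positivity) zero_le_one
    rw [Real.norm_of_nonneg (mul_nonneg (overlapKernel_pos _ _).le (Real.exp_pos _).le)]
    exact overlapKernel_velocityTime_le hz σ φ s
  · exact Eventually.of_forall fun φ _ => ((tendsto_overlapKernel_velocityTime z σ φ).mul
      (tendsto_zonalPairing_velocity hl σ φ)).const_mul _

theorem cosh_sub_aberration_mul_sinh (σ : ℝ) {t : ℝ} (ht : t ∈ Set.Icc (-1 : ℝ) 1) :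
    Real.cosh σ - aberration σ t * Real.sinh σ = (Real.cosh σ - t * Real.sinh σ)⁻¹ := by
  have h := (cosh_sub_mul_sinh_pos σ ht).ne'
  refine eq_inv_of_mul_eq_one_left ?_
  rw [aberration, sub_mul, mul_right_comm, div_mul_cancel₀ _ h]
  linear_combination Real.cosh_sq_sub_sinh_sq σ

theorem aberration_aberration (σ : ℝ) {t : ℝ} (ht : t ∈ Set.Icc (-1 : ℝ) 1) :
    aberration σ (aberration σ t) = t := by
  have h := (cosh_sub_mul_sinh_pos σ ht).ne'
  rw [aberration, cosh_sub_aberration_mul_sinh σ ht, div_inv_eq_mul, aberration, sub_mul,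
    mul_right_comm, div_mul_cancel₀ _ h]
  linear_combination t * Real.cosh_sq_sub_sinh_sq σ

theorem hasDerivAt_aberration (σ : ℝ) {t : ℝ} (ht : t ∈ Set.Icc (-1 : ℝ) 1) :
    HasDerivAt (aberration σ) (-((Real.cosh σ - t * Real.sinh σ) ^ 2)⁻¹) t := by
  have h := (cosh_sub_mul_sinh_pos σ ht).ne'
  have h1 : HasDerivAt (fun t => Real.sinh σ - t * Real.cosh σ) (-Real.cosh σ) t := by
    simpa using ((hasDerivAt_id t).mul_const (Real.cosh σ)).const_sub (Real.sinh σ)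
  have h2 : HasDerivAt (fun t => Real.cosh σ - t * Real.sinh σ) (-Real.sinh σ) t := by
    simpa using ((hasDerivAt_id t).mul_const (Real.sinh σ)).const_sub (Real.cosh σ)
  refine (h1.div h2 h).congr_deriv ?_
  have h3 : (Real.cosh σ - t * Real.sinh σ) ^ 2 ≠ 0 := pow_ne_zero 2 h
  rw [div_eq_iff h3]
  linear_combination inv_mul_cancel₀ h3 - Real.cosh_sq_sub_sinh_sq σ

theorem continuousOn_aberration (σ : ℝ) : ContinuousOn (aberration σ) (Set.Icc (-1) 1) :=
  fun _ ht => (hasDerivAt_aberration σ ht).continuousAt.continuousWithinAt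

/-- Substitution of the aberration formula, by which the light-like limit velocities are again
described in the frame of `u`. -/
theorem integral_rpow_mul_legendre_aberration (l : ℕ) (σ z : ℝ) :
    ∫ t in (-1 : ℝ)..1, (Real.cosh σ - t * Real.sinh σ) ^ (-z) *
        (legendre l).eval (aberration σ t) =
      ∫ t in (-1 : ℝ)..1, (legendre l).eval t * (Real.cosh σ - t * Real.sinh σ) ^ (z - 2) := by
  have huIcc : Set.uIcc (-1 : ℝ) 1 = Set.Icc (-1) 1 := Set.uIcc_of_le (by norm_num)
  set G : ℝ → ℝ := fun t => (Real.cosh σ - t * Real.sinh σ) ^ (-z) *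
    (legendre l).eval (aberration σ t) with hG
  have hGc : ContinuousOn G (Set.Icc (-1) 1) :=
    (continuousOn_cosh_sub_mul_sinh_rpow σ (-z)).mul
      ((legendre l).continuous.comp_continuousOn (continuousOn_aberration σ))
  have h1 : aberration σ (-1) = 1 := by
    have := (cosh_sub_mul_sinh_pos σ (t := -1) (by norm_num)).ne'
    rw [aberration, div_eq_one_iff_eq this]; ring
  have h2 : aberration σ 1 = -1 := by
    have := (cosh_sub_mul_sinh_pos σ (t := 1) (by norm_num)).ne'
    rw [aberration, div_eq_iff this]; ring
  have hsub := intervalIntegral.integral_comp_mul_deriv' (a := -1) (b := 1) (f := aberration σ)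
    (f' := fun t => -((Real.cosh σ - t * Real.sinh σ) ^ 2)⁻¹) (g := G)
    (fun t ht => hasDerivAt_aberration σ (huIcc ▸ ht)) ?_ ?_
  · rw [h1, h2, intervalIntegral.integral_symm (-1) 1, ← neg_eq_iff_eq_neg,
      ← intervalIntegral.integral_neg] at hsub
    rw [← hsub]
    refine intervalIntegral.integral_congr fun t ht => ?_
    rw [huIcc] at ht
    have hp := cosh_sub_mul_sinh_pos σ ht
    simp only [Function.comp_apply, hG]
    rw [cosh_sub_aberration_mul_sinh σ ht, aberration_aberration σ ht, Real.inv_rpow hp.le,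
      Real.rpow_neg hp.le, inv_inv, Real.rpow_sub hp, Real.rpow_ofNat, div_eq_mul_inv]
    ring
  · rw [huIcc]
    exact (ContinuousOn.inv₀ (by fun_prop) fun t ht =>
      pow_ne_zero 2 (cosh_sub_mul_sinh_pos σ ht).ne').neg
  · rw [huIcc]
    exact hGc.mono (Set.image_subset_iff.2 fun t ht => aberration_mem_Icc σ ht)

end Limit

/-! ### The overlaps with the bound state -/

section BoundState
variable {q : ℝ} {n : ℤ}

/-- The closed form of the overlaps: up to a nonzero constant they are
`sinh^l σ ∫ (t² - 1)^l (cosh σ - t sinh σ)^(z - 2 - l) dt`. -/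
theorem exists_overlap_eq (hz : 0 < couplingZ q n) (hz1 : couplingZ q n < 1) {b : Fock Photon}
    (hb : Tendsto (boundStateApprox q n) atTop (𝓝 b)) {l : ℕ} (hl : 1 ≤ l) :
    ∃ K : ℂ, K ≠ 0 ∧ ∀ σ : ℝ, overlap q n b l σ =
      K * ((Real.sinh σ : ℂ) ^ l * (zonalMoment l (couplingZ q n - 2 - l) σ : ℂ)) := by
  set z := couplingZ q n with hzdef
  obtain ⟨c, hc, hclim⟩ := tendsto_normFactor hz.le hz1
  set k : ℝ := c * Real.exp z * ((2 ^ l * l.factorial : ℝ)⁻¹ *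
    ∏ j ∈ Finset.range l, (z - 2 - j)) with hk
  have hk0 : k ≠ 0 := by
    refine mul_ne_zero (mul_ne_zero hc.ne' (Real.exp_ne_zero _)) (mul_ne_zero (by positivity) ?_)
    refine Finset.prod_ne_zero_iff.2 fun j _ => ?_
    have : (0 : ℝ) ≤ j := j.cast_nonneg
    linarith
  refine ⟨excitationFactor q n l * k, mul_ne_zero (excitationFactor_ne_zero q n hz hl)
    (by exact_mod_cast hk0), fun σ => ?_⟩
  have hint : ∫ φ in (0 : ℝ)..Real.pi, Real.sin φ *
        ((Real.cosh σ - Real.cos φ * Real.sinh σ) ^ (-z) *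
          (legendre l).eval (aberration σ (Real.cos φ))) =
      (2 ^ l * l.factorial : ℝ)⁻¹ * (Real.sinh σ ^ l * (∏ j ∈ Finset.range l, (z - 2 - j)) *
        zonalMoment l (z - 2 - l) σ) := by
    rw [← integral_legendre_mul_rpow, ← integral_rpow_mul_legendre_aberration]
    exact integral_sin_mul_comp_cos ((continuousOn_cosh_sub_mul_sinh_rpow σ (-z)).mul
      ((legendre l).continuous.comp_continuousOn (continuousOn_aberration σ)))
  have hreal := hclim.mul ((tendsto_integral_overlapKernel_mul_zonalPairing hz.le hl σ).const_mul
    2⁻¹)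
  rw [hint] at hreal
  have hlim := ((Complex.continuous_ofReal.tendsto _).comp hreal).const_mul (excitationFactor q n l)
  have hinner : Tendsto (fun s => ⟪boundStateApprox q n s, boostedExcitation q n l σ⟫_ℂ) atTop
      (𝓝 (overlap q n b l σ)) := hb.inner tendsto_const_nhds
  refine (tendsto_nhds_unique hinner (hlim.congr fun s => ?_)).trans ?_
  · rw [inner_boundStateApprox_boostedExcitation, Function.comp_apply]
    congr 2
    have h : Real.exp (-(z * s)) * Real.exp (z * s) = 1 := by
      rw [← Real.exp_add, neg_add_cancel, Real.exp_zero]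
    generalize (∫ φ in (0 : ℝ)..Real.pi, Real.sin φ *
        (overlapKernel z (velocityTime σ φ s) *
          zonalPairing l (velocityTime σ φ s) (velocityAxial σ φ s))) = I
    linear_combination normFactor z s * (2⁻¹ * I) * h
  · rw [hk]
    push_cast
    ring

end BoundState

end CoulombField
end

open CoulombField

theorem mainTheorem10 (q : ℝ) (hq : 0 < q) (n : ℤ)
    (hz0 : 0 < couplingZ q n) (hz1 : couplingZ q n < 1) :
    ∃ b : Fock Photon, Tendsto (boundStateApprox q n) atTop (𝓝 b) ∧ ‖b‖ = 1 ∧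
      ∀ l : ℕ, 1 ≤ l →
        (∀ᵐ σ : ℝ ∂volume, overlap q n b l σ ≠ 0) ∧
        AnalyticAt ℝ (overlap q n b l) 0 ∧
        ∃ C : ℂ, C ≠ 0 ∧
          (fun σ : ℝ => overlap q n b l σ - C * (σ : ℂ) ^ l) =O[𝓝 0]
            fun σ : ℝ => σ ^ (l + 2) := by
  obtain ⟨b, hb, hb1⟩ := exists_boundState q n hz0.le hz1
  refine ⟨b, hb, hb1, fun l hl => ?_⟩
  obtain ⟨K, hK, hform⟩ := exists_overlap_eq hz0 hz1 hb hl
  set μ := couplingZ q n - 2 - l with hμ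
  have hana : AnalyticAt ℝ (fun σ => (zonalMoment l μ σ : ℂ)) 0 := analyticAt_zonalMoment l μ
  refine ⟨?_, ?_, K * zonalMoment l μ 0, mul_ne_zero hK ?_, ?_⟩
  · have hne : ∀ᵐ σ : ℝ, σ ≠ 0 := by simp [ae_iff]
    filter_upwards [hne] with σ hσ
    rw [hform]
    refine mul_ne_zero hK (mul_ne_zero (pow_ne_zero _ ?_) ?_)
    · exact_mod_cast Real.sinh_ne_zero.2 hσ
    · exact_mod_cast zonalMoment_ne_zero l μ σ
  · have hsinh : AnalyticAt ℝ (fun σ => (Real.sinh σ : ℂ)) 0 :=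
      (Complex.ofRealCLM.analyticAt _).comp Real.analyticAt_sinh
    exact (analyticAt_const.mul ((hsinh.pow l).mul hana)).congr
      (Eventually.of_forall fun σ => (hform σ).symm)
  · exact_mod_cast zonalMoment_ne_zero l μ 0
  · refine ((isBigO_sinh_pow_mul_sub hana (fun σ => by rw [zonalMoment_neg]) l).const_mul_left
      K).congr_left fun σ => ?_
    rw [hform]
    ring
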